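/- Complex analytic supermanifolds of dimension $1|3$ with underlying manifold $\mathbb{CP}^1$ are considered. Let $U_0,U_1$ be the standard charts of $\mathbb{CP}^1$ with coordinates $x$ and $y=x^{-1}$. For $k\in\mathbb Z$ let $(k,k,k)$ denote the split supermanifold with coordinates $x,\xi_1,\xi_2,\xi_3$ over $U_0$ and $y,\eta_1,\eta_2,\eta_3$ over $U_1$, where $\eta_i=x^{-k}\xi_i$ over $U_0\cap U_1$, let $\mathcal T=\bigoplus_p\mathcal T_p$ be its $\mathbb Z$-graded tangent sheaf, and let $$\mathfrak s''=\langle \mathbf e'',\mathbf f'',[\mathbf e'',\mathbf f'']\rangle\subset H^0(\mathbb{CP}^1,\mathcal T_0),\quad \mathbf e''=\tfrac{\partial}{\partial x}+\xi_2\tfrac{\partial}{\partial \xi_1}+\xi_3\tfrac{\partial}{\partial \xi_2},\quad \mathbf f''=\tfrac{\partial}{\partial y}+2\eta_1\tfrac{\partial}{\partial \eta_2}+2\eta_2\tfrac{\partial}{\partial \eta_3}.$$ A $1$-cocycle of the cover $\{U_0,U_1\}$ with values in $\mathcal T_2$ is a section $v\in\mathcal T_2(U_0\cap U_1)$. A supermanifold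 corresponds to $v$ (and to its class in $H^1(\mathbb{CP}^1,\mathcal T_2)$) if it is obtained by gluing the restrictions of $(k,k,k)$ to $U_0$ and $U_1$ by the automorphism $\mathrm{id}+v$ over $U_0\cap U_1$. A supermanifold with retract $(k,k,k)$ is called $\mathfrak s''$-even-homogeneous if it corresponds to a class $\gamma\in H^1(\mathbb{CP}^1,\mathcal T_2)$ such that $[w,\gamma]=0$ for all $w\in\mathfrak s''$. **Theorem (classification of $\mathfrak s''$-even-homogeneous supermanifolds).** 1. There exists a unique up to isomorphism non-split $\mathfrak s''$-even-homogeneous supermanifold with retract $(2,2,2)$. It corresponds to the cocycle $$\frac{1}{x^3}\xi_1\xi_2\xi_3\frac{\partial}{\partial \xi_3}-\frac{1}{2x^2}\xi_1\xi_2\xi_3\frac{\partial}{\partial \xi_2}+\frac{1}{2x}\xi_1\xi_2\xi_3\frac{\partial}{\partial \xi_1}.$$ 2. There exists a unique up to isomorphism non-split $\mathfrak s''$-even-homogeneous supermanifold with retract $(3,3,3)$. It corresponds to the cocycle $$\frac{1}{x^3}\xi_1\xi_2\frac{\partial}{\partial x}+\frac{1}{2x^2}\xi_1\xi_3\frac{\partial}{\partial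 x}+\frac{1}{2x}\xi_2\xi_3\frac{\partial}{\partial x}+\frac{3}{8x^2}\xi_1\xi_2\xi_3\frac{\partial}{\partial \xi_1}-\frac{3}{4x^3}\xi_1\xi_2\xi_3\frac{\partial}{\partial \xi_2}+\frac{9}{4x^4}\xi_1\xi_2\xi_3\frac{\partial}{\partial \xi_3}.$$ 3. For $k\in\mathbb Z\setminus\{2,3\}$ there is no non-split $\mathfrak s''$-even-homogeneous supermanifold with retract $(k,k,k)$. -/

import Mathlib

noncomputable section

open scoped Topology
open Filter TopologicalSpace CategoryTheory Opposite

namespace CP1Super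

/-! ## The Grassmann algebra -/

/-- The complex Grassmann algebra in the odd generators `ξ₁, …, ξₘ`. -/
abbrev Gr (m : ℕ) : Type := ExteriorAlgebra ℂ (Fin m → ℂ)

variable {m : ℕ}

/-- The odd generator with index `j` (indices start at `0`). -/
def xi (j : Fin m) : Gr m := ExteriorAlgebra.ι ℂ (Pi.single j 1)

/-- The left derivative with respect to the odd generator `xi j`:
the left antiderivation of the Grassmann algebra sending `xi i` to `δᵢⱼ`. -/
def dxi (j : Fin m) : Gr m →ₗ[ℂ] Gr m := CliffordAlgebra.contractLeft (LinearMap.proj j)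

/-- The monomial basis of the Grassmann algebra, indexed by subsets of `{1, …, m}`. -/
def grBasis (m : ℕ) : Module.Basis (Finset (Fin m)) ℂ (Gr m) :=
  (Pi.basisFun ℂ (Fin m)).ExteriorAlgebra

instance grFinite : Module.Finite ℂ (Gr m) := Module.Finite.of_basis (grBasis m)

/-- The component of degree `p` of the Grassmann algebra. -/
abbrev grDeg (m p : ℕ) : Submodule ℂ (Gr m) := ⋀[ℂ]^p (Fin m → ℂ)

/-- The even (`i = 0`) and the odd (`i = 1`) part of the Grassmann algebra. -/
abbrev grPar (m : ℕ) (i : ZMod 2) : Submodule ℂ (Gr m) :=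
  CliffordAlgebra.evenOdd (0 : QuadraticForm ℂ (Fin m → ℂ)) i

lemma dxi_iota_mul (j : Fin m) (v : Fin m → ℂ) (u : Gr m) :
    dxi j (ExteriorAlgebra.ι ℂ v * u) = v j • u - ExteriorAlgebra.ι ℂ v * dxi j u := by
  exact CliffordAlgebra.contractLeft_ι_mul (Q := (0 : QuadraticForm ℂ (Fin m → ℂ))) _ v u

lemma dxi_iota (j : Fin m) (v : Fin m → ℂ) :
    dxi j (ExteriorAlgebra.ι ℂ v) = algebraMap ℂ (Gr m) (v j) := by
  exact CliffordAlgebra.contractLeft_ι (Q := (0 : QuadraticForm ℂ (Fin m → ℂ))) _ v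

lemma dxi_algebraMap (j : Fin m) (r : ℂ) : dxi j (algebraMap ℂ (Gr m) r) = 0 := by
  exact CliffordAlgebra.contractLeft_algebraMap (Q := (0 : QuadraticForm ℂ (Fin m → ℂ))) _ r

lemma dxi_xi (i j : Fin m) : dxi j (xi i) = if i = j then 1 else 0 := by
  rw [xi, dxi_iota, Pi.single_apply]
  by_cases h : i = j
  · simp [h]
  · simp [h, Ne.symm h]

/-- The parity automorphism `u ↦ (-1)^{|u|} u`. -/
abbrev sg : Gr m →ₐ[ℂ] Gr m := CliffordAlgebra.involute

lemma sg_iota (v : Fin m → ℂ) :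
    sg (ExteriorAlgebra.ι ℂ v : Gr m) = -ExteriorAlgebra.ι ℂ v :=
  CliffordAlgebra.involute_ι v

lemma sg_sg (u : Gr m) : sg (sg u) = u := CliffordAlgebra.involute_involute u

lemma dxi_mul (j : Fin m) (u w : Gr m) :
    dxi j (u * w) = dxi j u * w + sg u * dxi j w := by
  induction u using ExteriorAlgebra.induction generalizing w with
  | algebraMap r =>
    rw [dxi_algebraMap, AlgHom.commutes, ← Algebra.smul_def, ← Algebra.smul_def, map_smul]
    simp
  | ι v =>
    rw [dxi_iota_mul, dxi_iota, sg_iota, ← Algebra.smul_def, neg_mul, sub_eq_add_neg]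
  | mul a b ha hb =>
    rw [mul_assoc, ha, hb, ha b, map_mul]
    noncomm_ring
  | add a b ha hb =>
    rw [add_mul, map_add, map_add, map_add, ha, hb]
    noncomm_ring

lemma iota_mul_comm (v : Fin m → ℂ) (u : Gr m) :
    ExteriorAlgebra.ι ℂ v * u = sg u * ExteriorAlgebra.ι ℂ v := by
  induction u using ExteriorAlgebra.induction with
  | algebraMap r => rw [AlgHom.commutes]; exact (Algebra.commutes r _).symm
  | ι w =>
    rw [sg_iota, neg_mul]
    exact eq_neg_of_add_eq_zero_left (ExteriorAlgebra.ι_add_mul_swap v w)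
  | mul a b ha hb => rw [← mul_assoc, ha, mul_assoc, hb, map_mul, mul_assoc]
  | add a b ha hb => rw [mul_add, map_add, add_mul, ha, hb]

lemma grDeg_mul_comm {n : ℕ} {b : Gr m} (hb : b ∈ grDeg m n) (u : Gr m) :
    b * u = (sg^[n] u) * b := by
  induction hb using Submodule.pow_induction_on_left' generalizing u with
  | algebraMap r => exact Algebra.commutes r u
  | add x y i hx hy ihx ihy => rw [add_mul, mul_add, ihx, ihy]
  | mem_mul v hv i x hx ih =>
    obtain ⟨v, rfl⟩ := hv
    rw [mul_assoc, ih, ← mul_assoc, iota_mul_comm, mul_assoc, Function.iterate_succ_apply']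

lemma sg_iterate_even {n : ℕ} (hn : Even n) (u : Gr m) : sg^[n] u = u := by
  have h : Function.Involutive (sg : Gr m → Gr m) := sg_sg
  rw [h.iterate_even hn]
  rfl

lemma even_mul_comm {n : ℕ} (hn : Even n) {b : Gr m} (hb : b ∈ grDeg m n) (u : Gr m) :
    b * u = u * b := by
  rw [grDeg_mul_comm hb, sg_iterate_even hn]

lemma odd_mul_comm {n : ℕ} (hn : Even n) {b : Gr m} (hb : b ∈ grDeg m (n + 1)) (u : Gr m) :
    b * sg u = u * b := by
  rw [grDeg_mul_comm hb, Function.iterate_succ_apply, sg_sg, sg_iterate_even hn]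

lemma grDeg_mul {p q : ℕ} {a b : Gr m} (ha : a ∈ grDeg m p) (hb : b ∈ grDeg m q) :
    a * b ∈ grDeg m (p + q) := by
  simp only [grDeg, ExteriorAlgebra.exteriorPower, pow_add] at *
  exact Submodule.mul_mem_mul ha hb

lemma one_mem_grDeg : (1 : Gr m) ∈ grDeg m 0 := by
  simp only [grDeg, ExteriorAlgebra.exteriorPower, pow_zero]
  exact Submodule.one_le.mp le_rfl

lemma iota_mem_grDeg (v : Fin m → ℂ) : (ExteriorAlgebra.ι ℂ v : Gr m) ∈ grDeg m 1 := by
  simp only [grDeg, ExteriorAlgebra.exteriorPower, pow_one]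
  exact LinearMap.mem_range_self _ v

lemma xi_mem_grDeg (j : Fin m) : xi j ∈ grDeg m 1 := iota_mem_grDeg _

lemma algebraMap_mem_grDeg (r : ℂ) : algebraMap ℂ (Gr m) r ∈ grDeg m 0 := by
  rw [Algebra.algebraMap_eq_smul_one]
  exact Submodule.smul_mem _ _ one_mem_grDeg

/-- `c ∂_{ξⱼ}` with `c` of degree `q + 1` raises the degree by `q`. -/
lemma mul_dxi_mem {n q : ℕ} {c u : Gr m} (hc : c ∈ grDeg m (q + 1)) (hu : u ∈ grDeg m n)
    (j : Fin m) : c * dxi j u ∈ grDeg m (n + q) := by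
  induction hu using Submodule.pow_induction_on_left' generalizing c q with
  | algebraMap r => rw [dxi_algebraMap, mul_zero]; exact Submodule.zero_mem _
  | add x y i hx hy ihx ihy =>
    rw [map_add, mul_add]
    exact Submodule.add_mem _ (ihx hc) (ihy hc)
  | mem_mul v hv i x hx ih =>
    obtain ⟨v, rfl⟩ := hv
    have h1 : c * x ∈ grDeg m (i.succ + q) := by
      have := grDeg_mul hc hx
      rwa [show q + 1 + i = i.succ + q by omega] at this
    have h2 : c * ExteriorAlgebra.ι ℂ v * dxi j x ∈ grDeg m (i.succ + q) := by
      have := ih (q := q + 1) (grDeg_mul hc (iota_mem_grDeg v))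
      rwa [show i + (q + 1) = i.succ + q by omega] at this
    have e : dxi j (ExteriorAlgebra.ι ℂ v * x) = v j • x - ExteriorAlgebra.ι ℂ v * dxi j x :=
      dxi_iota_mul j v x
    rw [e, mul_sub, mul_smul_comm, ← mul_assoc]
    exact Submodule.sub_mem _ (Submodule.smul_mem _ _ h1) h2

/-! ## Holomorphic functions with values in the Grassmann algebra -/

/-- The coefficient of the monomial with index set `s`. -/
def coef (s : Finset (Fin m)) : Gr m →ₗ[ℂ] ℂ := (grBasis m).coord s

lemma sum_coef (u : Gr m) : ∑ s, coef s u • grBasis m s = u := (grBasis m).sum_repr u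

lemma ext_coef {u w : Gr m} (h : ∀ s, coef s u = coef s w) : u = w := by
  rw [← sum_coef u, ← sum_coef w]
  simp only [h]

lemma coef_basis (s t : Finset (Fin m)) : coef s (grBasis m t) = if t = s then 1 else 0 := by
  rw [coef, Module.Basis.coord_apply, Module.Basis.repr_self, Finsupp.single_apply]

/-- A Grassmann algebra valued function is holomorphic at `z` if all its coefficients are. -/
def HolAt (g : ℂ → Gr m) (z : ℂ) : Prop :=
  ∀ s, AnalyticAt ℂ (fun w => coef s (g w)) z

/-- The coefficientwise derivative `∂/∂x` of a Grassmann algebra valued function. -/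
def dx (g : ℂ → Gr m) (z : ℂ) : Gr m :=
  ∑ s, deriv (fun w => coef s (g w)) z • grBasis m s

lemma coef_dx (g : ℂ → Gr m) (z : ℂ) (s : Finset (Fin m)) :
    coef s (dx g z) = deriv (fun w => coef s (g w)) z := by
  simp [dx, coef_basis]

lemma dual_eq (φ : Gr m →ₗ[ℂ] ℂ) (u : Gr m) : φ u = ∑ s, coef s u * φ (grBasis m s) := by
  conv_lhs => rw [← sum_coef u]
  simp

lemma HolAt.dual {g : ℂ → Gr m} {z : ℂ} (hg : HolAt g z) (φ : Gr m →ₗ[ℂ] ℂ) :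
    AnalyticAt ℂ (fun w => φ (g w)) z := by
  rw [show (fun w => φ (g w)) = fun w => ∑ s, coef s (g w) * φ (grBasis m s) from
    funext fun w => dual_eq φ _]
  exact Finset.analyticAt_fun_sum _ fun s _ => (hg s).mul analyticAt_const

lemma HolAt.linear {n : ℕ} {g : ℂ → Gr m} {z : ℂ} (hg : HolAt g z) (L : Gr m →ₗ[ℂ] Gr n) :
    HolAt (fun w => L (g w)) z := fun s => hg.dual (coef s ∘ₗ L)

lemma HolAt.const (u : Gr m) (z : ℂ) : HolAt (fun _ => u) z := fun _ => analyticAt_const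

lemma HolAt.add {g h : ℂ → Gr m} {z : ℂ} (hg : HolAt g z) (hh : HolAt h z) :
    HolAt (fun w => g w + h w) z := fun s => by
  simpa only [map_add] using (hg s).fun_add (hh s)

lemma HolAt.sum {ι : Type} {t : Finset ι} {g : ι → ℂ → Gr m} {z : ℂ}
    (hg : ∀ i ∈ t, HolAt (g i) z) : HolAt (fun w => ∑ i ∈ t, g i w) z := fun s => by
  simpa only [map_sum] using Finset.analyticAt_fun_sum t fun i hi => hg i hi s

lemma HolAt.smul {c : ℂ → ℂ} {h : ℂ → Gr m} {z : ℂ} (hc : AnalyticAt ℂ c z) (hh : HolAt h z) :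
    HolAt (fun w => c w • h w) z := fun s => by
  simpa only [map_smul, smul_eq_mul] using hc.fun_mul (hh s)

lemma mul_expand (u w : Gr m) :
    u * w = ∑ s, coef s u • (grBasis m s * w) := by
  conv_lhs => rw [← sum_coef u]
  rw [Finset.sum_mul]
  simp only [smul_mul_assoc]

lemma HolAt.mul {g h : ℂ → Gr m} {z : ℂ} (hg : HolAt g z) (hh : HolAt h z) :
    HolAt (fun w => g w * h w) z := by
  simp only [fun w => mul_expand (g w) (h w)]
  exact HolAt.sum fun s _ => HolAt.smul (hg s) (hh.linear (LinearMap.mulLeft ℂ (grBasis m s)))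

lemma HolAt.congr {g h : ℂ → Gr m} {z : ℂ} (hg : HolAt g z) (e : ∀ᶠ w in 𝓝 z, g w = h w) :
    HolAt h z := fun s => (hg s).congr (e.mono fun w hw => by simp only [hw])

lemma HolAt.eventually {g : ℂ → Gr m} {z : ℂ} (hg : HolAt g z) : ∀ᶠ w in 𝓝 z, HolAt g w := by
  have : ∀ s, ∀ᶠ w in 𝓝 z, AnalyticAt ℂ (fun w => coef s (g w)) w :=
    fun s => (hg s).eventually_analyticAt
  exact eventually_all.mpr this

lemma HolAt.dx {g : ℂ → Gr m} {z : ℂ} (hg : HolAt g z) : HolAt (dx g) z := fun s => by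
  simp only [coef_dx]
  exact (hg s).deriv

lemma HolAt.comp {g : ℂ → Gr m} {c : ℂ → ℂ} {z : ℂ} (hg : HolAt g (c z))
    (hc : AnalyticAt ℂ c z) : HolAt (fun w => g (c w)) z :=
  fun s => AnalyticAt.fun_comp (g := fun w => coef s (g w)) (hg s) hc

lemma dx_congr {g h : ℂ → Gr m} {z : ℂ} (e : ∀ᶠ w in 𝓝 z, g w = h w) : dx g z = dx h z := by
  simp only [dx]
  refine Finset.sum_congr rfl fun s _ => ?_
  rw [Filter.EventuallyEq.deriv_eq (f := fun w => coef s (h w))]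
  exact e.mono fun w hw => by simp only [hw]

lemma dual_dx {g : ℂ → Gr m} {z : ℂ} (hg : HolAt g z) (φ : Gr m →ₗ[ℂ] ℂ) :
    φ (dx g z) = deriv (fun w => φ (g w)) z := by
  rw [show (fun w => φ (g w)) = fun w => ∑ s, coef s (g w) * φ (grBasis m s) from
    funext fun w => dual_eq φ _, dual_eq φ (dx g z)]
  simp only [coef_dx]
  rw [deriv_fun_sum fun s _ => ((hg s).fun_mul analyticAt_const).differentiableAt]
  refine Finset.sum_congr rfl fun s _ => ?_
  rw [deriv_mul_const (hg s).differentiableAt]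

lemma dx_linear {n : ℕ} {g : ℂ → Gr m} {z : ℂ} (hg : HolAt g z) (L : Gr m →ₗ[ℂ] Gr n) :
    dx (fun w => L (g w)) z = L (dx g z) :=
  ext_coef fun s => by
    rw [coef_dx]
    exact (dual_dx hg (coef s ∘ₗ L)).symm

lemma dx_const (u : Gr m) (z : ℂ) : dx (fun _ => u) z = 0 := by
  simp [dx]

lemma dx_add {g h : ℂ → Gr m} {z : ℂ} (hg : HolAt g z) (hh : HolAt h z) :
    dx (fun w => g w + h w) z = dx g z + dx h z :=
  ext_coef fun s => by
    simp only [coef_dx, map_add]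
    exact deriv_fun_add (hg s).differentiableAt (hh s).differentiableAt

lemma dx_sum {ι : Type} {t : Finset ι} {g : ι → ℂ → Gr m} {z : ℂ}
    (hg : ∀ i ∈ t, HolAt (g i) z) :
    dx (fun w => ∑ i ∈ t, g i w) z = ∑ i ∈ t, dx (g i) z :=
  ext_coef fun s => by
    simp only [coef_dx, map_sum]
    exact deriv_fun_sum fun i hi => (hg i hi s).differentiableAt

lemma dx_smul {c : ℂ → ℂ} {h : ℂ → Gr m} {z : ℂ} (hc : AnalyticAt ℂ c z) (hh : HolAt h z) :
    dx (fun w => c w • h w) z = deriv c z • h z + c z • dx h z :=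
  ext_coef fun s => by
    simp only [coef_dx, map_add, map_smul, smul_eq_mul]
    exact deriv_fun_mul hc.differentiableAt (hh s).differentiableAt

lemma dx_mul {g h : ℂ → Gr m} {z : ℂ} (hg : HolAt g z) (hh : HolAt h z) :
    dx (fun w => g w * h w) z = dx g z * h z + g z * dx h z := by
  simp only [fun w => mul_expand (g w) (h w)]
  have hl : ∀ s, HolAt (fun w => grBasis m s * h w) z :=
    fun s => hh.linear (LinearMap.mulLeft ℂ (grBasis m s))
  rw [dx_sum fun s _ => HolAt.smul (hg s) (hl s)]
  rw [mul_expand (dx g z), mul_expand (g z), ← Finset.sum_add_distrib]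
  refine Finset.sum_congr rfl fun s _ => ?_
  rw [dx_smul (hg s) (hl s), coef_dx]
  congr 2
  exact dx_linear hh (LinearMap.mulLeft ℂ (grBasis m s))

lemma dx_comp {g : ℂ → Gr m} {c : ℂ → ℂ} {z : ℂ} (hg : HolAt g (c z))
    (hc : AnalyticAt ℂ c z) : dx (fun w => g (c w)) z = deriv c z • dx g (c z) :=
  ext_coef fun s => by
    simp only [coef_dx, map_smul, smul_eq_mul]
    have := (hg s).differentiableAt.hasDerivAt.comp z hc.differentiableAt.hasDerivAt
    rw [mul_comm]
    exact this.deriv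

lemma dx_mem {g : ℂ → Gr m} {z : ℂ} (hg : HolAt g z) (S : Submodule ℂ (Gr m))
    (h : ∀ᶠ w in 𝓝 z, g w ∈ S) : dx g z ∈ S := by
  by_contra hn
  obtain ⟨φ, hφ, hS⟩ := Submodule.exists_le_ker_of_notMem hn
  apply hφ
  rw [dual_dx hg φ]
  rw [Filter.EventuallyEq.deriv_eq (f := fun _ => (0 : ℂ))]
  · simp
  · exact h.mono fun w hw => hS hw

/-! ## The split supermanifold `(k₁, …, kₘ)` on the complex projective line -/

/-- The complex projective line, as the Riemann sphere `ℂ ∪ {∞}`. -/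
abbrev CP1 : TopCat.{0} := TopCat.of (OnePoint ℂ)

/-- The point of the projective line with coordinate `x = z`. -/
abbrev pt (z : ℂ) : CP1 := (OnePoint.some z : OnePoint ℂ)

/-- The point of the projective line with coordinate `y = x⁻¹ = 0`. -/
abbrev ptInf : CP1 := (OnePoint.infty : OnePoint ℂ)

/-- The chart domain of the coordinate `x`. -/
def U0 : Opens CP1 := ⟨{ptInf}ᶜ, isOpen_compl_singleton⟩

/-- The chart domain of the coordinate `y = x⁻¹`. -/
def U1 : Opens CP1 := ⟨{pt 0}ᶜ, isOpen_compl_singleton⟩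

/-- The intersection of the two chart domains. -/
def U01 : Opens CP1 := U0 ⊓ U1

/-- The part of the open set `U` that is visible in the chart with coordinate `x`. -/
abbrev Fin0 (U : Opens CP1) : Type := {z : ℂ // pt z ∈ U}

/-- Extension by zero of a function on the `x`-part of `U`. -/
def zext {U : Opens CP1} (f : Fin0 U → Gr m) (z : ℂ) : Gr m :=
  open Classical in if h : pt z ∈ U then f ⟨z, h⟩ else 0

lemma zext_of_mem {U : Opens CP1} (f : Fin0 U → Gr m) {z : ℂ} (h : pt z ∈ U) :
    zext f z = f ⟨z, h⟩ := by
  rw [zext, dif_pos h]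

lemma isOpen_fin0 (U : Opens CP1) : IsOpen {z : ℂ | pt z ∈ U} :=
  U.isOpen.preimage OnePoint.continuous_coe

lemma eventually_fin0 {U : Opens CP1} {z : ℂ} (h : pt z ∈ U) : ∀ᶠ w in 𝓝 z, pt w ∈ U :=
  (isOpen_fin0 U).mem_nhds h

lemma tendsto_inv_inf : Tendsto (fun y : ℂ => pt y⁻¹) (𝓝[≠] 0) (𝓝 ptInf) := by
  have h1 : Tendsto (fun y : ℂ => y⁻¹) (𝓝[≠] 0) (coclosedCompact ℂ) := by
    rw [coclosedCompact_eq_cocompact, ← Metric.cobounded_eq_cocompact]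
    exact tendsto_inv₀_nhdsNE_zero
  exact OnePoint.tendsto_coe_infty.comp h1

lemma eventually_inf {U : Opens CP1} (h : ptInf ∈ U) : ∀ᶠ y : ℂ in 𝓝[≠] 0, pt y⁻¹ ∈ U :=
  tendsto_inv_inf.eventually (U.isOpen.mem_nhds h)

/-- The change of odd coordinates `ηᵢ = x^{-kᵢ} ξᵢ`: the homomorphism of Grassmann algebras that
rewrites a polynomial in the `ηᵢ` as a polynomial in the `ξᵢ`, at the point with coordinate `x`. -/
def trans (k : Fin m → ℤ) (x : ℂ) : Gr m →ₐ[ℂ] Gr m :=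
  ExteriorAlgebra.map (LinearMap.pi fun i => (x ^ (-k i)) • LinearMap.proj i)

lemma trans_iota (k : Fin m → ℤ) (x : ℂ) (v : Fin m → ℂ) :
    trans k x (ExteriorAlgebra.ι ℂ v) = ExteriorAlgebra.ι ℂ (fun i => x ^ (-k i) * v i) := by
  rw [trans, ExteriorAlgebra.map_apply_ι]
  rfl

lemma trans_xi (k : Fin m → ℤ) (x : ℂ) (j : Fin m) :
    trans k x (xi j) = x ^ (-k j) • xi j := by
  rw [xi, trans_iota, ← map_smul]
  congr 1
  ext i
  by_cases h : i = j
  · subst h; simp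
  · simp [h]

lemma trans_sg (k : Fin m → ℤ) (x : ℂ) (u : Gr m) : trans k x (sg u) = sg (trans k x u) := by
  induction u using ExteriorAlgebra.induction with
  | algebraMap r => simp only [AlgHom.commutes]
  | ι v => rw [sg_iota, map_neg, trans_iota, sg_iota]
  | mul a b ha hb => rw [map_mul, map_mul, ha, hb, map_mul, map_mul]
  | add a b ha hb => rw [map_add, map_add, ha, hb, map_add, map_add]

/-- A function on the `x`-part of `U` with values in the Grassmann algebra represents a
superfunction on `U` if it is holomorphic and if moreover, should `U` contain the point `y = 0`, its
expression in the coordinates `y, η₁, …, ηₘ` extends holomorphically to this point. -/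
def IsSection (k : Fin m → ℤ) (U : Opens CP1) (f : Fin0 U → Gr m) : Prop :=
  (∀ z, pt z ∈ U → HolAt (zext f) z) ∧
    (ptInf ∈ U → ∃ g : ℂ → Gr m, HolAt g 0 ∧
      ∀ᶠ y in 𝓝[≠] (0 : ℂ), zext f y⁻¹ = trans k y⁻¹ (g y))

/-- The superalgebra of sections over `U` of the structure sheaf of the split supermanifold
`(k₁, …, kₘ)`, i.e. of the exterior algebra of the sheaf of sections of the vector bundle with
frames `(ξᵢ)` over `U0` and `(ηᵢ)` over `U1`, where `y = x⁻¹` and `ηᵢ = x^{-kᵢ} ξᵢ`. A section is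
given by its expression in the coordinates `x, ξ₁, …, ξₘ`. -/
def Sec (k : Fin m → ℤ) (U : Opens CP1) : Subalgebra ℂ (Fin0 U → Gr m) where
  carrier := {f | IsSection k U f}
  mul_mem' := by
    rintro f g ⟨hf, hf'⟩ ⟨hg, hg'⟩
    have e : ∀ z, zext (f * g) z = zext f z * zext g z := by
      intro z
      by_cases h : pt z ∈ U <;> simp [zext, h]
    refine ⟨fun z hz => ?_, fun hU => ?_⟩
    · exact ((hf z hz).mul (hg z hz)).congr (Eventually.of_forall fun w => (e w).symm)
    · obtain ⟨a, ha, ha'⟩ := hf' hU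
      obtain ⟨b, hb, hb'⟩ := hg' hU
      refine ⟨fun y => a y * b y, ha.mul hb, ?_⟩
      filter_upwards [ha', hb'] with y h1 h2
      rw [e, h1, h2, map_mul]
  add_mem' := by
    rintro f g ⟨hf, hf'⟩ ⟨hg, hg'⟩
    have e : ∀ z, zext (f + g) z = zext f z + zext g z := by
      intro z
      by_cases h : pt z ∈ U <;> simp [zext, h]
    refine ⟨fun z hz => ?_, fun hU => ?_⟩
    · exact ((hf z hz).add (hg z hz)).congr (Eventually.of_forall fun w => (e w).symm)
    · obtain ⟨a, ha, ha'⟩ := hf' hU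
      obtain ⟨b, hb, hb'⟩ := hg' hU
      refine ⟨fun y => a y + b y, ha.add hb, ?_⟩
      filter_upwards [ha', hb'] with y h1 h2
      rw [e, h1, h2, map_add]
  algebraMap_mem' r := by
    refine ⟨fun z hz => ?_, fun hU => ?_⟩
    · refine (HolAt.const (algebraMap ℂ (Gr m) r) z).congr ?_
      filter_upwards [eventually_fin0 hz] with w hw
      rw [zext_of_mem _ hw]
      rfl
    · refine ⟨fun _ => algebraMap ℂ (Gr m) r, HolAt.const _ _, ?_⟩
      filter_upwards [eventually_inf hU] with y hy
      rw [zext_of_mem _ hy, AlgHom.commutes]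
      rfl

lemma zext_res {U V : Opens CP1} (h : V ≤ U) (f : Fin0 U → Gr m) {z : ℂ} (hz : pt z ∈ V) :
    zext (fun w : Fin0 V => f ⟨w.1, h w.2⟩) z = zext f z := by
  rw [zext_of_mem _ hz, zext_of_mem _ (h hz)]

/-- Restriction of sections. -/
def secRes (k : Fin m → ℤ) {U V : Opens CP1} (h : V ≤ U) : Sec k U →ₐ[ℂ] Sec k V where
  toFun f := ⟨fun z => f.1 ⟨z.1, h z.2⟩, by
    obtain ⟨f, hf, hf'⟩ := f
    refine ⟨fun z hz => (hf z (h hz)).congr ?_, fun hV => ?_⟩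
    · filter_upwards [eventually_fin0 hz] with w hw
      exact (zext_res h f hw).symm
    · obtain ⟨g, hg, hg'⟩ := hf' (h hV)
      refine ⟨g, hg, ?_⟩
      filter_upwards [hg', eventually_inf hV] with y h1 h2
      rw [zext_res h f h2, h1]⟩
  map_one' := rfl
  map_mul' _ _ := rfl
  map_zero' := rfl
  map_add' _ _ := rfl
  commutes' _ := rfl

/-- The presheaf of superalgebras `U ↦ Sec k U`. -/
def splitPresheaf (k : Fin m → ℤ) : TopCat.Presheaf (AlgCat.{0} ℂ) CP1 where
  obj U := AlgCat.of ℂ (Sec k U.unop)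
  map i := AlgCat.ofHom (secRes k i.unop.le)
  map_id _ := rfl
  map_comp _ _ := rfl

lemma splitPresheaf_isSheaf (k : Fin m → ℤ) : (splitPresheaf k).IsSheaf := by
  rw [TopCat.Presheaf.isSheaf_iff_isSheafUniqueGluing]
  intro ι U sf hsf
  have hU : ∀ {p : CP1}, p ∈ iSup U → ∃ i, p ∈ U i := fun hp => Opens.mem_iSup.mp hp
  let S : ∀ i, Sec k (U i) := sf
  have hS : ∀ (i j : ι) (z : ℂ) (hi : pt z ∈ U i) (hj : pt z ∈ U j),
      (S i).1 ⟨z, hi⟩ = (S j).1 ⟨z, hj⟩ := by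
    intro i j z hi hj
    have h : (secRes k (inf_le_left : U i ⊓ U j ≤ U i) (S i)) =
      (secRes k (inf_le_right : U i ⊓ U j ≤ U j) (S j)) := hsf i j
    have h2 := congrFun (congrArg Subtype.val h) ⟨z, hi, hj⟩
    exact h2
  let f : Fin0 (iSup U) → Gr m := fun z => (S (hU z.2).choose).1 ⟨z.1, (hU z.2).choose_spec⟩
  have hf : ∀ (i : ι) (z : ℂ) (hi : pt z ∈ U i), zext f z = zext (S i).1 z := by
    intro i z hi
    have hz : pt z ∈ iSup U := (le_iSup U i) hi
    rw [zext_of_mem _ hi, zext_of_mem _ hz]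
    exact hS _ _ _ _ _
  have hsec : IsSection k (iSup U) f := by
    refine ⟨fun z hz => ?_, fun hz => ?_⟩
    · obtain ⟨i, hi⟩ := hU hz
      refine ((S i).2.1 z hi).congr ?_
      filter_upwards [eventually_fin0 hi] with w hw
      exact (hf i w hw).symm
    · obtain ⟨i, hi⟩ := hU hz
      obtain ⟨g, hg, hg'⟩ := (S i).2.2 hi
      refine ⟨g, hg, ?_⟩
      filter_upwards [hg', eventually_inf hi] with y h1 h2
      rw [hf i _ h2, h1]
  refine ⟨(⟨f, hsec⟩ : Sec k (iSup U)), ?_, ?_⟩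
  · intro i
    have : secRes k (le_iSup U i) ⟨f, hsec⟩ = S i := by
      apply Subtype.ext
      funext z
      have h := hf i z.1 z.2
      rw [zext_of_mem _ z.2, zext_of_mem _ ((le_iSup U i) z.2)] at h
      exact h
    exact this
  · intro s hs
    apply Subtype.ext
    funext z
    obtain ⟨i, hi⟩ := hU z.2
    have h : secRes k (le_iSup U i) s = S i := hs i
    have h2 := congrFun (congrArg Subtype.val h) ⟨z.1, hi⟩
    have h3 := hf i z.1 hi
    rw [zext_of_mem _ hi, zext_of_mem _ z.2] at h3
    exact h2.trans h3.symm

/-! ## Sheaves of superalgebras on the projective line and their isomorphisms -/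

/-- A sheaf of complex superalgebras on the projective line. -/
structure SuperSheaf where
  /-- the underlying sheaf of algebras -/
  sheaf : TopCat.Sheaf (AlgCat.{0} ℂ) CP1
  /-- the even and the odd sections -/
  par : ∀ U : Opens CP1, ZMod 2 → Submodule ℂ (sheaf.obj.obj (op U))
  isInternal : ∀ U, DirectSum.IsInternal (par U)
  gradedMonoid : ∀ U, SetLike.GradedMonoid (par U)
  map_par : ∀ {U V : Opens CP1} (h : V ≤ U) (i : ZMod 2), ∀ s ∈ par U i,
    (sheaf.obj.map (homOfLE h).op).hom s ∈ par V i

namespace SuperSheaf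

/-- The algebra of sections over an open set. -/
abbrev Obj (F : SuperSheaf) (U : Opens CP1) : AlgCat.{0} ℂ := F.sheaf.obj.obj (op U)

/-- The restriction homomorphisms. -/
abbrev res (F : SuperSheaf) {U V : Opens CP1} (h : V ≤ U) : F.Obj U →ₐ[ℂ] F.Obj V :=
  (F.sheaf.obj.map (homOfLE h).op).hom

/-- An isomorphism over the open set `U` (covering the identity of `U`) between the restrictions
to `U` of two sheaves of superalgebras. -/
structure IsoOn (U : Opens CP1) (F G : SuperSheaf) where
  equiv : ∀ W : Opens CP1, W ≤ U → (F.Obj W ≃ₐ[ℂ] G.Obj W)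
  natural : ∀ (W W' : Opens CP1) (hW : W ≤ U) (h : W' ≤ W) (s : F.Obj W),
    G.res h (equiv W hW s) = equiv W' (h.trans hW) (F.res h s)
  map_par : ∀ (W : Opens CP1) (hW : W ≤ U) (i : ZMod 2), ∀ s ∈ F.par W i,
    equiv W hW s ∈ G.par W i

end SuperSheaf

/-- The sections of degree `p` of the structure sheaf of `(k₁, …, kₘ)`. -/
def secDeg (k : Fin m → ℤ) (U : Opens CP1) (p : ℕ) : Submodule ℂ (Sec k U) where
  carrier := {f | ∀ z, f.1 z ∈ grDeg m p}
  add_mem' hf hg z := Submodule.add_mem _ (hf z) (hg z)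
  zero_mem' _ := Submodule.zero_mem _
  smul_mem' c _ hf z := Submodule.smul_mem _ c (hf z)

/-- The even and the odd sections of the structure sheaf of `(k₁, …, kₘ)`. -/
def secPar (k : Fin m → ℤ) (U : Opens CP1) (i : ZMod 2) : Submodule ℂ (Sec k U) where
  carrier := {f | ∀ z, f.1 z ∈ grPar m i}
  add_mem' hf hg z := Submodule.add_mem _ (hf z) (hg z)
  zero_mem' _ := Submodule.zero_mem _
  smul_mem' c _ hf z := Submodule.smul_mem _ c (hf z)

lemma isSection_linear {k : Fin m → ℤ} {U : Opens CP1} {f : Fin0 U → Gr m}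
    (hf : IsSection k U f) (L : Gr m →ₗ[ℂ] Gr m)
    (hL : ∀ x u, L (trans k x u) = trans k x (L u)) : IsSection k U (fun z => L (f z)) := by
  have e : ∀ z, zext (fun z => L (f z)) z = L (zext f z) := by
    intro z
    by_cases h : pt z ∈ U <;> simp [zext, h]
  refine ⟨fun z hz => ?_, fun hU => ?_⟩
  · exact ((hf.1 z hz).linear L).congr (Eventually.of_forall fun w => (e w).symm)
  · obtain ⟨g, hg, hg'⟩ := hf.2 hU
    refine ⟨fun y => L (g y), hg.linear L, ?_⟩
    filter_upwards [hg'] with y hy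
    rw [e, hy, hL]

lemma half_add_sg (u : Gr m) : (2⁻¹ : ℂ) • (u + sg u) ∈ grPar m 0 := by
  obtain ⟨a, ha, b, hb, rfl⟩ := Submodule.mem_sup.mp
    ((CliffordAlgebra.evenOdd_isCompl (0 : QuadraticForm ℂ (Fin m → ℂ))).sup_eq_top ▸
      Submodule.mem_top (x := u))
  have h1 : sg a = a := CliffordAlgebra.involute_eq_of_mem_even ha
  have h2 : sg b = -b := CliffordAlgebra.involute_eq_of_mem_odd hb
  have e : (2⁻¹ : ℂ) • (a + b + sg (a + b)) = a := by
    rw [map_add, h1, h2]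
    have : a + b + (a + -b) = (2 : ℂ) • a := by rw [two_smul]; abel
    rw [this, smul_smul]
    norm_num
  rw [e]
  exact ha

lemma half_sub_sg (u : Gr m) : (2⁻¹ : ℂ) • (u - sg u) ∈ grPar m 1 := by
  obtain ⟨a, ha, b, hb, rfl⟩ := Submodule.mem_sup.mp
    ((CliffordAlgebra.evenOdd_isCompl (0 : QuadraticForm ℂ (Fin m → ℂ))).sup_eq_top ▸
      Submodule.mem_top (x := u))
  have h1 : sg a = a := CliffordAlgebra.involute_eq_of_mem_even ha
  have h2 : sg b = -b := CliffordAlgebra.involute_eq_of_mem_odd hb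
  have e : (2⁻¹ : ℂ) • (a + b - sg (a + b)) = b := by
    rw [map_add, h1, h2]
    have : a + b - (a + -b) = (2 : ℂ) • b := by rw [two_smul]; abel
    rw [this, smul_smul]
    norm_num
  rw [e]
  exact hb

lemma secPar_isInternal (k : Fin m → ℤ) (U : Opens CP1) : DirectSum.IsInternal (secPar k U) := by
  have huniv : (Set.univ : Set (ZMod 2)) = {0, 1} := by
    ext i
    simp only [Set.mem_univ, Set.mem_insert_iff, Set.mem_singleton_iff, true_iff]
    revert i
    decide
  rw [DirectSum.isInternal_submodule_iff_isCompl _ zero_ne_one huniv]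
  have hc := CliffordAlgebra.evenOdd_isCompl (0 : QuadraticForm ℂ (Fin m → ℂ))
  refine ⟨?_, ?_⟩
  · rw [Submodule.disjoint_def]
    intro f h0 h1
    apply Subtype.ext
    funext z
    exact Submodule.disjoint_def.mp hc.disjoint _ (h0 z) (h1 z)
  · rw [codisjoint_iff, Submodule.eq_top_iff']
    intro f
    have hsg : IsSection k U (fun z => sg (f.1 z)) :=
      isSection_linear f.2 sg.toLinearMap (fun x u => (trans_sg k x u).symm)
    let σ : Sec k U := ⟨_, hsg⟩
    refine Submodule.mem_sup.mpr ⟨(2⁻¹ : ℂ) • (f + σ), fun z => half_add_sg (f.1 z),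
      (2⁻¹ : ℂ) • (f - σ), fun z => half_sub_sg (f.1 z), ?_⟩
    rw [← smul_add, add_add_sub_cancel, ← two_smul ℂ f, smul_smul]
    norm_num

/-- The structure sheaf of the split supermanifold `(k₁, …, kₘ)`. -/
def split (k : Fin m → ℤ) : SuperSheaf where
  sheaf := ⟨splitPresheaf k, splitPresheaf_isSheaf k⟩
  par U i := secPar k U i
  isInternal U := secPar_isInternal k U
  gradedMonoid _ :=
    { one_mem := fun _ => SetLike.GradedOne.one_mem (A := grPar m)
      mul_mem := fun _ _ _ _ hf hg z =>
        SetLike.GradedMul.mul_mem (A := grPar m) (hf z) (hg z) }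
  map_par h _ _ hs z := hs ⟨z.1, h z.2⟩

/-! ## Supermanifolds, retracts, split supermanifolds -/

/-- The transition map between two trivializations over `U` and `V`. -/
def transition {k : Fin m → ℤ} {F : SuperSheaf} {U V : Opens CP1} (φ : F.IsoOn U (split k))
    (ψ : F.IsoOn V (split k)) (W : Opens CP1) (hU : W ≤ U) (hV : W ≤ V) :
    Sec k W ≃ₐ[ℂ] Sec k W :=
  (φ.equiv W hU).symm.trans (ψ.equiv W hV)

/-- `F` is the structure sheaf of a complex supermanifold of dimension `1|m` with underlying
manifold `CP1`: it is locally isomorphic to the sheaf of holomorphic functions with values in the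
Grassmann algebra in `m` generators, which is the structure sheaf of `(0, …, 0)`. -/
def IsSupermanifold (m : ℕ) (F : SuperSheaf) : Prop :=
  ∀ p : CP1, ∃ U : Opens CP1, p ∈ U ∧ Nonempty (F.IsoOn U (split (0 : Fin m → ℤ)))

/-- `F` is a split supermanifold of dimension `1|m`, i.e. it is isomorphic to the exterior algebra
of the sheaf of sections of a vector bundle of rank `m` on `CP1`: it has an atlas whose transition
maps preserve the `ℤ`-grading of the Grassmann algebra valued functions, so that they are induced
by the transition functions of a vector bundle. -/
def IsSplit (m : ℕ) (F : SuperSheaf) : Prop :=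
  ∃ (ι : Type) (U : ι → Opens CP1) (φ : ∀ i, F.IsoOn (U i) (split (0 : Fin m → ℤ))),
    (∀ p : CP1, ∃ i, p ∈ U i) ∧
    ∀ (i j : ι) (W : Opens CP1) (hi : W ≤ U i) (hj : W ≤ U j) (p : ℕ),
      ∀ f ∈ secDeg (0 : Fin m → ℤ) W p,
        transition (φ i) (φ j) W hi hj f ∈ secDeg (0 : Fin m → ℤ) W p

/-- The sections whose components of degree less than `p` vanish: the `p`-th power of the ideal
generated by the odd sections. -/
def secFil (k : Fin m → ℤ) (U : Opens CP1) (p : ℕ) : Submodule ℂ (Sec k U) where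
  carrier := {f | ∀ z, f.1 z ∈ ⨆ q : {q : ℕ // p ≤ q}, grDeg m q.1}
  add_mem' hf hg z := Submodule.add_mem _ (hf z) (hg z)
  zero_mem' _ := Submodule.zero_mem _
  smul_mem' c _ hf z := Submodule.smul_mem _ c (hf z)

/-- `F` has the retract `(k₁, …, kₘ)`, i.e. the graded sheaf associated with the filtration of `F`
by the powers of the ideal generated by the odd sections is isomorphic to the structure sheaf of
`(k₁, …, kₘ)`: there are an open cover and isomorphisms of `F` with this sheaf over the members
of the cover, such that the transition maps induce the identity of the associated graded sheaf. -/
def HasRetract (k : Fin m → ℤ) (F : SuperSheaf) : Prop :=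
  ∃ (ι : Type) (U : ι → Opens CP1) (φ : ∀ i, F.IsoOn (U i) (split k)),
    (∀ p : CP1, ∃ i, p ∈ U i) ∧
    ∀ (i j : ι) (W : Opens CP1) (hi : W ≤ U i) (hj : W ≤ U j) (p : ℕ),
      ∀ f ∈ secFil k W p,
        transition (φ i) (φ j) W hi hj f - f ∈ secFil k W (p + 1)

/-! ## The tangent sheaf of a split supermanifold and its first cohomology -/

/-- Families of linear operators on the sections over the open subsets of `V`. -/
def OpFam (k : Fin m → ℤ) (V : Opens CP1) : Type :=
  ∀ W : {W : Opens CP1 // W ≤ V}, Sec k W.1 →ₗ[ℂ] Sec k W.1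

instance (k : Fin m → ℤ) (V : Opens CP1) : AddCommGroup (OpFam k V) :=
  inferInstanceAs (AddCommGroup (∀ W : {W : Opens CP1 // W ≤ V}, Sec k W.1 →ₗ[ℂ] Sec k W.1))

instance (k : Fin m → ℤ) (V : Opens CP1) : Module ℂ (OpFam k V) :=
  inferInstanceAs (Module ℂ (∀ W : {W : Opens CP1 // W ≤ V}, Sec k W.1 →ₗ[ℂ] Sec k W.1))

lemma OpFam.add_apply {k : Fin m → ℤ} {V : Opens CP1} (D E : OpFam k V)
    (W : {W : Opens CP1 // W ≤ V}) (f : Sec k W.1) : (D + E) W f = D W f + E W f := rfl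

lemma OpFam.smul_apply {k : Fin m → ℤ} {V : Opens CP1} (c : ℂ) (D : OpFam k V)
    (W : {W : Opens CP1 // W ≤ V}) (f : Sec k W.1) : (c • D) W f = c • D W f := rfl

lemma OpFam.zero_apply {k : Fin m → ℤ} {V : Opens CP1}
    (W : {W : Opens CP1 // W ≤ V}) (f : Sec k W.1) : (0 : OpFam k V) W f = 0 := rfl

lemma OpFam.ext {k : Fin m → ℤ} {V : Opens CP1} {D E : OpFam k V}
    (h : ∀ (W : {W : Opens CP1 // W ≤ V}) (f : Sec k W.1), D W f = E W f) : D = E :=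
  funext fun W => LinearMap.ext (h W)

/-- The sections over `V` of the component of degree `p` of the tangent sheaf of `(k₁, …, kₘ)`,
for **even** `p`: the derivations of the structure sheaf over `V` that raise the degree by `p`.
(For even `p` the sign in the Leibniz rule of superderivations is `+`.) -/
def Vect (k : Fin m → ℤ) (p : ℕ) (V : Opens CP1) : Submodule ℂ (OpFam k V) where
  carrier := {D |
    (∀ (W W' : {W : Opens CP1 // W ≤ V}) (h : W'.1 ≤ W.1) (f : Sec k W.1),
      secRes k h (D W f) = D W' (secRes k h f)) ∧
    (∀ (W : {W : Opens CP1 // W ≤ V}) (f g : Sec k W.1), D W (f * g) = D W f * g + f * D W g) ∧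
    (∀ (W : {W : Opens CP1 // W ≤ V}) (n : ℕ), ∀ f ∈ secDeg k W.1 n,
      D W f ∈ secDeg k W.1 (n + p))}
  add_mem' := by
    rintro D E ⟨h1, h2, h3⟩ ⟨h1', h2', h3'⟩
    refine ⟨fun W W' h f => ?_, fun W f g => ?_, fun W n f hf => ?_⟩
    · simp only [OpFam.add_apply, map_add, h1 W W' h f, h1' W W' h f]
    · simp only [OpFam.add_apply, h2, h2']
      noncomm_ring
    · exact Submodule.add_mem _ (h3 W n f hf) (h3' W n f hf)
  zero_mem' := by
    refine ⟨fun W W' h f => ?_, fun W f g => ?_, fun W n f hf => ?_⟩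
    · simp only [OpFam.zero_apply, map_zero]
    · simp only [OpFam.zero_apply, zero_mul, mul_zero, add_zero]
    · exact Submodule.zero_mem _
  smul_mem' := by
    rintro c D ⟨h1, h2, h3⟩
    refine ⟨fun W W' h f => ?_, fun W f g => ?_, fun W n f hf => ?_⟩
    · simp only [OpFam.smul_apply, map_smul, h1 W W' h f]
    · simp only [OpFam.smul_apply, h2, smul_add, smul_mul_assoc, mul_smul_comm]
    · exact Submodule.smul_mem _ c (h3 W n f hf)

/-- Restriction of vector fields. -/
def vectRes (k : Fin m → ℤ) (p : ℕ) {V V' : Opens CP1} (h : V' ≤ V) :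
    Vect k p V →ₗ[ℂ] Vect k p V' where
  toFun D := ⟨fun W => D.1 ⟨W.1, W.2.trans h⟩,
    fun W W' h' f => D.2.1 ⟨W.1, W.2.trans h⟩ ⟨W'.1, W'.2.trans h⟩ h' f,
    fun W f g => D.2.2.1 ⟨W.1, W.2.trans h⟩ f g,
    fun W n f hf => D.2.2.2 ⟨W.1, W.2.trans h⟩ n f hf⟩
  map_add' _ _ := rfl
  map_smul' _ _ := rfl

/-- The commutator of a vector field of degree `0` and a vector field of degree `p`. -/
def bracket {k : Fin m → ℤ} {p : ℕ} {V : Opens CP1} (w : Vect k 0 V) :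
    Vect k p V →ₗ[ℂ] Vect k p V where
  toFun D := ⟨fun W => w.1 W ∘ₗ D.1 W - D.1 W ∘ₗ w.1 W, by
    obtain ⟨w, h1, h2, h3⟩ := w
    obtain ⟨D, h1', h2', h3'⟩ := D
    refine ⟨fun W W' h f => ?_, fun W f g => ?_, fun W n f hf => ?_⟩
    · simp only [LinearMap.sub_apply, LinearMap.comp_apply, map_sub, h1 W W' h, h1' W W' h]
    · simp only [LinearMap.sub_apply, LinearMap.comp_apply, h2, h2', map_add, sub_mul, mul_sub]
      abel
    · exact Submodule.sub_mem _ (h3 W (n + p) _ (h3' W n f hf)) (h3' W (n + 0) _ (h3 W n f hf))⟩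
  map_add' D E := by
    apply Subtype.ext
    refine OpFam.ext fun W f => ?_
    change w.1 W (D.1 W f + E.1 W f) - (D.1 W (w.1 W f) + E.1 W (w.1 W f)) =
      (w.1 W (D.1 W f) - D.1 W (w.1 W f)) + (w.1 W (E.1 W f) - E.1 W (w.1 W f))
    rw [map_add]
    abel
  map_smul' c D := by
    apply Subtype.ext
    refine OpFam.ext fun W f => ?_
    change w.1 W (c • D.1 W f) - c • D.1 W (w.1 W f) =
      c • (w.1 W (D.1 W f) - D.1 W (w.1 W f))
    rw [map_smul, smul_sub]

/-- The coboundaries for the open cover `{U0, U1}` with values in the component of degree `2` of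
the tangent sheaf. -/
def B1 (k : Fin m → ℤ) : Submodule ℂ (Vect k 2 U01) :=
  LinearMap.range (vectRes k 2 (inf_le_left : U01 ≤ U0)) ⊔
    LinearMap.range (vectRes k 2 (inf_le_right : U01 ≤ U1))

/-- The first cohomology of the component of degree `2` of the tangent sheaf, computed as Čech
cohomology of the cover `{U0, U1}` (a `1`-cocycle is a vector field on `U01`). -/
abbrev H1 (k : Fin m → ℤ) : Type := Vect k 2 U01 ⧸ B1 k

/-- The action `γ ↦ [w, γ]` of global vector fields of degree `0` on the cohomology. -/
def H1.ad {k : Fin m → ℤ} (w : Vect k 0 ⊤) : H1 k →ₗ[ℂ] H1 k :=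
  Submodule.mapQ (B1 k) (B1 k) (bracket (vectRes k 0 le_top w)) (by
    rw [B1, sup_le_iff]
    constructor
    · rintro _ ⟨D, rfl⟩
      exact Submodule.mem_sup_left ⟨bracket (vectRes k 0 le_top w) D, rfl⟩
    · rintro _ ⟨D, rfl⟩
      exact Submodule.mem_sup_right ⟨bracket (vectRes k 0 le_top w) D, rfl⟩)

/-- The subspace of cohomology classes invariant under a space `a` of global vector fields. -/
def H1.invariants {k : Fin m → ℤ} (a : Submodule ℂ (Vect k 0 ⊤)) : Submodule ℂ (H1 k) where
  carrier := {γ | ∀ w ∈ a, H1.ad w γ = 0}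
  add_mem' h h' w hw := by rw [map_add, h w hw, h' w hw, add_zero]
  zero_mem' _ _ := map_zero _
  smul_mem' c _ h w hw := by rw [map_smul, h w hw, smul_zero]

/-- `F` is the supermanifold that the Green theorem assigns to the class of the cocycle `v`: it is
obtained by gluing the restrictions of `(k₁, k₂, k₃)` to `U0` and to `U1` by means of the
automorphism `id + v` over `U01`. -/
def CorrespondsTo {k : Fin 3 → ℤ} (v : Vect k 2 U01) (F : SuperSheaf) : Prop :=
  ∃ (φ₀ : F.IsoOn U0 (split k)) (φ₁ : F.IsoOn U1 (split k)),
    ∀ (W : Opens CP1) (hW : W ≤ U01) (f : Sec k W),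
      transition φ₁ φ₀ W (hW.trans inf_le_right) (hW.trans inf_le_left) f = f + v.1 ⟨W, hW⟩ f

/-- `F` is an `a`-even-homogeneous supermanifold with retract `(k₁, k₂, k₃)`: it corresponds to an
`a`-invariant cohomology class. -/
def IsEvenHomogeneous {k : Fin 3 → ℤ} (a : Submodule ℂ (Vect k 0 ⊤)) (F : SuperSheaf) : Prop :=
  ∃ v : Vect k 2 U01, Submodule.Quotient.mk v ∈ H1.invariants a ∧ CorrespondsTo v F

/-! ## Vector fields in coordinates -/

/-- The operator `a ∂/∂x + ∑ⱼ bⱼ ∂/∂ξⱼ` on functions with values in the Grassmann algebra. -/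
def coordField (a : ℂ → Gr m) (b : Fin m → ℂ → Gr m) (g : ℂ → Gr m) (z : ℂ) : Gr m :=
  a z * dx g z + ∑ j, b j z * dxi j (g z)

/-- The conditions on the coefficients under which `a ∂/∂x + ∑ⱼ bⱼ ∂/∂ξⱼ` is a vector field of
even degree `p` on `V`. The last one says that in the coordinates `y, ηⱼ` it is of the same form,
with coefficients which are holomorphic at `y = 0` if this point is in `V`. -/
structure IsCoordField (k : Fin m → ℤ) (p : ℕ) (V : Opens CP1) (a : ℂ → Gr m)
    (b : Fin m → ℂ → Gr m) : Prop where
  even : Even p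
  a_hol : ∀ z, pt z ∈ V → HolAt a z
  b_hol : ∀ j z, pt z ∈ V → HolAt (b j) z
  a_deg : ∀ z, a z ∈ grDeg m p
  b_deg : ∀ j z, b j z ∈ grDeg m (p + 1)
  inf : ptInf ∈ V → ∃ (a' : ℂ → Gr m) (b' : Fin m → ℂ → Gr m), HolAt a' 0 ∧
    (∀ j, HolAt (b' j) 0) ∧ ∀ g : ℂ → Gr m, HolAt g 0 → ∀ᶠ y in 𝓝[≠] (0 : ℂ),
      coordField a b (fun x => trans k x (g x⁻¹)) y⁻¹ = trans k y⁻¹ (coordField a' b' g y)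

lemma coordField_congr (a : ℂ → Gr m) (b : Fin m → ℂ → Gr m) {g h : ℂ → Gr m} {z : ℂ}
    (e : ∀ᶠ w in 𝓝 z, g w = h w) : coordField a b g z = coordField a b h z := by
  simp only [coordField, dx_congr e, e.self_of_nhds]

lemma HolAt.coordField {a : ℂ → Gr m} {b : Fin m → ℂ → Gr m} {g : ℂ → Gr m} {z : ℂ}
    (ha : HolAt a z) (hb : ∀ j, HolAt (b j) z) (hg : HolAt g z) : HolAt (coordField a b g) z :=
  (ha.mul hg.dx).add (HolAt.sum fun j _ => (hb j).mul (hg.linear (dxi j)))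

lemma coordField_add (a : ℂ → Gr m) (b : Fin m → ℂ → Gr m) {g h : ℂ → Gr m} {z : ℂ}
    (hg : HolAt g z) (hh : HolAt h z) :
    coordField a b (fun w => g w + h w) z = coordField a b g z + coordField a b h z := by
  simp only [coordField, dx_add hg hh, map_add, mul_add, Finset.sum_add_distrib]
  abel

lemma coordField_smul (a : ℂ → Gr m) (b : Fin m → ℂ → Gr m) (c : ℂ) {g : ℂ → Gr m} {z : ℂ}
    (hg : HolAt g z) :
    coordField a b (fun w => c • g w) z = c • coordField a b g z := by
  simp only [coordField, dx_smul (analyticAt_const (v := c)) hg, map_smul, deriv_const, zero_smul,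
    zero_add, mul_smul_comm, smul_add, Finset.smul_sum]

lemma coordField_mul {p : ℕ} (hp : Even p) {a : ℂ → Gr m} {b : Fin m → ℂ → Gr m} {g h : ℂ → Gr m}
    {z : ℂ} (ha : a z ∈ grDeg m p) (hb : ∀ j, b j z ∈ grDeg m (p + 1))
    (hg : HolAt g z) (hh : HolAt h z) :
    coordField a b (fun w => g w * h w) z =
      coordField a b g z * h z + g z * coordField a b h z := by
  have e : ∀ j, b j z * dxi j (g z * h z) =
      b j z * dxi j (g z) * h z + g z * (b j z * dxi j (h z)) := by
    intro j
    rw [dxi_mul, mul_add, ← mul_assoc, ← mul_assoc, odd_mul_comm hp (hb j), mul_assoc (g z)]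
  have e' : a z * (dx g z * h z + g z * dx h z) =
      a z * dx g z * h z + g z * (a z * dx h z) := by
    rw [mul_add, ← mul_assoc, ← mul_assoc, even_mul_comm hp ha (g z), mul_assoc (g z)]
  simp only [coordField, dx_mul hg hh, e, e', Finset.sum_add_distrib, add_mul, mul_add,
    Finset.sum_mul, Finset.mul_sum]
  abel

lemma coordField_mem {p n : ℕ} {a : ℂ → Gr m} {b : Fin m → ℂ → Gr m} {g : ℂ → Gr m}
    {z : ℂ} (ha : a z ∈ grDeg m p) (hb : ∀ j, b j z ∈ grDeg m (p + 1))
    (hg : HolAt g z) (h : ∀ᶠ w in 𝓝 z, g w ∈ grDeg m n) :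
    coordField a b g z ∈ grDeg m (n + p) := by
  refine Submodule.add_mem _ ?_ (Submodule.sum_mem _ fun j _ => mul_dxi_mem (hb j)
    h.self_of_nhds j)
  rw [add_comm]
  exact grDeg_mul ha (dx_mem hg _ h)

lemma isSection_coordField {k : Fin m → ℤ} {p : ℕ} {V W : Opens CP1} (hW : W ≤ V)
    {a : ℂ → Gr m} {b : Fin m → ℂ → Gr m} (h : IsCoordField k p V a b) (f : Sec k W) :
    IsSection k W (fun z => coordField a b (zext f.1) z.1) := by
  obtain ⟨f, hf, hf'⟩ := f
  have e : ∀ z, pt z ∈ W → zext (fun z : Fin0 W => coordField a b (zext f) z.1) z =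
      coordField a b (zext f) z := fun z hz => by rw [zext_of_mem _ hz]
  refine ⟨fun z hz => ?_, fun hi => ?_⟩
  · refine (HolAt.coordField (h.a_hol z (hW hz)) (fun j => h.b_hol j z (hW hz)) (hf z hz)).congr ?_
    filter_upwards [eventually_fin0 hz] with w hw
    exact (e w hw).symm
  · obtain ⟨g, hg, hg'⟩ := hf' hi
    obtain ⟨a', b', ha', hb', hab⟩ := h.inf (hW hi)
    refine ⟨coordField a' b' g, HolAt.coordField ha' hb' hg, ?_⟩
    filter_upwards [hab g hg, eventually_inf hi, eventually_eventually_nhdsWithin.mpr hg',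
      self_mem_nhdsWithin] with y h1 h2 h3 hy
    rw [e _ h2, ← h1]
    apply coordField_congr
    have hy : y ≠ 0 := hy
    have h4 : ∀ᶠ u in 𝓝 y, zext f u⁻¹ = trans k u⁻¹ (g u) := by
      rwa [(isOpen_compl_singleton (x := (0 : ℂ))).nhdsWithin_eq hy] at h3
    have h5 : Tendsto (fun x : ℂ => x⁻¹) (𝓝 y⁻¹) (𝓝 y) := by
      have := tendsto_inv₀ (inv_ne_zero hy)
      rwa [inv_inv] at this
    filter_upwards [h5.eventually h4] with x hx
    rwa [inv_inv] at hx

/-- The vector field `a ∂/∂x + ∑ⱼ bⱼ ∂/∂ξⱼ` on `V`. -/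
def ofCoords {k : Fin m → ℤ} {p : ℕ} {V : Opens CP1} {a : ℂ → Gr m} {b : Fin m → ℂ → Gr m}
    (h : IsCoordField k p V a b) : Vect k p V :=
  ⟨fun W =>
    { toFun := fun f => ⟨fun z => coordField a b (zext f.1) z.1, isSection_coordField W.2 h f⟩
      map_add' := fun f g => by
        apply Subtype.ext
        funext z
        refine Eq.trans (coordField_congr a b ?_)
          (coordField_add a b (f.2.1 z.1 z.2) (g.2.1 z.1 z.2))
        filter_upwards [eventually_fin0 z.2] with w hw
        rw [zext_of_mem _ hw, zext_of_mem _ hw, zext_of_mem _ hw]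
        rfl
      map_smul' := fun c f => by
        apply Subtype.ext
        funext z
        refine Eq.trans (coordField_congr a b ?_) (coordField_smul a b c (f.2.1 z.1 z.2))
        filter_upwards [eventually_fin0 z.2] with w hw
        rw [zext_of_mem _ hw, zext_of_mem _ hw]
        rfl },
    by
      refine ⟨fun W W' hW f => ?_, fun W f g => ?_, fun W n f hf => ?_⟩
      · apply Subtype.ext
        funext z
        refine coordField_congr a b ?_
        filter_upwards [eventually_fin0 z.2] with w hw
        exact (zext_res hW f.1 hw).symm
      · apply Subtype.ext
        funext z
        have e := coordField_mul h.even (h.a_deg z.1) (fun j => h.b_deg j z.1)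
          (f.2.1 z.1 z.2) (g.2.1 z.1 z.2)
        rw [zext_of_mem f.1 z.2, zext_of_mem g.1 z.2] at e
        refine Eq.trans (coordField_congr a b ?_) e
        filter_upwards [eventually_fin0 z.2] with w hw
        rw [zext_of_mem _ hw, zext_of_mem _ hw, zext_of_mem _ hw]
        rfl
      · intro z
        refine coordField_mem (h.a_deg z.1) (fun j => h.b_deg j z.1) (f.2.1 z.1 z.2) ?_
        filter_upwards [eventually_fin0 z.2] with w hw
        rw [zext_of_mem _ hw]
        exact hf ⟨w, hw⟩⟩

/-! ## The subalgebra `s''` and the two cocycles -/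

lemma iota_eq_sum (v : Fin m → ℂ) : (ExteriorAlgebra.ι ℂ v : Gr m) = ∑ i, v i • xi i := by
  simp only [xi, ← map_smul, ← map_sum]
  congr 1
  ext j
  simp [Finset.sum_apply, Pi.single_apply]

/-- The derivation `∑ⱼ bⱼ ∂/∂ξⱼ` of the Grassmann algebra. -/
def oddDer (b : Fin m → Gr m) (u : Gr m) : Gr m := ∑ j, b j * dxi j u

lemma oddDer_add (b : Fin m → Gr m) (u w : Gr m) :
    oddDer b (u + w) = oddDer b u + oddDer b w := by
  simp only [oddDer, map_add, mul_add, Finset.sum_add_distrib]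

lemma oddDer_algebraMap (b : Fin m → Gr m) (r : ℂ) :
    oddDer b (algebraMap ℂ (Gr m) r) = 0 := by
  simp only [oddDer, dxi_algebraMap, mul_zero, Finset.sum_const_zero]

lemma oddDer_iota (b : Fin m → Gr m) (v : Fin m → ℂ) :
    oddDer b (ExteriorAlgebra.ι ℂ v) = ∑ j, v j • b j := by
  simp only [oddDer, dxi_iota]
  refine Finset.sum_congr rfl fun j _ => ?_
  rw [Algebra.smul_def, Algebra.commutes]

lemma oddDer_mul {b : Fin m → Gr m} (hb : ∀ j, b j ∈ grDeg m 1) (u w : Gr m) :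
    oddDer b (u * w) = oddDer b u * w + u * oddDer b w := by
  have e : ∀ j, b j * dxi j (u * w) = b j * dxi j u * w + u * (b j * dxi j w) := by
    intro j
    rw [dxi_mul, mul_add, ← mul_assoc, ← mul_assoc, odd_mul_comm (n := 0) Even.zero (hb j),
      mul_assoc u]
  simp only [oddDer, e, Finset.sum_add_distrib, Finset.sum_mul, Finset.mul_sum]

lemma oddDer_trans {k : Fin m → ℤ} {x : ℂ} {b : Fin m → Gr m} (hb : ∀ j, b j ∈ grDeg m 1)
    (h : ∀ j, trans k x (b j) = x ^ (-k j) • b j) (u : Gr m) :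
    oddDer b (trans k x u) = trans k x (oddDer b u) := by
  induction u using ExteriorAlgebra.induction with
  | algebraMap r => rw [AlgHom.commutes, oddDer_algebraMap, map_zero]
  | ι v =>
    rw [trans_iota, oddDer_iota, oddDer_iota, map_sum]
    refine Finset.sum_congr rfl fun j _ => ?_
    rw [map_smul, h, smul_smul, mul_comm]
  | mul a c ha hc => rw [map_mul, oddDer_mul hb, ha, hc, oddDer_mul hb, map_add, map_mul, map_mul]
  | add a c ha hc => rw [map_add, oddDer_add, ha, hc, oddDer_add, map_add]

/-- The coefficients of the vector field `∑ⱼ kⱼ ξⱼ ∂/∂ξⱼ`. -/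
def eulerCoef (k : Fin m → ℤ) (j : Fin m) : Gr m := (k j : ℂ) • xi j

lemma eulerCoef_mem (k : Fin m → ℤ) (j : Fin m) : eulerCoef k j ∈ grDeg m 1 :=
  Submodule.smul_mem _ _ (xi_mem_grDeg j)

lemma oddDer_euler_trans (k : Fin m → ℤ) (x : ℂ) (u : Gr m) :
    oddDer (eulerCoef k) (trans k x u) = trans k x (oddDer (eulerCoef k) u) :=
  oddDer_trans (eulerCoef_mem k) (fun j => by rw [eulerCoef, map_smul, trans_xi, smul_comm]) u

lemma trans_hol_dx (k : Fin m → ℤ) {z : ℂ} (hz : z ≠ 0) (u : Gr m) :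
    HolAt (fun w => trans k w u) z ∧
      dx (fun w => trans k w u) z = -(z⁻¹ • oddDer (eulerCoef k) (trans k z u)) := by
  induction u using ExteriorAlgebra.induction with
  | algebraMap r =>
    simp only [AlgHom.commutes]
    exact ⟨HolAt.const _ _, by rw [dx_const, oddDer_algebraMap, smul_zero, neg_zero]⟩
  | ι v =>
    have hc : ∀ i, AnalyticAt ℂ (fun w : ℂ => w ^ (-k i) * v i) z := fun i =>
      (analyticAt_id.fun_zpow hz).fun_mul analyticAt_const
    have hh : ∀ i ∈ Finset.univ, HolAt (fun w : ℂ => (w ^ (-k i) * v i) • xi i) z :=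
      fun i _ => HolAt.smul (hc i) (HolAt.const _ _)
    simp only [trans_iota]
    simp only [oddDer_iota]
    simp only [iota_eq_sum]
    refine ⟨HolAt.sum hh, ?_⟩
    rw [dx_sum hh, Finset.smul_sum, ← Finset.sum_neg_distrib]
    refine Finset.sum_congr rfl fun i _ => ?_
    rw [dx_smul (hc i) (HolAt.const _ _), dx_const, smul_zero, add_zero, deriv_mul_const_field,
      deriv_zpow, eulerCoef, smul_smul, smul_smul, ← neg_smul]
    congr 1
    rw [zpow_sub_one₀ hz]
    push_cast
    ring
  | mul a b ha hb =>
    simp only [map_mul]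
    refine ⟨ha.1.mul hb.1, ?_⟩
    rw [dx_mul ha.1 hb.1, ha.2, hb.2, oddDer_mul (eulerCoef_mem k), smul_add, neg_add, neg_mul,
      mul_neg, smul_mul_assoc, mul_smul_comm]
  | add a b ha hb =>
    simp only [map_add]
    refine ⟨ha.1.add hb.1, ?_⟩
    rw [dx_add ha.1 hb.1, ha.2, hb.2, oddDer_add, smul_add, neg_add]

lemma oddDer_sum_smul {ι : Type} (t : Finset ι) (b : Fin m → Gr m) (c : ι → ℂ) (u : ι → Gr m) :
    oddDer b (∑ i ∈ t, c i • u i) = ∑ i ∈ t, c i • oddDer b (u i) := by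
  simp only [oddDer, map_sum, map_smul, Finset.mul_sum, Finset.smul_sum, mul_smul_comm]
  rw [Finset.sum_comm]

lemma dx_trans (k : Fin m → ℤ) {z : ℂ} (hz : z ≠ 0) {G : ℂ → Gr m} (hG : HolAt G z) :
    dx (fun w => trans k w (G w)) z =
      trans k z (dx G z) - z⁻¹ • oddDer (eulerCoef k) (trans k z (G z)) := by
  have e : ∀ w u, trans k w u = ∑ s, coef s u • trans k w (grBasis m s) := fun w u => by
    conv_lhs => rw [← sum_coef u]
    simp only [map_sum, map_smul]
  rw [show (fun w => trans k w (G w)) =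
    fun w => ∑ s, coef s (G w) • trans k w (grBasis m s) from funext fun w => e w _]
  rw [dx_sum fun s _ => HolAt.smul (hG s) (trans_hol_dx k hz (grBasis m s)).1]
  rw [e z (dx G z), e z (G z), oddDer_sum_smul, Finset.smul_sum, ← Finset.sum_sub_distrib]
  refine Finset.sum_congr rfl fun s _ => ?_
  rw [dx_smul (hG s) (trans_hol_dx k hz (grBasis m s)).1, (trans_hol_dx k hz (grBasis m s)).2,
    coef_dx, smul_neg, smul_comm, sub_eq_add_neg]

lemma dx_trans_inv (k : Fin m → ℤ) {y : ℂ} (hy : y ≠ 0) {g : ℂ → Gr m} (hg : HolAt g y) :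
    dx (fun w => trans k w (g w⁻¹)) y⁻¹ =
      -(y ^ 2 • trans k y⁻¹ (dx g y)) - y • oddDer (eulerCoef k) (trans k y⁻¹ (g y)) := by
  have hy' : y⁻¹ ≠ 0 := inv_ne_zero hy
  have hc : AnalyticAt ℂ (fun w : ℂ => w⁻¹) y⁻¹ := analyticAt_id.fun_inv hy'
  have hg' : HolAt g (y⁻¹)⁻¹ := by rwa [inv_inv]
  rw [dx_trans k hy' (HolAt.comp hg' hc), dx_comp hg' hc, deriv_inv, map_smul, inv_inv, neg_smul]
  congr 3
  rw [inv_pow, inv_inv]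

lemma coordField_eq (a : ℂ → Gr m) (b : Fin m → ℂ → Gr m) (g : ℂ → Gr m) (z : ℂ) :
    coordField a b g z = a z * dx g z + oddDer (fun j => b j z) (g z) := rfl

lemma oddDer_coef_add (b c : Fin m → Gr m) (u : Gr m) :
    oddDer (fun j => b j + c j) u = oddDer b u + oddDer c u := by
  simp only [oddDer, add_mul, Finset.sum_add_distrib]

lemma oddDer_coef_smul (r : ℂ) (c : Fin m → Gr m) (u : Gr m) :
    oddDer (fun j => r • c j) u = r • oddDer c u := by
  simp only [oddDer, smul_mul_assoc, Finset.smul_sum]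

/-- The retract `(k, k, k)`. -/
abbrev kkk (k : ℤ) : Fin 3 → ℤ := fun _ => k

/-- The coefficients of `ξ₂ ∂/∂ξ₁ + ξ₃ ∂/∂ξ₂`. -/
def eOdd : Fin 3 → Gr 3 := ![xi 1, xi 2, 0]

/-- The coefficients of `2 ξ₁ ∂/∂ξ₂ + 2 ξ₂ ∂/∂ξ₃`. -/
def fOdd : Fin 3 → Gr 3 := ![0, (2 : ℂ) • xi 0, (2 : ℂ) • xi 1]

lemma eOdd_mem (j : Fin 3) : eOdd j ∈ grDeg 3 1 := by
  fin_cases j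
  · exact xi_mem_grDeg 1
  · exact xi_mem_grDeg 2
  · exact Submodule.zero_mem _

lemma fOdd_mem (j : Fin 3) : fOdd j ∈ grDeg 3 1 := by
  fin_cases j
  · exact Submodule.zero_mem _
  · exact Submodule.smul_mem _ _ (xi_mem_grDeg 0)
  · exact Submodule.smul_mem _ _ (xi_mem_grDeg 1)

lemma eOdd_trans (k : ℤ) (x : ℂ) (j : Fin 3) :
    trans (kkk k) x (eOdd j) = x ^ (-kkk k j) • eOdd j := by
  fin_cases j <;> simp [eOdd, trans_xi]

lemma fOdd_trans (k : ℤ) (x : ℂ) (j : Fin 3) :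
    trans (kkk k) x (fOdd j) = x ^ (-kkk k j) • fOdd j := by
  fin_cases j
  · simp [fOdd]
  · change trans (kkk k) x ((2 : ℂ) • xi 0) = x ^ (-k) • (2 : ℂ) • xi 0
    rw [map_smul, trans_xi, smul_comm]
  · change trans (kkk k) x ((2 : ℂ) • xi 1) = x ^ (-k) • (2 : ℂ) • xi 1
    rw [map_smul, trans_xi, smul_comm]

lemma trans_hol_eventually {g : ℂ → Gr m} (hg : HolAt g 0) :
    ∀ᶠ y in 𝓝[≠] (0 : ℂ), y ≠ 0 ∧ HolAt g y := by
  filter_upwards [self_mem_nhdsWithin, hg.eventually.filter_mono nhdsWithin_le_nhds] with y h1 h2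
  exact ⟨h1, h2⟩

lemma isCoordField_e (k : ℤ) :
    IsCoordField (kkk k) 0 ⊤ (fun _ => 1) (fun j _ => eOdd j) where
  even := Even.zero
  a_hol _ _ := HolAt.const _ _
  b_hol _ _ _ := HolAt.const _ _
  a_deg _ := one_mem_grDeg
  b_deg j _ := eOdd_mem j
  inf _ := by
    refine ⟨fun y => (-y ^ 2 : ℂ) • 1, fun j y => eOdd j + (-y : ℂ) • eulerCoef (kkk k) j,
      HolAt.smul (by fun_prop) (HolAt.const _ _),
      fun j => (HolAt.const _ _).add (HolAt.smul (by fun_prop) (HolAt.const _ _)),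
      fun g hg => ?_⟩
    filter_upwards [trans_hol_eventually hg] with y ⟨hy, hgy⟩
    rw [coordField_eq, coordField_eq, dx_trans_inv _ hy hgy, inv_inv, oddDer_coef_add,
      oddDer_coef_smul, oddDer_trans eOdd_mem (eOdd_trans k _), oddDer_euler_trans]
    simp only [map_add, map_smul, one_mul, smul_mul_assoc, neg_smul, map_neg, neg_mul]
    abel

/-- In the coordinates `y, η₁, η₂, η₃` the operator `-x² ∂/∂x - k x ∑ⱼ ξⱼ ∂/∂ξⱼ + 2 ξ₁ ∂/∂ξ₂ +
2 ξ₂ ∂/∂ξ₃` is `∂/∂y + 2 η₁ ∂/∂η₂ + 2 η₂ ∂/∂η₃`. -/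
lemma f_in_chart1 (k : ℤ) {g : ℂ → Gr 3} {y : ℂ} (hy : y ≠ 0) (hgy : HolAt g y) :
    coordField (fun x => (-x ^ 2 : ℂ) • 1) (fun j x => (-(k * x) : ℂ) • xi j + fOdd j)
        (fun x => trans (kkk k) x (g x⁻¹)) y⁻¹ =
      trans (kkk k) y⁻¹ (coordField (fun _ => 1) (fun j _ => fOdd j) g y) := by
  have e : (fun j => (-(k * y⁻¹) : ℂ) • xi j + fOdd j) =
      fun j => (-y⁻¹ : ℂ) • eulerCoef (kkk k) j + fOdd j := by
    funext j
    rw [eulerCoef, smul_smul]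
    congr 2
    ring
  rw [coordField_eq, coordField_eq, dx_trans_inv _ hy hgy, inv_inv, e, oddDer_coef_add,
    oddDer_coef_smul, oddDer_trans fOdd_mem (fOdd_trans k _)]
  simp only [map_add, one_mul, smul_mul_assoc, smul_sub, smul_neg, smul_smul]
  have h1 : -(y⁻¹) ^ 2 * y ^ 2 = -1 := by field_simp
  have h2 : -(y⁻¹) ^ 2 * y = -y⁻¹ := by field_simp
  rw [h1, h2]
  simp only [neg_smul, one_smul, neg_neg]
  abel

lemma isCoordField_f (k : ℤ) :
    IsCoordField (kkk k) 0 ⊤ (fun x => (-x ^ 2 : ℂ) • 1)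
      (fun j x => (-(k * x) : ℂ) • xi j + fOdd j) where
  even := Even.zero
  a_hol _ _ := HolAt.smul (by fun_prop) (HolAt.const _ _)
  b_hol _ _ _ := (HolAt.smul (by fun_prop) (HolAt.const _ _)).add (HolAt.const _ _)
  a_deg _ := Submodule.smul_mem _ _ one_mem_grDeg
  b_deg j _ := Submodule.add_mem _ (Submodule.smul_mem _ _ (xi_mem_grDeg j)) (fOdd_mem j)
  inf _ := by
    refine ⟨fun _ => 1, fun j _ => fOdd j, HolAt.const _ _, fun j => HolAt.const _ _,
      fun g hg => ?_⟩
    filter_upwards [trans_hol_eventually hg] with y ⟨hy, hgy⟩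
    exact f_in_chart1 k hy hgy

/-- The global vector field `e'' = ∂/∂x + ξ₂ ∂/∂ξ₁ + ξ₃ ∂/∂ξ₂` on `(k, k, k)`. -/
def eField (k : ℤ) : Vect (kkk k) 0 ⊤ := ofCoords (isCoordField_e k)

/-- The global vector field `f'' = ∂/∂y + 2 η₁ ∂/∂η₂ + 2 η₂ ∂/∂η₃` on `(k, k, k)`, written as
`-x² ∂/∂x - k x ∑ⱼ ξⱼ ∂/∂ξⱼ + 2 ξ₁ ∂/∂ξ₂ + 2 ξ₂ ∂/∂ξ₃` in the coordinates `x, ξ₁, ξ₂, ξ₃`. -/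
def fField (k : ℤ) : Vect (kkk k) 0 ⊤ := ofCoords (isCoordField_f k)

/-- The subalgebra `s''` spanned by `e''`, `f''` and `h'' = [e'', f'']`. -/
def sPP (k : ℤ) : Submodule ℂ (Vect (kkk k) 0 ⊤) :=
  Submodule.span ℂ {eField k, fField k, bracket (eField k) (fField k)}

lemma ne_zero_of_mem {z : ℂ} (h : pt z ∈ U01) : z ≠ 0 := fun h0 => h.2 (congrArg pt h0)

lemma ptInf_notMem : ptInf ∉ U01 := fun h => h.1 rfl

lemma hol_zpow {z : ℂ} (hz : z ≠ 0) (c : ℂ) (n : ℤ) (u : Gr m) :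
    HolAt (fun x : ℂ => (c * x ^ n) • u) z :=
  HolAt.smul (analyticAt_const.fun_mul (analyticAt_id.fun_zpow hz)) (HolAt.const _ _)

lemma xi_mul_mem (i j : Fin 3) : xi i * xi j ∈ grDeg 3 2 :=
  grDeg_mul (xi_mem_grDeg i) (xi_mem_grDeg j)

/-- The product `ξ₁ ξ₂ ξ₃`. -/
def xi123 : Gr 3 := xi 0 * xi 1 * xi 2

lemma xi123_mem : xi123 ∈ grDeg 3 3 := grDeg_mul (xi_mul_mem 0 1) (xi_mem_grDeg 2)

lemma isCoordField_cocycle1 (k : Fin 3 → ℤ) :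
    IsCoordField k 2 U01 (fun _ => 0)
      ![fun x => (1 / 2 * x ^ (-1 : ℤ) : ℂ) • xi123,
        fun x => (-1 / 2 * x ^ (-2 : ℤ) : ℂ) • xi123,
        fun x => (1 * x ^ (-3 : ℤ) : ℂ) • xi123] where
  even := even_two
  a_hol _ _ := HolAt.const _ _
  b_hol j z hz := by
    fin_cases j <;> exact hol_zpow (ne_zero_of_mem hz) _ _ _
  a_deg _ := Submodule.zero_mem _
  b_deg j z := by
    fin_cases j <;> exact Submodule.smul_mem _ _ xi123_mem
  inf h := absurd h ptInf_notMem

lemma isCoordField_cocycle2 (k : Fin 3 → ℤ) :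
    IsCoordField k 2 U01
      (fun x => (1 * x ^ (-3 : ℤ) : ℂ) • (xi 0 * xi 1) + (1 / 2 * x ^ (-2 : ℤ) : ℂ) • (xi 0 * xi 2)
        + (1 / 2 * x ^ (-1 : ℤ) : ℂ) • (xi 1 * xi 2))
      ![fun x => (3 / 8 * x ^ (-2 : ℤ) : ℂ) • xi123,
        fun x => (-3 / 4 * x ^ (-3 : ℤ) : ℂ) • xi123,
        fun x => (9 / 4 * x ^ (-4 : ℤ) : ℂ) • xi123] where
  even := even_two
  a_hol z hz := ((hol_zpow (ne_zero_of_mem hz) _ _ _).add (hol_zpow (ne_zero_of_mem hz) _ _ _)).add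
    (hol_zpow (ne_zero_of_mem hz) _ _ _)
  b_hol j z hz := by
    fin_cases j <;> exact hol_zpow (ne_zero_of_mem hz) _ _ _
  a_deg _ := Submodule.add_mem _ (Submodule.add_mem _ (Submodule.smul_mem _ _ (xi_mul_mem 0 1))
    (Submodule.smul_mem _ _ (xi_mul_mem 0 2))) (Submodule.smul_mem _ _ (xi_mul_mem 1 2))
  b_deg j z := by
    fin_cases j <;> exact Submodule.smul_mem _ _ xi123_mem
  inf h := absurd h ptInf_notMem

/-- The cocycle `x⁻³ ξ₁ξ₂ξ₃ ∂/∂ξ₃ - ½ x⁻² ξ₁ξ₂ξ₃ ∂/∂ξ₂ + ½ x⁻¹ ξ₁ξ₂ξ₃ ∂/∂ξ₁` on `(2, 2, 2)`. -/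
def cocycle1 : Vect (kkk 2) 2 U01 := ofCoords (isCoordField_cocycle1 (kkk 2))

/-- The cocycle `x⁻³ ξ₁ξ₂ ∂/∂x + ½ x⁻² ξ₁ξ₃ ∂/∂x + ½ x⁻¹ ξ₂ξ₃ ∂/∂x + ⅜ x⁻² ξ₁ξ₂ξ₃ ∂/∂ξ₁
- ¾ x⁻³ ξ₁ξ₂ξ₃ ∂/∂ξ₂ + (9/4) x⁻⁴ ξ₁ξ₂ξ₃ ∂/∂ξ₃` on `(3, 3, 3)`. -/
def cocycle2 : Vect (kkk 3) 2 U01 := ofCoords (isCoordField_cocycle2 (kkk 3))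

/-- `F` is a non-split `s''`-even-homogeneous supermanifold with retract `(k, k, k)`. -/
def IsNonsplitSPP (k : ℤ) (F : SuperSheaf) : Prop :=
  IsSupermanifold 3 F ∧ HasRetract (kkk k) F ∧ ¬ IsSplit 3 F ∧ IsEvenHomogeneous (sPP k) F

/-- `F` and `G` are isomorphic by an isomorphism covering the identity of `CP1`. -/
def Isomorphic (F G : SuperSheaf) : Prop := Nonempty (F.IsoOn ⊤ G)

end CP1Super

end

/-! The theorem reduces to a computation of the `s''`-invariants in the first cohomology of the
degree 2 part of the tangent sheaf, together with a dictionary between cohomology classes and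
isomorphism types. Indices of odd coordinates start at 0 below.

The computation. On `U01` a vector field of degree 2 has six components, all holomorphic on the
punctured plane: the coefficients a_l of `om l` ∂/∂x and the coefficients b_j of `xi123` ∂/∂ξ_j
(`vect_apply`, `vect_ext_comp`). A field on `U0` has entire components. A field on `U1` has a_j =
x^(2-2k) p_j(1/x) and b_j = x^(-2k) q_j(1/x) + k ε_j x^(1-2k) p_j(1/x) with p_j, q_j entire and ε_j
a sign; the mixed term comes from the change of odd coordinates. With the Laurent decomposition this
makes the cohomology explicit. For k ≤ 1 every cocycle is a coboundary (`mem_B1_of_le_one`). For k ≥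
2 a cocycle is a coboundary iff its a-coefficients vanish in degrees strictly between 2-2k and 0,
its b-coefficients vanish in degrees strictly between 1-2k and 0, and for each j one boundary
relation ties b_j in degree 1-2k to a_j in degree 2-2k (`mem_B1_iff_coef`).

The field h'' = [e'', f''] acts diagonally on Laurent coefficients. In an invariant class the
coefficients of nonzero weight therefore vanish in these ranges, which leaves a_0, a_1, a_2 in
degrees 2-k, 1-k, -k and b_0, b_1, b_2 in degrees 1-k, -k, -k-1. Invariance under e'' links each of
these to the next one in its triple. For k ≥ 4 both chains end at an equation inside the range, and
everything vanishes (`mem_B1_of_four_le`). For k = 3 the last equation of the a-chain is lost and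
that of the b-chain becomes a boundary relation, so all coefficients are multiples of a_2 in degree
-3. For k = 2 the a-part dies, and the one free parameter is the defect of the boundary relation for
j = 2. In the last two cases the invariants are spanned by the given cocycle
(`exists_sub_smul_cocycle1_mem_B1`, `exists_sub_smul_cocycle2_mem_B1`).

The dictionary. The Grassmann algebra has nothing above degree 3, so composites and products of
degree 2 derivations vanish and id + v is an automorphism that depends additively on v. Cohomologous
cocycles thus give isomorphic supermanifolds, and a dilation of the odd coordinates rescales a
cocycle by any nonzero constant (`isomorphic_of_correspondsTo`); a line of invariants contributes
one isomorphism type besides the split one. Conversely, a split supermanifold has zero class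
(`mem_B1_of_isSplit`): its local Euler operators glue to a global derivation, which in the chart
over U_i reads E + u_i with u_i of degree 2, and [E, v] = 2v yields v = (u_1 - u_0)/2. Existence is
provided by an explicit gluing (`glued`). -/

noncomputable section

open scoped Topology
open Filter TopologicalSpace CategoryTheory Opposite

namespace CP1Super

variable {m : ℕ}

section

/-! ## Laurent coefficients of holomorphic functions on the punctured plane -/

/-- Holomorphic functions on the punctured plane. -/
abbrev HolPunct (f : ℂ → ℂ) : Prop := DifferentiableOn ℂ f {0}ᶜ

lemma HolPunct.at {f : ℂ → ℂ} (hf : HolPunct f) {z : ℂ} (hz : z ≠ 0) : DifferentiableAt ℂ f z :=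
  hf.differentiableAt (isOpen_compl_singleton.mem_nhds hz)

lemma holPunct_of_at {f : ℂ → ℂ} (hf : ∀ z ≠ 0, DifferentiableAt ℂ f z) : HolPunct f :=
  fun z hz => (hf z hz).differentiableWithinAt

lemma HolPunct.zpow_mul {f : ℂ → ℂ} (hf : HolPunct f) (n : ℤ) : HolPunct fun z => z ^ n * f z :=
  holPunct_of_at fun _ hz => (differentiableAt_zpow.mpr (Or.inl hz)).mul (hf.at hz)

lemma HolPunct.comp_inv {f : ℂ → ℂ} (hf : HolPunct f) : HolPunct fun z => f z⁻¹ :=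
  holPunct_of_at fun z hz =>
    DifferentiableAt.fun_comp' (g := f) z (hf.at (inv_ne_zero hz)) (differentiableAt_inv hz)

lemma HolPunct.deriv {f : ℂ → ℂ} (hf : HolPunct f) : HolPunct (deriv f) :=
  DifferentiableOn.deriv hf isOpen_compl_singleton

lemma holPunct_of_entire {f : ℂ → ℂ} (hf : Differentiable ℂ f) : HolPunct f :=
  hf.differentiableOn

lemma ne_zero_of_sphere {z : ℂ} {R : ℝ} (hR : 0 < R) (hz : z ∈ Metric.sphere (0 : ℂ) R) :
    z ≠ 0 := by
  rintro rfl
  rw [Metric.mem_sphere, dist_self] at hz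
  exact hR.ne hz

lemma HolPunct.circleIntegrable {f : ℂ → ℂ} (hf : HolPunct f) {R : ℝ} (hR : 0 < R) :
    CircleIntegrable f 0 R :=
  (hf.continuousOn.mono fun _ hz => ne_zero_of_sphere hR hz).circleIntegrable hR.le

/-- Substitution of 1/z on the unit circle, that is θ ↦ 2π - θ: the reversed orientation cancels the
sign in d(1/z) = -z⁻² dz. It carries statements at 0 over to ∞. -/
lemma circleIntegral_inv_eq (F : ℂ → ℂ) :
    (∮ z in C(0, 1), F z) = ∮ z in C(0, 1), z ^ (-2 : ℤ) * F z⁻¹ := by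
  have hc : ∀ θ : ℝ, circleMap 0 1 (2 * Real.pi - θ) = (circleMap 0 1 θ)⁻¹ := fun θ => by
    simp only [circleMap_zero, Complex.ofReal_one, one_mul, ← Complex.exp_neg]
    rw [Complex.exp_eq_exp_iff_exists_int]
    exact ⟨1, by push_cast; ring⟩
  have h0 : ∀ θ : ℝ, circleMap 0 1 θ ≠ 0 := fun θ => circleMap_ne_center one_ne_zero
  simp only [circleIntegral, deriv_circleMap, smul_eq_mul]
  have := intervalIntegral.integral_comp_sub_left (a := 0) (b := 2 * Real.pi)
    (fun θ => circleMap 0 1 θ * Complex.I * F (circleMap 0 1 θ)) (2 * Real.pi)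
  rw [sub_self, sub_zero] at this
  rw [← this]
  refine intervalIntegral.integral_congr fun θ _ => ?_
  simp only [hc]
  have := h0 θ
  field_simp

/-- The coefficient of `zⁿ` in the Laurent series of `f` on the punctured plane. -/
def laurentCoef (n : ℤ) (f : ℂ → ℂ) : ℂ :=
  (2 * Real.pi * Complex.I)⁻¹ * ∮ z in C(0, 1), z ^ (-n - 1) * f z

lemma laurentCoef_congr {n : ℤ} {f g : ℂ → ℂ} (h : ∀ z ≠ 0, f z = g z) :
    laurentCoef n f = laurentCoef n g := by
  unfold laurentCoef
  congr 1
  refine circleIntegral.integral_congr zero_le_one fun z hz => ?_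
  simp only [h z (ne_zero_of_sphere one_pos hz)]

lemma laurentCoef_add (n : ℤ) {f g : ℂ → ℂ} (hf : HolPunct f) (hg : HolPunct g) :
    laurentCoef n (fun z => f z + g z) = laurentCoef n f + laurentCoef n g := by
  unfold laurentCoef
  rw [← mul_add, ← circleIntegral.integral_add ((hf.zpow_mul _).circleIntegrable one_pos)
    ((hg.zpow_mul _).circleIntegrable one_pos)]
  simp only [mul_add]

lemma laurentCoef_const_mul (n : ℤ) (c : ℂ) (f : ℂ → ℂ) :
    laurentCoef n (fun z => c * f z) = c * laurentCoef n f := by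
  unfold laurentCoef
  rw [mul_left_comm c, ← circleIntegral.integral_const_mul c]
  simp only [mul_left_comm _ c]

lemma laurentCoef_zpow_mul (n j : ℤ) (f : ℂ → ℂ) :
    laurentCoef n (fun z => z ^ j * f z) = laurentCoef (n - j) f := by
  unfold laurentCoef
  congr 1
  refine circleIntegral.integral_congr zero_le_one fun z hz => ?_
  simp only
  rw [← mul_assoc, ← zpow_add₀ (ne_zero_of_sphere one_pos hz)]
  congr 2
  ring

/-- Integration by parts: the derivative of z^(-n-1) f(z) integrates to zero over the circle. -/
lemma laurentCoef_deriv (n : ℤ) {f : ℂ → ℂ} (hf : HolPunct f) :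
    laurentCoef n (deriv f) = (n + 1) * laurentCoef (n + 1) f := by
  have h : (∮ z in C(0, 1), (((-n - 1 : ℤ) : ℂ) * z ^ (-n - 1 - 1) * f z +
      z ^ (-n - 1) * deriv f z)) = 0 := by
    refine circleIntegral.integral_eq_zero_of_hasDerivWithinAt (f := fun z => z ^ (-n - 1) * f z)
      zero_le_one fun z hz => HasDerivAt.hasDerivWithinAt ?_
    have hz0 := ne_zero_of_sphere one_pos hz
    exact (hasDerivAt_zpow _ z (Or.inl hz0)).mul (hf.at hz0).hasDerivAt
  have h1 := (hf.zpow_mul (-n - 1 - 1)).circleIntegrable one_pos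
  rw [circleIntegral.integral_add (by
    simp only [mul_assoc]
    exact h1.const_smul (a := ((-n - 1 : ℤ) : ℂ)))
    ((hf.deriv.zpow_mul _).circleIntegrable one_pos)] at h
  simp only [mul_assoc] at h
  rw [circleIntegral.integral_const_mul] at h
  unfold laurentCoef
  rw [show -(n + 1) - 1 = -n - 1 - 1 by ring, eq_neg_of_add_eq_zero_right h]
  push_cast
  ring

lemma circleIntegral_pow_mul_entire {g : ℂ → ℂ} (hg : Differentiable ℂ g) {n : ℤ} (hn : 0 ≤ n) :
    (∮ z in C(0, 1), z ^ n * g z) = 0 := by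
  lift n to ℕ using hn
  simp only [zpow_natCast]
  have : Differentiable ℂ fun z : ℂ => z ^ n * g z := by fun_prop
  exact this.diffContOnCl.circleIntegral_eq_zero zero_le_one

lemma laurentCoef_entire {g : ℂ → ℂ} (hg : Differentiable ℂ g) {n : ℤ} (hn : n < 0) :
    laurentCoef n g = 0 := by
  rw [laurentCoef, circleIntegral_pow_mul_entire hg (by lia), mul_zero]

/-- After inversion the integrand is z^(n-1) g(z), which is entire since n > 0. -/
lemma laurentCoef_entire_inv {g : ℂ → ℂ} (hg : Differentiable ℂ g) {n : ℤ} (hn : 0 < n) :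
    laurentCoef n (fun z => g z⁻¹) = 0 := by
  rw [laurentCoef, circleIntegral_inv_eq, show (∮ z in C(0, 1), z ^ (-2 : ℤ) *
    (z⁻¹ ^ (-n - 1) * g z⁻¹⁻¹)) = ∮ z in C(0, 1), z ^ (n - 1) * g z from ?_,
    circleIntegral_pow_mul_entire hg (by lia), mul_zero]
  refine circleIntegral.integral_congr zero_le_one fun z hz => ?_
  rw [inv_inv, inv_zpow', ← mul_assoc, ← zpow_add₀ (ne_zero_of_sphere one_pos hz)]
  congr 2
  ring

lemma laurentCoef_one (n : ℤ) : laurentCoef n (fun _ => 1) = if n = 0 then 1 else 0 := by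
  unfold laurentCoef
  split_ifs with h
  · subst h
    have := circleIntegral.integral_sub_center_inv 0 (R := 1) one_ne_zero
    simp only [sub_zero] at this
    simp only [neg_zero, zero_sub, zpow_neg_one, mul_one]
    rw [this, inv_mul_cancel₀ Complex.two_pi_I_ne_zero]
  · have := circleIntegral.integral_sub_zpow_of_ne (n := -n - 1) (by lia) 0 0 1
    simp only [sub_zero] at this
    simp only [mul_one]
    rw [this, mul_zero]

lemma laurentCoef_zpow (n j : ℤ) (c : ℂ) :
    laurentCoef n (fun z => c * z ^ j) = if n = j then c else 0 := by
  have h1 := laurentCoef_const_mul n c (fun z => z ^ j * 1)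
  simp only [mul_one] at h1
  have h2 := laurentCoef_zpow_mul n j (fun _ => 1)
  simp only [mul_one] at h2
  rw [h1, h2, laurentCoef_one]
  simp [sub_eq_zero]

/-! ### Cauchy integrals and the Laurent decomposition. -/

/-- Cauchy's formula on the annulus between the circles of radii `1` and `2`. -/
lemma cauchy_annulus {f : ℂ → ℂ} (hf : HolPunct f) {z : ℂ} (h1 : 1 < ‖z‖) (h2 : ‖z‖ < 2) :
    2 * Real.pi * Complex.I * f z =
      (∮ w in C(0, 2), (w - z)⁻¹ * f w) - ∮ w in C(0, 1), (w - z)⁻¹ * f w := by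
  have hz : z ≠ 0 := norm_pos_iff.mp (one_pos.trans h1)
  have hne : ∀ R : ℝ, R ≠ ‖z‖ → ∀ w ∈ Metric.sphere (0 : ℂ) R, w - z ≠ 0 := by
    intro R hR w hw h0
    rw [sub_eq_zero.mp h0, mem_sphere_zero_iff_norm] at hw
    exact hR hw.symm
  have hint : ∀ R : ℝ, 0 < R → R ≠ ‖z‖ → ∀ g : ℂ → ℂ, ContinuousOn g {0}ᶜ →
      CircleIntegrable (fun w => (w - z)⁻¹ * g w) 0 R := by
    intro R hR hRz g hg
    refine ContinuousOn.circleIntegrable hR.le (ContinuousOn.mul ?_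
      (hg.mono fun w hw => ne_zero_of_sphere hR hw))
    exact ContinuousOn.inv₀ (by fun_prop) (hne R hRz)
  -- The difference quotient has no singularity at z, so its integrals over the two circles agree;
  -- splitting it into its two terms gives the formula.
  have hd : HolPunct (dslope f z) :=
    (Complex.differentiableOn_dslope (isOpen_compl_singleton.mem_nhds hz)).mpr hf
  have hsub : Metric.closedBall (0 : ℂ) 2 \ Metric.ball 0 1 ⊆ {0}ᶜ := by
    rintro w ⟨-, hw⟩ rfl
    exact hw (Metric.mem_ball_self one_pos)
  have key := Complex.circleIntegral_eq_of_differentiable_on_annulus_off_countable one_pos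
    one_le_two Set.countable_empty (hd.continuousOn.mono hsub) (fun w hw =>
      hd.at fun h0 => hsub ⟨Metric.ball_subset_closedBall hw.1.1,
        fun hb => hw.1.2 (Metric.ball_subset_closedBall hb)⟩ h0)
  have hval : ∀ R : ℝ, 0 < R → R ≠ ‖z‖ → (∮ w in C(0, R), dslope f z w) =
      (∮ w in C(0, R), (w - z)⁻¹ * f w) - ∮ w in C(0, R), (w - z)⁻¹ * f z := by
    intro R hR hRz
    rw [← circleIntegral.integral_sub (hint R hR hRz f hf.continuousOn)
      (hint R hR hRz (fun _ => f z) continuousOn_const)]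
    refine circleIntegral.integral_congr hR.le fun w hw => ?_
    have := hne R hRz w hw
    rw [dslope_of_ne _ (sub_ne_zero.mp this), slope_def_field]
    field_simp
  rw [hval 2 two_pos h2.ne', hval 1 one_pos h1.ne] at key
  have c2 : (∮ w in C(0, 2), (w - z)⁻¹ * f z) = 2 * Real.pi * Complex.I * f z := by
    have := circleIntegral.integral_smul_const (fun w => (w - z)⁻¹) (f z) 0 2
    simp only [smul_eq_mul] at this
    rw [this, circleIntegral.integral_sub_inv_of_mem_ball (by simpa using h2)]
  -- The pole z lies outside the closed unit disc.
  have c1 : (∮ w in C(0, 1), (w - z)⁻¹ * f z) = 0 := by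
    refine DiffContOnCl.circleIntegral_eq_zero zero_le_one (DifferentiableOn.diffContOnCl ?_)
    rw [closure_ball _ one_ne_zero]
    intro w hw
    have : w - z ≠ 0 := by
      intro h0
      rw [sub_eq_zero.mp h0, mem_closedBall_zero_iff] at hw
      exact absurd h1 (not_lt.mpr hw)
    exact DifferentiableAt.differentiableWithinAt (by fun_prop (disch := assumption))
  rw [c2, c1] at key
  linear_combination -key

lemma cauchyIntegral_analytic {f : ℂ → ℂ} (R : NNReal) (hR : 0 < R) (hf : CircleIntegrable f 0 R)
    {z : ℂ} (hz : ‖z‖ < R) :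
    AnalyticAt ℂ (fun z => (2 * Real.pi * Complex.I)⁻¹ * ∮ w in C(0, R), (w - z)⁻¹ * f w) z := by
  have := (hasFPowerSeriesOn_cauchy_integral hf hR).analyticAt_of_mem
    (by simpa [← NNReal.coe_lt_coe] using hz : z ∈ Metric.eball (0 : ℂ) R)
  simpa only [smul_eq_mul] using this

lemma exists_entire_of_puncture {F g : ℂ → ℂ} (hF : HolPunct F) (hg : AnalyticAt ℂ g 0)
    (h : ∀ᶠ z in 𝓝[≠] (0 : ℂ), F z = g z) :
    ∃ G : ℂ → ℂ, Differentiable ℂ G ∧ ∀ z ≠ 0, G z = F z := by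
  refine ⟨Function.update F 0 (g 0), fun z => ?_, fun z hz => Function.update_of_ne hz _ _⟩
  by_cases hz : z = 0
  · subst hz
    refine hg.differentiableAt.congr_of_eventuallyEq ?_
    rw [eventually_nhdsWithin_iff] at h
    filter_upwards [h] with w hw
    by_cases hw0 : w = 0
    · subst hw0; simp
    · rw [Function.update_of_ne hw0, hw hw0]
  · refine (hF.at hz).congr_of_eventuallyEq ?_
    filter_upwards [isOpen_compl_singleton.mem_nhds hz] with w hw
    exact Function.update_of_ne hw _ _

/-- Laurent decomposition. -/
theorem laurent_decomposition {f : ℂ → ℂ} (hf : HolPunct f) :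
    ∃ p q : ℂ → ℂ, Differentiable ℂ p ∧ Differentiable ℂ q ∧
      ∀ z ≠ 0, f z = p z + z⁻¹ * q z⁻¹ := by
  set c : ℂ := 2 * Real.pi * Complex.I with hc
  have hc0 : c ≠ 0 := Complex.two_pi_I_ne_zero
  set P : ℂ → ℂ := fun z => c⁻¹ * ∮ w in C(0, 2), (w - z)⁻¹ * f w
  have hP : ∀ z : ℂ, ‖z‖ < 2 → AnalyticAt ℂ P z := fun z hz =>
    cauchyIntegral_analytic 2 two_pos (hf.circleIntegrable two_pos) hz
  -- With this g, inversion turns the integral over the inner circle at z into -1/z times a Cauchy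
  -- integral of g at 1/z, which is analytic for |1/z| < 1.
  set g : ℂ → ℂ := fun s => s ^ (-1 : ℤ) * f s⁻¹
  have hg : HolPunct g := hf.comp_inv.zpow_mul _
  set Q : ℂ → ℂ := fun z => c⁻¹ * ∮ w in C(0, 1), (w - z)⁻¹ * g w
  have hQ : ∀ z : ℂ, ‖z‖ < 1 → AnalyticAt ℂ Q z := fun z hz =>
    cauchyIntegral_analytic 1 one_pos (hg.circleIntegrable one_pos) hz
  have hPQ : ∀ z : ℂ, 1 < ‖z‖ → ‖z‖ < 2 → f z = P z + z⁻¹ * Q z⁻¹ := by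
    intro z h1 h2
    have hz : z ≠ 0 := norm_pos_iff.mp (one_pos.trans h1)
    have key := cauchy_annulus hf h1 h2
    have e : (∮ w in C(0, 1), (w - z)⁻¹ * f w) =
        -z⁻¹ * ∮ w in C(0, 1), (w - z⁻¹)⁻¹ * g w := by
      rw [circleIntegral_inv_eq, ← circleIntegral.integral_const_mul]
      refine circleIntegral.integral_congr zero_le_one fun w hw => ?_
      have hw0 := ne_zero_of_sphere one_pos hw
      have hwz : w * z ≠ 1 := by
        intro h
        have := congrArg norm h
        rw [norm_mul, mem_sphere_zero_iff_norm.mp hw, one_mul, norm_one] at this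
        exact h1.ne' this
      have a1 : w⁻¹ - z ≠ 0 := by
        intro h; apply hwz; rw [← sub_eq_zero.mp h]; field_simp
      have a2 : w - z⁻¹ ≠ 0 := by
        intro h; apply hwz; rw [sub_eq_zero.mp h]; field_simp
      have a3 : 1 - w * z ≠ 0 := sub_ne_zero.mpr hwz.symm
      have e1 : (w⁻¹ - z)⁻¹ = w * (1 - w * z)⁻¹ := by
        field_simp
      have e2 : (w - z⁻¹)⁻¹ = -(z * (1 - w * z)⁻¹) := by
        rw [← inv_inj, inv_inv, inv_neg, mul_inv, inv_inv]; field_simp; ring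
      simp only [g, e1, e2, zpow_neg, zpow_one]
      field_simp
    simp only [P, Q]
    rw [e] at key
    field_simp
    rw [← hc] at key
    rw [mul_comm (f z), key]
    field_simp
    ring
  -- The two formulas agree on the annulus 1 < |z| < 2 by `hPQ`, so they glue to an entire function.
  set p : ℂ → ℂ := fun z => if ‖z‖ < 2 then P z else f z - z⁻¹ * Q z⁻¹
  have hp2 : ∀ z : ℂ, ‖z‖ < 2 → p z = P z := fun z hz => if_pos hz
  have hp1 : ∀ z : ℂ, 1 < ‖z‖ → p z = f z - z⁻¹ * Q z⁻¹ := by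
    intro z hz
    by_cases h : ‖z‖ < 2
    · rw [hp2 z h, hPQ z hz h]; ring
    · exact if_neg h
  have hp : Differentiable ℂ p := by
    intro z
    by_cases h : ‖z‖ < 2
    · refine (hP z h).differentiableAt.congr_of_eventuallyEq ?_
      filter_upwards [(isOpen_lt continuous_norm continuous_const).mem_nhds h] with w hw
      exact hp2 w hw
    · have h1 : 1 < ‖z‖ := by linarith
      have hz : z ≠ 0 := norm_pos_iff.mp (one_pos.trans h1)
      have hi : ‖z⁻¹‖ < 1 := by rw [norm_inv]; exact inv_lt_one_of_one_lt₀ h1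
      have : DifferentiableAt ℂ (fun z => f z - z⁻¹ * Q z⁻¹) z :=
        (hf.at hz).sub ((differentiableAt_inv hz).mul
          (DifferentiableAt.fun_comp' (g := Q) z (hQ _ hi).differentiableAt
            (differentiableAt_inv hz)))
      refine this.congr_of_eventuallyEq ?_
      filter_upwards [(isOpen_lt continuous_const continuous_norm).mem_nhds h1] with w hw
      exact hp1 w hw
  -- The second part is forced by the first: it solves f(z) - p(z) = z⁻¹ q(z⁻¹) on the punctured
  -- plane, and it equals the analytic function `Q` near 0, so the puncture is removable.
  have hF : HolPunct fun u => u⁻¹ * (f u⁻¹ - p u⁻¹) := by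
    have : HolPunct fun u => f u - p u := hf.sub (holPunct_of_entire hp)
    simpa only [zpow_neg_one] using (this.comp_inv.zpow_mul (-1))
  obtain ⟨q, hq, hq'⟩ := exists_entire_of_puncture hF (hQ 0 (by simp)) (by
    rw [eventually_nhdsWithin_iff]
    filter_upwards [Metric.ball_mem_nhds (0 : ℂ) one_pos] with u hu hu0
    have hu0 : u ≠ 0 := hu0
    have hu1 : 1 < ‖u⁻¹‖ := by
      rw [norm_inv]
      exact (one_lt_inv₀ (norm_pos_iff.mpr hu0)).mpr (by simpa using hu)
    rw [hp1 _ hu1, inv_inv]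
    field_simp
    ring)
  refine ⟨p, q, hp, hq, fun z hz => ?_⟩
  rw [hq' _ (inv_ne_zero hz), inv_inv]
  field_simp
  ring

lemma entire_eq_add_mul {q : ℂ → ℂ} (hq : Differentiable ℂ q) :
    ∃ r : ℂ → ℂ, Differentiable ℂ r ∧ ∀ z, q z = q 0 + z * r z := by
  refine ⟨dslope q 0, ?_, fun z => ?_⟩
  · have := (Complex.differentiableOn_dslope (f := q) (c := 0) (s := Set.univ) univ_mem).mpr
      hq.differentiableOn
    exact differentiableOn_univ.mp this
  · have := sub_smul_dslope q 0 z
    rw [sub_zero, smul_eq_mul] at this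
    rw [this]; ring

lemma laurentCoef_zero_entire_inv {q : ℂ → ℂ} (hq : Differentiable ℂ q) :
    laurentCoef 0 (fun z => q z⁻¹) = q 0 := by
  obtain ⟨r, hr, h⟩ := entire_eq_add_mul hq
  have e : ∀ z : ℂ, z ≠ 0 → q z⁻¹ = q 0 * 1 + z ^ (-1 : ℤ) * r z⁻¹ := fun z _ => by
    rw [h z⁻¹, zpow_neg_one, mul_one]
  have hr' := (holPunct_of_entire hr).comp_inv
  rw [laurentCoef_congr e, laurentCoef_add 0 (differentiableOn_const _) (hr'.zpow_mul _),
    laurentCoef_const_mul, laurentCoef_one, laurentCoef_zpow_mul, laurentCoef_entire_inv hr (by simp)]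
  simp

/-- The Laurent coefficient of q(1/z) in degree -i is the i-th Taylor coefficient of q at 0, and one
factor z is split off at a time. -/
lemma entire_factor_pow {q : ℂ → ℂ} (hq : Differentiable ℂ q) (j : ℕ)
    (h : ∀ i : ℕ, i < j → laurentCoef (-i) (fun z => q z⁻¹) = 0) :
    ∃ r : ℂ → ℂ, Differentiable ℂ r ∧ ∀ z, q z = z ^ j * r z := by
  induction j generalizing q with
  | zero => exact ⟨q, hq, fun z => by simp⟩
  | succ j ih =>
    have h0 := h 0 j.succ_pos
    rw [Nat.cast_zero, neg_zero, laurentCoef_zero_entire_inv hq] at h0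
    obtain ⟨s, hs, hs'⟩ := entire_eq_add_mul hq
    simp only [h0, zero_add] at hs'
    obtain ⟨r, hr, hr'⟩ := ih hs (fun i hi => by
      have h1 := h (i + 1) (Nat.succ_lt_succ hi)
      rw [laurentCoef_congr (g := fun z => z ^ (-1 : ℤ) * s z⁻¹) fun z _ => by
        rw [hs', zpow_neg_one], laurentCoef_zpow_mul] at h1
      rw [← h1]
      congr 1
      push_cast
      ring)
    exact ⟨r, hr, fun z => by rw [hs', hr', pow_succ']; ring⟩

/-- A function on the punctured plane whose Laurent coefficients of degrees `-j, …, -1` vanish is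
the sum of a function holomorphic at `0` and a function vanishing to order `j + 1` at `∞`. -/
theorem laurent_decomposition_of_coef {f : ℂ → ℂ} (hf : HolPunct f) (j : ℕ)
    (h : ∀ n : ℤ, -j ≤ n → n < 0 → laurentCoef n f = 0) :
    ∃ p q : ℂ → ℂ, Differentiable ℂ p ∧ Differentiable ℂ q ∧
      ∀ z ≠ 0, f z = p z + z ^ (-1 - j : ℤ) * q z⁻¹ := by
  obtain ⟨p, q, hp, hq, hpq⟩ := laurent_decomposition hf
  have hq' := (holPunct_of_entire hq).comp_inv
  -- The i-th Taylor coefficient of q is the coefficient of f in degree -i-1, because q(1/z) is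
  -- multiplied by z⁻¹.
  obtain ⟨r, hr, hr'⟩ := entire_factor_pow hq j (fun i hi => by
    have h1 := h (-i - 1) (by lia) (by lia)
    rw [laurentCoef_congr (g := fun z => p z + z ^ (-1 : ℤ) * q z⁻¹) fun z hz => by
      rw [hpq z hz, zpow_neg_one], laurentCoef_add _ (holPunct_of_entire hp) (hq'.zpow_mul _),
      laurentCoef_entire hp (by lia), laurentCoef_zpow_mul, zero_add] at h1
    rw [← h1]
    congr 1
    ring)
  refine ⟨p, r, hp, hr, fun z hz => ?_⟩
  rw [hpq z hz, hr', sub_eq_add_neg, zpow_add₀ hz, zpow_neg_one, zpow_neg, zpow_natCast, inv_pow,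
    mul_assoc]

end

section

/-! ## The Grassmann algebra in three generators -/

lemma xi_sq (i : Fin m) : xi i * xi i = 0 := ExteriorAlgebra.ι_sq_zero _

lemma xi_sq_mul (i : Fin m) (u : Gr m) : xi i * (xi i * u) = 0 := by
  rw [← mul_assoc, xi_sq, zero_mul]

lemma xi_swap (i j : Fin m) : xi i * xi j = -(xi j * xi i) :=
  eq_neg_of_add_eq_zero_left (ExteriorAlgebra.ι_add_mul_swap _ _)

lemma xi_swap_mul (i j : Fin m) (u : Gr m) : xi i * (xi j * u) = -(xi j * (xi i * u)) := by
  rw [← mul_assoc, xi_swap, neg_mul, mul_assoc]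

lemma sg_xi (i : Fin m) : sg (xi i) = -xi i := sg_iota _

lemma dxi_xi_mul (i j : Fin m) (u : Gr m) :
    dxi j (xi i * u) = (if i = j then 1 else 0) * u - xi i * dxi j u := by
  rw [dxi_mul, dxi_xi, sg_xi, neg_mul, sub_eq_add_neg]

lemma oddDer_xi (b : Fin m → Gr m) (i : Fin m) : oddDer b (xi i) = b i := by
  rw [xi, oddDer_iota]
  simp [Pi.single_apply]

lemma oddDer_smul (b : Fin m → Gr m) (c : ℂ) (u : Gr m) : oddDer b (c • u) = c • oddDer b u := by
  simp only [oddDer, map_smul, mul_smul_comm, Finset.smul_sum]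

/-- The products of two generators: `om l` omits the generator `xi l`. -/
def om : Fin 3 → Gr 3 := ![xi 1 * xi 2, xi 0 * xi 2, xi 0 * xi 1]

/-- The sign in `om l * xi l = epsSign l • xi123`. -/
def epsSign : Fin 3 → ℂ := ![1, -1, 1]

lemma epsSign_sq (l : Fin 3) : epsSign l * epsSign l = 1 := by
  fin_cases l <;> simp [epsSign]

/-- The constant term of an element of the Grassmann algebra. -/
def augm : Gr m →ₗ[ℂ] ℂ := (ExteriorAlgebra.algebraMapInv (R := ℂ) (M := Fin m → ℂ)).toLinearMap

lemma augm_one : augm (1 : Gr m) = 1 := by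
  simp [augm]

/-- The coefficient of `om l`. -/
def comp2 : Fin 3 → Gr 3 →ₗ[ℂ] ℂ :=
  ![augm ∘ₗ dxi 2 ∘ₗ dxi 1, augm ∘ₗ dxi 2 ∘ₗ dxi 0, augm ∘ₗ dxi 1 ∘ₗ dxi 0]

/-- The coefficient of `xi123`. -/
def comp3 : Gr 3 →ₗ[ℂ] ℂ := augm ∘ₗ dxi 2 ∘ₗ dxi 1 ∘ₗ dxi 0

lemma comp2_om (l j : Fin 3) : comp2 l (om j) = if l = j then 1 else 0 := by
  fin_cases l <;> fin_cases j <;>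
    simp [comp2, om, dxi_xi_mul, dxi_xi, augm_one]

lemma comp3_xi123 : comp3 xi123 = 1 := by
  simp [comp3, xi123, mul_assoc, dxi_xi_mul, dxi_xi, augm_one]

lemma om_mem (l : Fin 3) : om l ∈ grDeg 3 2 := by
  fin_cases l
  exacts [xi_mul_mem _ _, xi_mul_mem _ _, xi_mul_mem _ _]

lemma xi_mul_xi_mem_span (i j : Fin 3) : xi i * xi j ∈ Submodule.span ℂ (Set.range om) := by
  have h : ∀ l, om l ∈ Submodule.span ℂ (Set.range om) := fun l => Submodule.subset_span ⟨l, rfl⟩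
  fin_cases i <;> fin_cases j
  · exact (xi_sq (0 : Fin 3)) ▸ Submodule.zero_mem _
  · exact h 2
  · exact h 1
  · exact (xi_swap (1 : Fin 3) 0) ▸ Submodule.neg_mem _ (h 2)
  · exact (xi_sq (1 : Fin 3)) ▸ Submodule.zero_mem _
  · exact h 0
  · exact (xi_swap (2 : Fin 3) 0) ▸ Submodule.neg_mem _ (h 1)
  · exact (xi_swap (2 : Fin 3) 1) ▸ Submodule.neg_mem _ (h 0)
  · exact (xi_sq (2 : Fin 3)) ▸ Submodule.zero_mem _

/-- Degree n + 1 is spanned by the products of a generator with elements of degree n. This allows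
spanning sets of successive degrees to be found by multiplying generators only. -/
lemma grDeg_succ_le {n : ℕ} {T : Set (Gr m)} {S : Submodule ℂ (Gr m)}
    (hT : grDeg m n ≤ Submodule.span ℂ T) (h : ∀ i, ∀ u ∈ T, xi i * u ∈ S) :
    grDeg m (n + 1) ≤ S := by
  rw [grDeg, ExteriorAlgebra.exteriorPower, pow_succ', Submodule.mul_le]
  rintro _ ⟨v, rfl⟩ u hu
  rw [iota_eq_sum, Finset.sum_mul]
  refine Submodule.sum_mem _ fun i _ => ?_
  rw [smul_mul_assoc]
  refine Submodule.smul_mem _ _ ?_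
  have : Submodule.span ℂ T ≤ S.comap (LinearMap.mulLeft ℂ (xi i)) :=
    Submodule.span_le.mpr fun t ht => h i t ht
  exact this (hT hu)

lemma grDeg_zero_le : grDeg m 0 ≤ Submodule.span ℂ {1} := by
  rw [grDeg, ExteriorAlgebra.exteriorPower, pow_zero, Submodule.one_eq_span]

lemma grDeg_one_le : grDeg m 1 ≤ Submodule.span ℂ (Set.range xi) := by
  refine grDeg_succ_le grDeg_zero_le ?_
  rintro i _ rfl
  rw [mul_one]
  exact Submodule.subset_span ⟨i, rfl⟩

lemma grDeg_two_le : grDeg 3 2 ≤ Submodule.span ℂ (Set.range om) := by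
  refine grDeg_succ_le grDeg_one_le ?_
  rintro i _ ⟨j, rfl⟩
  exact xi_mul_xi_mem_span i j

lemma xi_mul_om (i l : Fin 3) : xi i * om l = if l = i then epsSign l • xi123 else 0 := by
  have s21 := xi_swap (2 : Fin 3) 1
  fin_cases i <;> fin_cases l <;>
    simp [om, epsSign, xi123, mul_assoc, xi_sq, xi_sq_mul, s21, xi_swap_mul 1 0,
      xi_swap_mul 2 0, xi_swap_mul 2 1]

lemma grDeg_three_le : grDeg 3 3 ≤ Submodule.span ℂ {xi123} := by
  refine grDeg_succ_le grDeg_two_le ?_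
  rintro i _ ⟨l, rfl⟩
  rw [xi_mul_om]
  split_ifs
  · exact Submodule.smul_mem _ _ (Submodule.mem_span_singleton_self _)
  · exact Submodule.zero_mem _

lemma xi_mul_xi123 (i : Fin 3) : xi i * xi123 = 0 := by
  fin_cases i <;>
    simp [xi123, mul_assoc, xi_sq, xi_sq_mul, xi_swap_mul 1 0,
      xi_swap_mul 2 0, xi_swap_mul 2 1]

/-- The source of all later simplifications: terms of second order in degree 2 fields land in degree
at least 4 and disappear. -/
lemma grDeg_eq_bot {n : ℕ} (hn : 4 ≤ n) : grDeg 3 n = ⊥ := by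
  induction n, hn using Nat.le_induction with
  | base =>
    refine le_bot_iff.mp (grDeg_succ_le grDeg_three_le ?_)
    rintro i _ rfl
    rw [xi_mul_xi123]
    exact Submodule.zero_mem _
  | succ n _ ih =>
    refine le_bot_iff.mp (grDeg_succ_le (T := ∅) ?_ ?_)
    · rw [ih]; exact bot_le
    · intro i u hu; exact absurd hu (Set.notMem_empty u)

lemma eq_sum_comp2 {u : Gr 3} (hu : u ∈ grDeg 3 2) : u = ∑ l, comp2 l u • om l := by
  induction grDeg_two_le hu using Submodule.span_induction with
  | mem x hx => obtain ⟨j, rfl⟩ := hx; simp [comp2_om]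
  | zero => simp
  | add x y hx' hy' hx hy =>
    have hle : Submodule.span ℂ (Set.range om) ≤ grDeg 3 2 := Submodule.span_le.mpr (by
      rintro _ ⟨l, rfl⟩; exact om_mem l)
    conv_lhs => rw [hx (hle hx'), hy (hle hy')]
    simp only [map_add, add_smul, Finset.sum_add_distrib]
  | smul c x hx' hx =>
    have hle : Submodule.span ℂ (Set.range om) ≤ grDeg 3 2 := Submodule.span_le.mpr (by
      rintro _ ⟨l, rfl⟩; exact om_mem l)
    conv_lhs => rw [hx (hle hx')]
    simp only [map_smul, smul_assoc, Finset.smul_sum]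

lemma eq_comp3 {u : Gr 3} (hu : u ∈ grDeg 3 3) : u = comp3 u • xi123 := by
  obtain ⟨c, rfl⟩ := Submodule.mem_span_singleton.mp (grDeg_three_le hu)
  rw [map_smul, comp3_xi123, smul_eq_mul, mul_one]

lemma om_mul_xi (l j : Fin 3) : om l * xi j = if l = j then epsSign l • xi123 else 0 := by
  rw [even_mul_comm even_two (om_mem l), xi_mul_om]

lemma eOdd_zero : eOdd 0 = xi 1 := rfl
lemma eOdd_one : eOdd 1 = xi 2 := rfl
lemma eOdd_two : eOdd 2 = 0 := rfl
lemma fOdd_zero : fOdd 0 = 0 := rfl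
lemma fOdd_one : fOdd 1 = (2 : ℂ) • xi 0 := rfl
lemma fOdd_two : fOdd 2 = (2 : ℂ) • xi 1 := rfl

lemma oddDer_eOdd_om (l : Fin 3) : oddDer eOdd (om l) = ![0, om 0, om 1] l := by
  fin_cases l <;> simp [om, oddDer_mul eOdd_mem, oddDer_xi, eOdd_zero, eOdd_one, eOdd_two, xi_sq]

lemma oddDer_fOdd_om (l : Fin 3) :
    oddDer fOdd (om l) = ![(2 : ℂ) • om 1, (2 : ℂ) • om 2, 0] l := by
  fin_cases l <;> simp [om, oddDer_mul fOdd_mem, oddDer_xi, fOdd_zero, fOdd_one, fOdd_two, xi_sq]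

lemma oddDer_euler_om (k : ℤ) (l : Fin 3) :
    oddDer (eulerCoef (kkk k)) (om l) = (2 * k : ℂ) • om l := by
  fin_cases l <;>
    simp [om, oddDer_mul (eulerCoef_mem _), oddDer_xi, eulerCoef, ← add_smul, two_mul]

/-- A linear vector field acts on the top exterior power by its trace, and the linear part of e'' is
nilpotent; the same holds for f'' below. -/
lemma oddDer_eOdd_xi123 : oddDer eOdd xi123 = 0 := by
  simp [xi123, oddDer_mul eOdd_mem, oddDer_xi, eOdd_zero, eOdd_one, eOdd_two, xi_sq, xi_sq_mul, mul_assoc]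

lemma oddDer_fOdd_xi123 : oddDer fOdd xi123 = 0 := by
  simp [xi123, oddDer_mul fOdd_mem, oddDer_xi, fOdd_zero, fOdd_one, fOdd_two, xi_sq, mul_assoc, xi_sq_mul]

lemma oddDer_euler_xi123 (k : ℤ) : oddDer (eulerCoef (kkk k)) xi123 = (3 * k : ℂ) • xi123 := by
  simp only [xi123, oddDer_mul (eulerCoef_mem _), oddDer_xi, eulerCoef, smul_mul_assoc, mul_smul_comm,
    ← add_smul]
  congr 1
  ring

lemma trans_om (k : ℤ) (x : ℂ) (l : Fin 3) : trans (kkk k) x (om l) = x ^ (-2 * k) • om l := by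
  have e : x ^ (-2 * k) = x ^ (-k) * x ^ (-k) := by
    rw [show -2 * k = -k * 2 by ring, zpow_mul]; exact zpow_two _
  fin_cases l <;> simp [om, trans_xi, smul_smul, -neg_mul, e]

lemma trans_xi123 (k : ℤ) (x : ℂ) : trans (kkk k) x xi123 = x ^ (-3 * k) • xi123 := by
  have e : x ^ (-3 * k) = x ^ (-k) * x ^ (-k) * x ^ (-k) := by
    rw [show -3 * k = -k * (3 : ℕ) by push_cast; ring, zpow_mul, zpow_natCast]; ring
  simp only [xi123, map_mul, trans_xi, smul_mul_assoc, mul_smul_comm, smul_smul, e, mul_assoc]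

end

section

/-! ## Vector fields in the coordinates of the first chart -/

lemma oddDer_mul_even {p : ℕ} (hp : Even p) {b : Fin m → Gr m} (hb : ∀ j, b j ∈ grDeg m (p + 1))
    (u w : Gr m) : oddDer b (u * w) = oddDer b u * w + u * oddDer b w := by
  have e : ∀ j, b j * dxi j (u * w) = b j * dxi j u * w + u * (b j * dxi j w) := by
    intro j
    rw [dxi_mul, mul_add, ← mul_assoc, ← mul_assoc, odd_mul_comm hp (hb j), mul_assoc u]
  simp only [oddDer, e, Finset.sum_add_distrib, Finset.sum_mul, Finset.mul_sum]

/-- The section given by a holomorphic function, over an open set in the first chart. -/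
def holSec (k : Fin m → ℤ) {W : Opens CP1} (hW : ptInf ∉ W) (F : ℂ → Gr m)
    (hF : ∀ z, pt z ∈ W → HolAt F z) : Sec k W :=
  ⟨fun z => F z, fun z hz => (hF z hz).congr (by
    filter_upwards [eventually_fin0 hz] with w hw
    rw [zext_of_mem _ hw]), fun h => absurd h hW⟩

section
variable {k : Fin m → ℤ} {W : Opens CP1} (hW : ptInf ∉ W)

lemma sec_holAt {W : Opens CP1} (f : Sec k W) {z : ℂ} (hz : pt z ∈ W) : HolAt (zext f.1) z :=
  f.2.1 z hz

/-- The constant section. -/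
def constSec (k : Fin m → ℤ) {W : Opens CP1} (hW : ptInf ∉ W) (u : Gr m) : Sec k W :=
  holSec k hW (fun _ => u) fun _ _ => HolAt.const _ _

/-- The even section given by a holomorphic function. -/
def scalSec (k : Fin m → ℤ) {W : Opens CP1} (hW : ptInf ∉ W) (φ : ℂ → ℂ)
    (hφ : ∀ z, pt z ∈ W → AnalyticAt ℂ φ z) : Sec k W :=
  holSec k hW (fun z => φ z • 1) fun z hz => HolAt.smul (hφ z hz) (HolAt.const _ _)

/-- The coordinate `x`. -/
def xSec (k : Fin m → ℤ) {W : Opens CP1} (hW : ptInf ∉ W) : Sec k W :=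
  scalSec k hW (fun z => z) fun _ _ => analyticAt_id

variable {p : ℕ} {V : Opens CP1}

/-- The value of a vector field on the coordinate `x`. -/
def coordA (D : Vect k p V) (h : W ≤ V) : ℂ → Gr m := zext (D.1 ⟨W, h⟩ (xSec k hW)).1

/-- The value of a vector field on the odd coordinates. -/
def coordB (D : Vect k p V) (h : W ≤ V) (j : Fin m) : ℂ → Gr m :=
  zext (D.1 ⟨W, h⟩ (constSec k hW (xi j))).1

lemma vect_one (D : Vect k p V) (h : W ≤ V) : D.1 ⟨W, h⟩ 1 = 0 := by
  have := D.2.2.1 ⟨W, h⟩ 1 1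
  rw [mul_one, mul_one, one_mul] at this
  exact left_eq_add.mp this

lemma coordA_mem (D : Vect k p V) (h : W ≤ V) {z : ℂ} (hz : pt z ∈ W) :
    coordA hW D h z ∈ grDeg m p := by
  rw [coordA, zext_of_mem _ hz]
  have := D.2.2.2 ⟨W, h⟩ 0 (xSec k hW) (fun z => Submodule.smul_mem _ _ one_mem_grDeg) ⟨z, hz⟩
  rwa [zero_add] at this

lemma coordB_mem (D : Vect k p V) (h : W ≤ V) (j : Fin m) {z : ℂ} (hz : pt z ∈ W) :
    coordB hW D h j z ∈ grDeg m (p + 1) := by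
  rw [coordB, zext_of_mem _ hz, add_comm]
  exact D.2.2.2 ⟨W, h⟩ 1 (constSec k hW (xi j)) (fun z => xi_mem_grDeg j) ⟨z, hz⟩

lemma vect_const (hp : Even p) (D : Vect k p V) (h : W ≤ V) (u : Gr m) (z : Fin0 W) :
    (D.1 ⟨W, h⟩ (constSec k hW u)).1 z = oddDer (fun j => coordB hW D h j z) u := by
  induction u using ExteriorAlgebra.induction with
  | algebraMap r =>
    have : constSec k hW (algebraMap ℂ (Gr m) r) = r • 1 := by
      apply Subtype.ext; funext z; exact Algebra.algebraMap_eq_smul_one r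
    rw [this, map_smul, vect_one, smul_zero, oddDer_algebraMap]
    rfl
  | ι v =>
    have : constSec k hW (ExteriorAlgebra.ι ℂ v) = ∑ i, v i • constSec k hW (xi i) := by
      apply Subtype.ext; funext z
      rw [AddSubmonoidClass.coe_finsetSum, Finset.sum_apply]
      exact iota_eq_sum v
    rw [this, map_sum, oddDer_iota, AddSubmonoidClass.coe_finsetSum, Finset.sum_apply]
    refine Finset.sum_congr rfl fun i _ => ?_
    rw [map_smul, coordB, zext_of_mem _ z.2]
    rfl
  | mul a b ha hb =>
    rw [show constSec k hW (a * b) = constSec k hW a * constSec k hW b from rfl, D.2.2.1,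
      oddDer_mul_even hp fun j => coordB_mem hW D h j z.2, ← ha, ← hb]
    rfl
  | add a b ha hb =>
    rw [show constSec k hW (a + b) = constSec k hW a + constSec k hW b from rfl, map_add,
      oddDer_add, ← ha, ← hb]
    rfl

/-- Hadamard's argument: φ = φ(z) + (x - z)ψ with ψ holomorphic and ψ(z) = φ'(z), and at the point z
the Leibniz rule leaves only ψ(z) D(x). -/
lemma vect_scal (D : Vect k p V) (h : W ≤ V) {φ : ℂ → ℂ}
    (hφ : ∀ z, pt z ∈ W → AnalyticAt ℂ φ z) (z : Fin0 W) :
    (D.1 ⟨W, h⟩ (scalSec k hW φ hφ)).1 z = deriv φ z • coordA hW D h z := by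
  have hd : ∀ w, pt w ∈ W → AnalyticAt ℂ (dslope φ z) w := by
    have h1 : DifferentiableOn ℂ φ {w | pt w ∈ W} := fun w hw =>
      (hφ w hw).differentiableAt.differentiableWithinAt
    have h2 := (Complex.differentiableOn_dslope ((isOpen_fin0 W).mem_nhds z.2)).mpr h1
    exact fun w hw => h2.analyticAt ((isOpen_fin0 W).mem_nhds hw)
  have e : scalSec k hW φ hφ = φ z • 1 +
      (xSec k hW - (z : ℂ) • 1) * scalSec k hW (dslope φ z) hd := by
    apply Subtype.ext; funext w
    change φ w • (1 : Gr m) = φ z • 1 + ((w : ℂ) • 1 - (z : ℂ) • 1) * (dslope φ z w • 1)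
    have := sub_smul_dslope φ z w
    rw [smul_eq_mul] at this
    rw [← sub_smul, mul_smul_comm, mul_one, smul_smul, mul_comm, this, ← add_smul]
    congr 1
    ring
  have e2 : ((xSec k hW - (z : ℂ) • 1 : Sec k W)).1 z = 0 := by
    change (z : ℂ) • (1 : Gr m) - (z : ℂ) • 1 = 0
    exact sub_self _
  rw [e, map_add, map_smul, vect_one, smul_zero, zero_add, D.2.2.1]
  change (D.1 ⟨W, h⟩ (xSec k hW - (z : ℂ) • 1)).1 z * (dslope φ z z • 1) +
    (xSec k hW - (z : ℂ) • 1 : Sec k W).1 z * _ = _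
  rw [e2, zero_mul, add_zero, map_sub, map_smul, vect_one, smul_zero, sub_zero, dslope_same,
    mul_smul_comm, mul_one, coordA, zext_of_mem _ z.2]

/-- A vector field in the coordinates `x, ξ₁, …, ξₘ`. -/
theorem vect_apply (hp : Even p) (D : Vect k p V) (h : W ≤ V) (f : Sec k W) (z : Fin0 W) :
    (D.1 ⟨W, h⟩ f).1 z =
      coordField (coordA hW D h) (coordB hW D h) (zext f.1) z := by
  have hφ : ∀ s, ∀ z, pt z ∈ W → AnalyticAt ℂ (fun w => coef s (zext f.1 w)) z :=
    fun s z hz => f.2.1 z hz s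
  -- Every section is a sum of a holomorphic function times a constant monomial, so the Leibniz rule
  -- together with `vect_scal` and `vect_const` determines the field.
  have e : f = ∑ s, scalSec k hW (fun w => coef s (zext f.1 w)) (hφ s) *
      constSec k hW (grBasis m s) := by
    apply Subtype.ext; funext w
    rw [AddSubmonoidClass.coe_finsetSum, Finset.sum_apply]
    have := sum_coef (f.1 w)
    rw [← this]
    refine Finset.sum_congr rfl fun s _ => ?_
    change _ = (coef s (zext f.1 w) • (1 : Gr m)) * grBasis m s
    rw [smul_one_mul, zext_of_mem _ w.2]
  have hb : ∀ s, oddDer (fun j => coordB hW D h j z) (grBasis m s) =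
    (D.1 ⟨W, h⟩ (constSec k hW (grBasis m s))).1 z := fun s => (vect_const hW hp D h _ z).symm
  rw [coordField_eq]
  conv_lhs => rw [e]
  rw [map_sum, AddSubmonoidClass.coe_finsetSum, Finset.sum_apply]
  conv_rhs => rw [← sum_coef (zext f.1 z)]
  rw [oddDer_sum_smul, dx, Finset.mul_sum, ← Finset.sum_add_distrib]
  refine Finset.sum_congr rfl fun s _ => ?_
  rw [D.2.2.1, hb]
  change (D.1 ⟨W, h⟩ (scalSec k hW _ _)).1 z * grBasis m s +
    (coef s (zext f.1 z) • (1 : Gr m)) * _ = _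
  rw [vect_scal hW D h (hφ s) z, smul_one_mul, smul_mul_assoc, mul_smul_comm]

end

end

section

/-! ## Vector fields of degree two in components -/

lemma pt_mem_U0 (z : ℂ) : pt z ∈ U0 := OnePoint.coe_ne_infty z

lemma pt_mem_U1 {z : ℂ} (hz : z ≠ 0) : pt z ∈ U1 := fun h => hz (OnePoint.coe_injective h)

lemma pt_mem_U01 {z : ℂ} (hz : z ≠ 0) : pt z ∈ U01 := ⟨pt_mem_U0 z, pt_mem_U1 hz⟩

lemma ptInf_notMem_U0 : ptInf ∉ U0 := fun h => h rfl

lemma ptInf_mem_U1 : ptInf ∈ U1 := OnePoint.infty_ne_coe 0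

lemma ptInf_notMem_of_le {W V : Opens CP1} (h : W ≤ V) (hV : ptInf ∉ V) : ptInf ∉ W :=
  fun hW => hV (h hW)

lemma coordA_res {k : Fin m → ℤ} {p : ℕ} {V W W' : Opens CP1} (hW : ptInf ∉ W) (hW' : ptInf ∉ W')
    (D : Vect k p V) (h : W ≤ V) (h' : W' ≤ W) {z : ℂ} (hz : pt z ∈ W') :
    coordA hW' D (h'.trans h) z = coordA hW D h z := by
  have := D.2.1 ⟨W, h⟩ ⟨W', h'.trans h⟩ h' (xSec k hW)
  rw [coordA, zext_of_mem _ hz, coordA, zext_of_mem _ (h' hz)]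
  exact (congrFun (congrArg Subtype.val this) ⟨z, hz⟩).symm

lemma coordB_res {k : Fin m → ℤ} {p : ℕ} {V W W' : Opens CP1} (hW : ptInf ∉ W) (hW' : ptInf ∉ W')
    (D : Vect k p V) (h : W ≤ V) (h' : W' ≤ W) (j : Fin m) {z : ℂ} (hz : pt z ∈ W') :
    coordB hW' D (h'.trans h) j z = coordB hW D h j z := by
  have := D.2.1 ⟨W, h⟩ ⟨W', h'.trans h⟩ h' (constSec k hW (xi j))
  rw [coordB, zext_of_mem _ hz, coordB, zext_of_mem _ (h' hz)]
  exact (congrFun (congrArg Subtype.val this) ⟨z, hz⟩).symm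

lemma coordField_congr_coef {a a' : ℂ → Gr m} {b b' : Fin m → ℂ → Gr m} {z : ℂ} (g : ℂ → Gr m)
    (ha : a z = a' z) (hb : ∀ j, b j z = b' j z) : coordField a b g z = coordField a' b' g z := by
  simp only [coordField, ha, hb]

lemma vect_ext {k : Fin m → ℤ} {p : ℕ} (hp : Even p) {V : Opens CP1} (hV : ptInf ∉ V)
    {D E : Vect k p V} (hA : ∀ z, pt z ∈ V → coordA hV D le_rfl z = coordA hV E le_rfl z)
    (hB : ∀ j z, pt z ∈ V → coordB hV D le_rfl j z = coordB hV E le_rfl j z) : D = E := by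
  apply Subtype.ext
  refine OpFam.ext fun W f => Subtype.ext (funext fun z => ?_)
  have hW := ptInf_notMem_of_le W.2 hV
  refine ((vect_apply hW hp D W.2 f z).trans ?_).trans (vect_apply hW hp E W.2 f z).symm
  have hz := W.2 z.2
  refine coordField_congr_coef _ ?_ fun j => ?_
  · rw [coordA_res hV hW D le_rfl W.2 z.2, coordA_res hV hW E le_rfl W.2 z.2, hA _ hz]
  · rw [coordB_res hV hW D le_rfl W.2 j z.2, coordB_res hV hW E le_rfl W.2 j z.2, hB j _ hz]

lemma dx_scal {φ : ℂ → ℂ} {z : ℂ} (hφ : AnalyticAt ℂ φ z) (u : Gr m) :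
    dx (fun w => φ w • u) z = deriv φ z • u := by
  rw [dx_smul hφ (HolAt.const _ _), dx_const, smul_zero, add_zero]

lemma coordField_scal (a : ℂ → Gr m) (b : Fin m → ℂ → Gr m) {φ : ℂ → ℂ} {z : ℂ}
    (hφ : AnalyticAt ℂ φ z) (u : Gr m) :
    coordField a b (fun w => φ w • u) z =
      deriv φ z • (a z * u) + φ z • oddDer (fun j => b j z) u := by
  rw [coordField_eq, dx_scal hφ, mul_smul_comm, oddDer_smul]

lemma coordA_ofCoords {k : Fin m → ℤ} {p : ℕ} {V W : Opens CP1} {a : ℂ → Gr m}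
    {b : Fin m → ℂ → Gr m} (h : IsCoordField k p V a b) (hW : ptInf ∉ W) (hWV : W ≤ V) {z : ℂ}
    (hz : pt z ∈ W) : coordA hW (ofCoords h) hWV z = a z := by
  rw [coordA, zext_of_mem _ hz]
  refine (coordField_congr (h := fun w => w • (1 : Gr m)) a b ?_).trans ?_
  · filter_upwards [eventually_fin0 hz] with w hw
    exact zext_of_mem _ hw
  · have h1 := oddDer_algebraMap (fun j => b j z) 1
    rw [map_one] at h1
    rw [coordField_scal a b (φ := fun w => w) analyticAt_id, h1]
    simp

lemma coordB_ofCoords {k : Fin m → ℤ} {p : ℕ} {V W : Opens CP1} {a : ℂ → Gr m}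
    {b : Fin m → ℂ → Gr m} (h : IsCoordField k p V a b) (hW : ptInf ∉ W) (hWV : W ≤ V) (j : Fin m)
    {z : ℂ} (hz : pt z ∈ W) : coordB hW (ofCoords h) hWV j z = b j z := by
  rw [coordB, zext_of_mem _ hz]
  refine (coordField_congr (h := fun _ => xi j) a b ?_).trans ?_
  · filter_upwards [eventually_fin0 hz] with w hw
    exact zext_of_mem _ hw
  · rw [coordField_eq, dx_const, mul_zero, zero_add, oddDer_xi]

lemma dxi_trans (k : Fin m → ℤ) (x : ℂ) (j : Fin m) (u : Gr m) :
    dxi j (trans k x u) = x ^ (-k j) • trans k x (dxi j u) := by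
  induction u using ExteriorAlgebra.induction with
  | algebraMap r => rw [AlgHom.commutes, dxi_algebraMap, map_zero, smul_zero]
  | ι v =>
    rw [trans_iota, dxi_iota, dxi_iota, AlgHom.commutes, map_mul, Algebra.smul_def]
  | mul a b ha hb =>
    rw [map_mul, dxi_mul, dxi_mul, ha, hb, map_add, map_mul, map_mul, trans_sg, smul_add,
      smul_mul_assoc, mul_smul_comm]
  | add a b ha hb => rw [map_add, map_add, map_add, ha, hb, map_add, smul_add]

lemma augm_trans (k : Fin m → ℤ) (x : ℂ) (u : Gr m) : augm (trans k x u) = augm u := by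
  induction u using ExteriorAlgebra.induction with
  | algebraMap r => rw [AlgHom.commutes]
  | ι v => rw [trans_iota]; simp [augm, ExteriorAlgebra.algebraMapInv]
  | mul a b ha hb =>
    have hm : ∀ u w : Gr m, augm (u * w) = augm u * augm w := fun u w =>
      map_mul (ExteriorAlgebra.algebraMapInv (R := ℂ) (M := Fin m → ℂ)) u w
    rw [map_mul, hm, hm, ha, hb]
  | add a b ha hb => rw [map_add, map_add, map_add, ha, hb]

lemma comp2_trans (k : ℤ) (x : ℂ) (l : Fin 3) (u : Gr 3) :
    comp2 l (trans (kkk k) x u) = x ^ (-2 * k) * comp2 l u := by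
  have e : x ^ (-2 * k) = x ^ (-k) * x ^ (-k) := by
    rw [show -2 * k = -k * 2 by ring, zpow_mul]; exact zpow_two _
  fin_cases l <;>
    simp only [comp2, Fin.zero_eta, Fin.mk_one, Fin.reduceFinMk, Matrix.cons_val, LinearMap.comp_apply,
      dxi_trans, map_smul, augm_trans, smul_smul, smul_eq_mul, e, mul_assoc]

lemma comp3_trans (k : ℤ) (x : ℂ) (u : Gr 3) :
    comp3 (trans (kkk k) x u) = x ^ (-3 * k) * comp3 u := by
  have e : x ^ (-3 * k) = x ^ (-k) * x ^ (-k) * x ^ (-k) := by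
    rw [show -3 * k = -k * (3 : ℕ) by push_cast; ring, zpow_mul, zpow_natCast]; ring
  simp only [comp3, LinearMap.comp_apply, dxi_trans, map_smul, augm_trans, smul_eq_mul, e,
    mul_assoc]

/-- The coefficient of `om l ∂/∂x` in a vector field of degree two. -/
def vA {k : ℤ} (v : Vect (kkk k) 2 U01) (l : Fin 3) (z : ℂ) : ℂ :=
  comp2 l (coordA ptInf_notMem v le_rfl z)

/-- The coefficient of `xi123 ∂/∂ξⱼ` in a vector field of degree two. -/
def vB {k : ℤ} (v : Vect (kkk k) 2 U01) (j : Fin 3) (z : ℂ) : ℂ :=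
  comp3 (coordB ptInf_notMem v le_rfl j z)

section
variable {k : ℤ} (v w : Vect (kkk k) 2 U01)

lemma coordA_eq {z : ℂ} (hz : z ≠ 0) :
    coordA ptInf_notMem v le_rfl z = ∑ l, vA v l z • om l :=
  eq_sum_comp2 (coordA_mem _ v le_rfl (pt_mem_U01 hz))

lemma coordB_eq (j : Fin 3) {z : ℂ} (hz : z ≠ 0) :
    coordB ptInf_notMem v le_rfl j z = vB v j z • xi123 :=
  eq_comp3 (coordB_mem _ v le_rfl j (pt_mem_U01 hz))

lemma vA_hol (l : Fin 3) : HolPunct (vA v l) := holPunct_of_at fun _ hz =>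
  ((sec_holAt _ (pt_mem_U01 hz)).dual (comp2 l)).differentiableAt

lemma vB_hol (j : Fin 3) : HolPunct (vB v j) := holPunct_of_at fun _ hz =>
  ((sec_holAt _ (pt_mem_U01 hz)).dual comp3).differentiableAt

variable {v w}

lemma vect_ext_comp (hA : ∀ l, ∀ z ≠ 0, vA v l z = vA w l z)
    (hB : ∀ j, ∀ z ≠ 0, vB v j z = vB w j z) : v = w := by
  refine vect_ext even_two ptInf_notMem (fun z hz => ?_) fun j z hz => ?_
  · simp only [coordA_eq _ (ne_zero_of_mem hz), hA _ z (ne_zero_of_mem hz)]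
  · simp only [coordB_eq _ _ (ne_zero_of_mem hz), hB _ z (ne_zero_of_mem hz)]

variable (v w)

lemma vA_add (l : Fin 3) {z : ℂ} (hz : z ≠ 0) : vA (v + w) l z = vA v l z + vA w l z := by
  simp only [vA, coordA, zext_of_mem _ (pt_mem_U01 hz)]
  exact map_add (comp2 l) _ _

lemma vB_add (j : Fin 3) {z : ℂ} (hz : z ≠ 0) : vB (v + w) j z = vB v j z + vB w j z := by
  simp only [vB, coordB, zext_of_mem _ (pt_mem_U01 hz)]
  exact map_add comp3 _ _

lemma vA_smul (c : ℂ) (l : Fin 3) {z : ℂ} (hz : z ≠ 0) : vA (c • v) l z = c * vA v l z := by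
  simp only [vA, coordA, zext_of_mem _ (pt_mem_U01 hz)]
  exact map_smul (comp2 l) _ _

lemma vB_smul (c : ℂ) (j : Fin 3) {z : ℂ} (hz : z ≠ 0) : vB (c • v) j z = c * vB v j z := by
  simp only [vB, coordB, zext_of_mem _ (pt_mem_U01 hz)]
  exact map_smul comp3 _ _

end

end

section

/-! ## Coboundaries in components -/

lemma U01_le_U0 : U01 ≤ U0 := inf_le_left

lemma U01_le_U1 : U01 ≤ U1 := inf_le_right

lemma mem_B1_iff {k : Fin m → ℤ} {v : Vect k 2 U01} : v ∈ B1 k ↔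
    ∃ (D : Vect k 2 U0) (E : Vect k 2 U1), vectRes k 2 U01_le_U0 D + vectRes k 2 U01_le_U1 E = v := by
  constructor
  · intro hv
    obtain ⟨_, ⟨D, rfl⟩, _, ⟨E, rfl⟩, h⟩ := Submodule.mem_sup.mp hv
    exact ⟨D, E, h⟩
  · rintro ⟨D, E, rfl⟩
    exact Submodule.add_mem_sup ⟨D, rfl⟩ ⟨E, rfl⟩

/-- The even coefficient of the vector field with components `α`. -/
def coefA (α : Fin 3 → ℂ → ℂ) (z : ℂ) : Gr 3 := ∑ l, α l z • om l

/-- The odd coefficients of the vector field with components `β`. -/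
def coefB (β : Fin 3 → ℂ → ℂ) (j : Fin 3) (z : ℂ) : Gr 3 := β j z • xi123

lemma comp2_coefA (α : Fin 3 → ℂ → ℂ) (l : Fin 3) (z : ℂ) : comp2 l (coefA α z) = α l z := by
  simp [coefA, comp2_om]

lemma comp3_coefB (β : Fin 3 → ℂ → ℂ) (j : Fin 3) (z : ℂ) : comp3 (coefB β j z) = β j z := by
  rw [coefB, map_smul, comp3_xi123, smul_eq_mul, mul_one]

lemma coefA_mem (α : Fin 3 → ℂ → ℂ) (z : ℂ) : coefA α z ∈ grDeg 3 2 :=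
  Submodule.sum_mem _ fun l _ => Submodule.smul_mem _ _ (om_mem l)

lemma coefB_mem (β : Fin 3 → ℂ → ℂ) (j : Fin 3) (z : ℂ) : coefB β j z ∈ grDeg 3 3 :=
  Submodule.smul_mem _ _ xi123_mem

lemma coefA_hol {α : Fin 3 → ℂ → ℂ} {z : ℂ} (h : ∀ l, AnalyticAt ℂ (α l) z) :
    HolAt (coefA α) z := HolAt.sum fun l _ => HolAt.smul (h l) (HolAt.const _ _)

lemma coefB_hol {β : Fin 3 → ℂ → ℂ} {z : ℂ} (j : Fin 3) (h : AnalyticAt ℂ (β j) z) :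
    HolAt (coefB β j) z := HolAt.smul h (HolAt.const _ _)

lemma isCoordField_coef (k : Fin 3 → ℤ) {V : Opens CP1} (hV : ptInf ∉ V) {α β : Fin 3 → ℂ → ℂ}
    (hα : ∀ l z, pt z ∈ V → AnalyticAt ℂ (α l) z) (hβ : ∀ j z, pt z ∈ V → AnalyticAt ℂ (β j) z) :
    IsCoordField k 2 V (coefA α) (coefB β) where
  even := even_two
  a_hol z hz := coefA_hol fun l => hα l z hz
  b_hol j z hz := coefB_hol j (hβ j z hz)
  a_deg := coefA_mem α
  b_deg := coefB_mem β
  inf h := absurd h hV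

/-- Only ξ_l has a nonzero product with `om l`. This is the origin of the mixed term with factor k:
in the second chart, `om l` ∂/∂x acquires a multiple of `om l` times the Euler field, hence of
`xi123` ∂/∂ξ_l alone. -/
lemma om_mul_oddDer_euler (k : ℤ) (l : Fin 3) (u : Gr 3) :
    om l * oddDer (eulerCoef (kkk k)) u = (k * epsSign l) • (xi123 * dxi l u) := by
  simp only [oddDer, Finset.mul_sum, eulerCoef, smul_mul_assoc, mul_smul_comm]
  simp only [← mul_assoc, om_mul_xi]
  rw [Finset.sum_eq_single l]
  · rw [if_pos rfl, smul_mul_assoc, smul_smul]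
  · intro j _ hj
    rw [if_neg hj.symm, zero_mul, smul_zero]
  · simp

lemma coefA_mul_trans (k : ℤ) (α : Fin 3 → ℂ → ℂ) (y x : ℂ) (hx : x ≠ 0) (u : Gr 3) :
    coefA α y * trans (kkk k) x u =
      trans (kkk k) x ((∑ l, (x ^ (2 * k) * α l y) • om l) * u) := by
  rw [map_mul, map_sum, coefA]
  congr 1
  refine Finset.sum_congr rfl fun l _ => ?_
  rw [map_smul, trans_om, smul_smul, mul_right_comm, ← zpow_add₀ hx]
  simp

/-- Vector fields of degree two on the second chart. -/
lemma isCoordField_chart1 (k : ℤ) {α β p q : Fin 3 → ℂ → ℂ}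
    (hp : ∀ l, Differentiable ℂ (p l)) (hq : ∀ l, Differentiable ℂ (q l))
    (hα : ∀ l, ∀ z ≠ 0, α l z = z ^ (2 - 2 * k) * p l z⁻¹)
    (hβ : ∀ l, ∀ z ≠ 0, β l z = z ^ (-2 * k) * q l z⁻¹ +
      k * epsSign l * (z ^ (1 - 2 * k) * p l z⁻¹)) :
    IsCoordField (kkk k) 2 U1 (coefA α) (coefB β) := by
  have hz0 : ∀ z, pt z ∈ U1 → z ≠ 0 := fun z h h0 => h (congrArg pt h0)
  have han : ∀ (n : ℤ) (r : ℂ → ℂ), Differentiable ℂ r → ∀ z ≠ 0,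
      AnalyticAt ℂ (fun z => z ^ n * r z⁻¹) z := fun n r hr z hz =>
    ((holPunct_of_entire hr).comp_inv.zpow_mul n).analyticAt
      (isOpen_compl_singleton.mem_nhds hz)
  have hne : ∀ {z : ℂ}, z ≠ 0 → ∀ᶠ w in 𝓝 z, w ≠ 0 := fun hz =>
    isOpen_compl_singleton.mem_nhds hz
  refine ⟨even_two, fun z hz => coefA_hol fun l => ?_, fun j z hz => coefB_hol j ?_, coefA_mem α,
    coefB_mem β, fun _ => ⟨coefA fun l z => -p l z, coefB q, ?_, fun j => ?_, fun g hg => ?_⟩⟩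
  · refine (han (2 - 2 * k) _ (hp l) z (hz0 z hz)).congr ?_
    filter_upwards [hne (hz0 z hz)] with w hw using (hα l w hw).symm
  · refine ((han (-2 * k) _ (hq j) z (hz0 z hz)).add
      (analyticAt_const (v := k * epsSign j).mul (han (1 - 2 * k) _ (hp j) z (hz0 z hz)))).congr ?_
    filter_upwards [hne (hz0 z hz)] with w hw using (hβ j w hw).symm
  · exact coefA_hol fun l => ((hp l).neg).analyticAt 0
  · exact coefB_hol j ((hq j).analyticAt 0)
  · filter_upwards [trans_hol_eventually hg] with y ⟨hy, hgy⟩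
    have hy' := inv_ne_zero hy
    rw [coordField_eq, coordField_eq, dx_trans_inv _ hy hgy, inv_inv, mul_sub, mul_neg,
      mul_smul_comm, mul_smul_comm, coefA_mul_trans k α _ _ hy', map_add]
    -- The sign in the witness `-p` comes from ∂/∂x = -y² ∂/∂y + …; the power x^(2-2k) absorbs y²
    -- and the rescaling of the two odd generators in `om l`.
    have e1 : (∑ l, (y⁻¹ ^ (2 * k) * α l y⁻¹) • om l) =
        -((y ^ (-2 : ℤ)) • coefA (fun l z => -p l z) y) := by
      rw [coefA, Finset.smul_sum, ← Finset.sum_neg_distrib]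
      refine Finset.sum_congr rfl fun l _ => ?_
      rw [smul_smul, ← neg_smul, hα l _ hy', inv_inv, ← mul_assoc, ← zpow_add₀ hy', inv_zpow']
      congr 1
      rw [show -(2 * k + (2 - 2 * k)) = (-2 : ℤ) by ring]
      ring
    rw [e1, neg_mul, map_neg, smul_neg, neg_neg, smul_mul_assoc, map_smul, smul_smul]
    have e2 : y ^ 2 * y ^ (-2 : ℤ) = 1 := by
      rw [← zpow_natCast, ← zpow_add₀ hy]; simp
    -- The mixed term in β cancels the Euler correction produced by differentiating the odd change
    -- of coordinates; what remains is `q`.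
    have key : oddDer (fun j => coefB β j y⁻¹) (trans (kkk k) y⁻¹ (g y)) =
        y • (coefA α y⁻¹ * oddDer (eulerCoef (kkk k)) (trans (kkk k) y⁻¹ (g y))) +
          trans (kkk k) y⁻¹ (oddDer (fun j => coefB q j y) (g y)) := by
      have hs : ∀ (c : Fin 3 → Gr 3) (u : Gr 3), oddDer c u = ∑ l, c l * dxi l u := fun _ _ => rfl
      rw [coefA, Finset.sum_mul, Finset.smul_sum, hs (fun j => coefB β j y⁻¹),
        hs (fun j => coefB q j y), map_sum, ← Finset.sum_add_distrib]
      refine Finset.sum_congr rfl fun l _ => ?_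
      have e3 : trans (kkk k) y⁻¹ (dxi l (g y)) =
          y⁻¹ ^ k • dxi l (trans (kkk k) y⁻¹ (g y)) := by
        rw [dxi_trans, smul_smul, ← zpow_add₀ hy']
        simp
      rw [smul_mul_assoc, om_mul_oddDer_euler, coefB, coefB, smul_mul_assoc, smul_mul_assoc,
        map_smul, map_mul, trans_xi123, e3, smul_mul_assoc, mul_smul_comm, smul_smul, smul_smul,
        smul_smul, smul_smul, ← add_smul, hα l _ hy', hβ l _ hy', inv_inv]
      congr 1
      have z1 : y⁻¹ ^ (-2 * k) = y⁻¹ ^ (-3 * k) * y⁻¹ ^ k := by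
        rw [← zpow_add₀ hy']; congr 1; ring
      have z2 : y⁻¹ ^ (1 - 2 * k) = y * y⁻¹ ^ (2 - 2 * k) := by
        nth_rw 2 [← inv_inv y]
        rw [← zpow_neg_one y⁻¹, ← zpow_add₀ hy']; congr 1; ring
      rw [z1, z2]
      ring
    rw [e2, one_smul, key]
    abel

variable {k : ℤ}

lemma vA_ofCoords {α β : Fin 3 → ℂ → ℂ} {V : Opens CP1} (hV : U01 ≤ V)
    (h : IsCoordField (kkk k) 2 V (coefA α) (coefB β)) (l : Fin 3) {z : ℂ} (hz : z ≠ 0) :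
    vA (vectRes (kkk k) 2 hV (ofCoords h)) l z = α l z := by
  rw [← comp2_coefA α, ← coordA_ofCoords h ptInf_notMem hV (pt_mem_U01 hz)]
  rfl

lemma vB_ofCoords {α β : Fin 3 → ℂ → ℂ} {V : Opens CP1} (hV : U01 ≤ V)
    (h : IsCoordField (kkk k) 2 V (coefA α) (coefB β)) (j : Fin 3) {z : ℂ} (hz : z ≠ 0) :
    vB (vectRes (kkk k) 2 hV (ofCoords h)) j z = β j z := by
  rw [← comp3_coefB β, ← coordB_ofCoords h ptInf_notMem hV j (pt_mem_U01 hz)]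
  rfl

/-- Sufficient condition for being a coboundary. -/
theorem mem_B1_of_decomposition (v : Vect (kkk k) 2 U01) {α β p q : Fin 3 → ℂ → ℂ}
    (hα : ∀ l, Differentiable ℂ (α l)) (hβ : ∀ l, Differentiable ℂ (β l))
    (hp : ∀ l, Differentiable ℂ (p l)) (hq : ∀ l, Differentiable ℂ (q l))
    (hA : ∀ l, ∀ z ≠ 0, vA v l z = α l z + z ^ (2 - 2 * k) * p l z⁻¹)
    (hB : ∀ l, ∀ z ≠ 0, vB v l z = β l z + (z ^ (-2 * k) * q l z⁻¹ +
      k * epsSign l * (z ^ (1 - 2 * k) * p l z⁻¹))) : v ∈ B1 (kkk k) := by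
  have h0 : IsCoordField (kkk k) 2 U0 (coefA α) (coefB β) :=
    isCoordField_coef _ ptInf_notMem_U0 (fun l z _ => (hα l).analyticAt z)
      fun l z _ => (hβ l).analyticAt z
  have h1 : IsCoordField (kkk k) 2 U1 (coefA fun l z => z ^ (2 - 2 * k) * p l z⁻¹)
      (coefB fun l z => z ^ (-2 * k) * q l z⁻¹ +
      k * epsSign l * (z ^ (1 - 2 * k) * p l z⁻¹)) :=
    isCoordField_chart1 k hp hq (fun _ _ _ => rfl) fun _ _ _ => rfl
  have e : vectRes (kkk k) 2 U01_le_U0 (ofCoords h0) +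
      vectRes (kkk k) 2 U01_le_U1 (ofCoords h1) = v :=
    vect_ext_comp (fun l z hz => by rw [vA_add _ _ _ hz, vA_ofCoords _ _ _ hz, vA_ofCoords _ _ _ hz,
      hA l z hz]) (fun l z hz => by
        rw [vB_add _ _ _ hz, vB_ofCoords _ _ _ hz, vB_ofCoords _ _ _ hz, hB l z hz])
  exact mem_B1_iff.mpr ⟨_, _, e⟩

lemma vA_res_chart0 (D : Vect (kkk k) 2 U0) (l : Fin 3) :
    ∃ α : ℂ → ℂ, Differentiable ℂ α ∧
      ∀ z ≠ 0, vA (vectRes (kkk k) 2 U01_le_U0 D) l z = α z := by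
  refine ⟨fun z => comp2 l (coordA ptInf_notMem_U0 D le_rfl z), fun z =>
    ((sec_holAt _ (pt_mem_U0 z)).dual (comp2 l)).differentiableAt, fun z hz => ?_⟩
  exact congrArg (comp2 l) (coordA_res ptInf_notMem_U0 ptInf_notMem D le_rfl U01_le_U0
    (pt_mem_U01 hz))

lemma vB_res_chart0 (D : Vect (kkk k) 2 U0) (j : Fin 3) :
    ∃ β : ℂ → ℂ, Differentiable ℂ β ∧
      ∀ z ≠ 0, vB (vectRes (kkk k) 2 U01_le_U0 D) j z = β z := by
  refine ⟨fun z => comp3 (coordB ptInf_notMem_U0 D le_rfl j z), fun z =>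
    ((sec_holAt _ (pt_mem_U0 z)).dual comp3).differentiableAt, fun z hz => ?_⟩
  exact congrArg comp3 (coordB_res ptInf_notMem_U0 ptInf_notMem D le_rfl U01_le_U0 j
    (pt_mem_U01 hz))

/-- The section of a homogeneous power of `x` over the second chart. -/
def chart1Sec (k : Fin m → ℤ) (n : ℤ) (u : Gr m) (g : ℂ → Gr m) (hg : HolAt g 0)
    (h : ∀ y ≠ 0, y⁻¹ ^ n • u = trans k y⁻¹ (g y)) : Sec k U1 :=
  ⟨fun z => (z : ℂ) ^ n • u, fun z hz => by
    have hz0 : z ≠ 0 := fun h0 => hz (congrArg pt h0)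
    refine (HolAt.smul (analyticAt_id.fun_zpow (n := n) hz0) (HolAt.const u z)).congr ?_
    filter_upwards [eventually_fin0 hz] with w hw
    rw [zext_of_mem _ hw]
    rfl, fun hU => ⟨g, hg, by
      filter_upwards [eventually_inf hU, self_mem_nhdsWithin] with y hy hy0
      rw [zext_of_mem _ hy]
      exact h y hy0⟩⟩

lemma chart1Sec_apply (D : Vect (kkk k) 2 U1) (n : ℤ) (u : Gr 3) (g : ℂ → Gr 3) (hg : HolAt g 0)
    (h : ∀ y ≠ 0, y⁻¹ ^ n • u = trans (kkk k) y⁻¹ (g y)) {z : ℂ} (hz : z ≠ 0) :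
    zext (D.1 ⟨U1, le_rfl⟩ (chart1Sec (kkk k) n u g hg h)).1 z =
      (n * z ^ (n - 1)) • (coordA ptInf_notMem (vectRes (kkk k) 2 U01_le_U1 D) le_rfl z * u) +
      z ^ n • oddDer (fun j => coordB ptInf_notMem (vectRes (kkk k) 2 U01_le_U1 D) le_rfl j z)
        u := by
  have hz1 := pt_mem_U01 hz
  have h1 := D.2.1 ⟨U1, le_rfl⟩ ⟨U01, U01_le_U1⟩ U01_le_U1 (chart1Sec (kkk k) n u g hg h)
  have h2 := congrFun (congrArg Subtype.val h1) ⟨z, hz1⟩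
  rw [zext_of_mem _ (pt_mem_U1 hz)]
  refine h2.trans ((vect_apply ptInf_notMem even_two (vectRes (kkk k) 2 U01_le_U1 D) le_rfl _
    ⟨z, hz1⟩).trans ?_)
  refine (coordField_congr (h := fun w => w ^ n • u) _ _ ?_).trans ?_
  · filter_upwards [eventually_fin0 hz1] with w hw
    exact zext_of_mem _ hw
  · exact (coordField_scal _ _ (analyticAt_id.fun_zpow hz) u).trans (by simp only [id, deriv_zpow])

lemma chart1Sec_inf (f : Sec (kkk k) U1) :
    ∃ g : ℂ → Gr 3, HolAt g 0 ∧ ∀ᶠ y in 𝓝[≠] (0 : ℂ), zext f.1 y⁻¹ = trans (kkk k) y⁻¹ (g y) :=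
  f.2.2 ptInf_mem_U1

/-- The even component is read off from the value of the field on the coordinate y = 1/x, which must
be holomorphic at y = 0. -/
lemma vA_res_chart1 (D : Vect (kkk k) 2 U1) (l : Fin 3) :
    ∃ p : ℂ → ℂ, Differentiable ℂ p ∧ ∀ z ≠ 0,
      vA (vectRes (kkk k) 2 U01_le_U1 D) l z = z ^ (2 - 2 * k) * p z⁻¹ := by
  set v := vectRes (kkk k) 2 U01_le_U1 D with hv
  have hg : HolAt (fun y : ℂ => y • (1 : Gr 3)) 0 := HolAt.smul analyticAt_id (HolAt.const _ _)
  have h1 : ∀ y : ℂ, y ≠ 0 → y⁻¹ ^ (-1 : ℤ) • (1 : Gr 3) = trans (kkk k) y⁻¹ (y • 1) := by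
    intro y _
    rw [map_smul, map_one, zpow_neg_one, inv_inv]
  obtain ⟨g, hgh, hg'⟩ := chart1Sec_inf (D.1 ⟨U1, le_rfl⟩ (chart1Sec (kkk k) _ _ _ hg h1))
  obtain ⟨p, hp, hp'⟩ := exists_entire_of_puncture (F := fun y => y ^ (2 - 2 * k) * vA v l y⁻¹)
    ((vA_hol v l).comp_inv.zpow_mul _) ((hgh.dual (comp2 l)).neg) (by
      filter_upwards [hg', self_mem_nhdsWithin] with y hy hy0
      have hy0 : y ≠ 0 := hy0
      rw [chart1Sec_apply D _ _ _ _ _ (inv_ne_zero hy0)] at hy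
      have h3 := oddDer_algebraMap
        (fun j => coordB ptInf_notMem (vectRes (kkk k) 2 U01_le_U1 D) le_rfl j y⁻¹) 1
      rw [map_one] at h3
      rw [h3, smul_zero, add_zero, mul_one] at hy
      have h4 := congrArg (comp2 l) hy
      rw [comp2_trans, map_smul, smul_eq_mul] at h4
      change _ * vA v l y⁻¹ = _ at h4
      have e1 : y⁻¹ ^ (-2 * k) = y ^ (2 * k) := by rw [inv_zpow']; congr 1; ring
      have e2 : y⁻¹ ^ (-1 - 1 : ℤ) = y ^ (2 : ℤ) := by rw [inv_zpow']; congr 1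
      have e3 : y ^ (2 - 2 * k) = y ^ (2 : ℤ) * (y ^ (2 * k))⁻¹ := by
        rw [zpow_sub₀ hy0]; rfl
      have e4 : y ^ (2 * k) ≠ 0 := zpow_ne_zero _ hy0
      rw [e1, e2] at h4
      rw [e3, Pi.neg_apply, ← inv_mul_cancel_left₀ e4 (comp2 l (g y)), ← h4]
      push_cast
      ring)
  refine ⟨p, hp, fun z hz => ?_⟩
  rw [hp' _ (inv_ne_zero hz), inv_inv, ← mul_assoc, inv_zpow', ← zpow_add₀ hz]
  simp

/-- The field is evaluated on η_j = x^(-k) ξ_j. Differentiating the factor x^(-k) contributes the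
term with the even component, and holomorphy at y = 0 makes q entire. -/
lemma vB_res_chart1 (D : Vect (kkk k) 2 U1) (j : Fin 3) :
    ∃ q : ℂ → ℂ, Differentiable ℂ q ∧ ∀ z ≠ 0,
      vB (vectRes (kkk k) 2 U01_le_U1 D) j z = z ^ (-2 * k) * q z⁻¹ +
        k * epsSign j * (z⁻¹ * vA (vectRes (kkk k) 2 U01_le_U1 D) j z) := by
  set v := vectRes (kkk k) 2 U01_le_U1 D with hv
  have hg : HolAt (fun _ : ℂ => xi j) 0 := HolAt.const _ _
  have h1 : ∀ y : ℂ, y ≠ 0 → y⁻¹ ^ (-k) • xi j = trans (kkk k) y⁻¹ (xi j) := by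
    intro y _
    rw [trans_xi]
  obtain ⟨g, hgh, hg'⟩ := chart1Sec_inf (D.1 ⟨U1, le_rfl⟩ (chart1Sec (kkk k) _ _ _ hg h1))
  have hF : HolPunct fun y => y ^ (-2 * k) *
      (vB v j y⁻¹ + -(k * epsSign j) * (y ^ (1 : ℤ) * vA v j y⁻¹)) :=
    HolPunct.zpow_mul ((vB_hol v j).comp_inv.add
      (((vA_hol v j).comp_inv.zpow_mul 1).const_mul _)) _
  obtain ⟨q, hq, hq'⟩ := exists_entire_of_puncture hF (hgh.dual comp3) (by
      filter_upwards [hg', self_mem_nhdsWithin] with y hy hy0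
      have hy0 : y ≠ 0 := hy0
      have hy1 := inv_ne_zero hy0
      rw [chart1Sec_apply D _ _ _ _ _ hy1, ← hv, oddDer_xi, coordA_eq _ hy1, coordB_eq _ _ hy1,
        Finset.sum_mul] at hy
      simp only [smul_mul_assoc, om_mul_xi] at hy
      rw [Finset.sum_eq_single j (fun l _ hl => by rw [if_neg hl, smul_zero]) (by simp), if_pos rfl,
        smul_smul, smul_smul, smul_smul, ← add_smul] at hy
      have h4 := congrArg comp3 hy
      rw [comp3_trans, map_smul, smul_eq_mul, comp3_xi123, mul_one] at h4
      have e1 : y⁻¹ ^ (-3 * k) = y ^ (2 * k) * y ^ k := by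
        rw [inv_zpow', ← zpow_add₀ hy0]; congr 1; ring
      have e2 : y⁻¹ ^ (-k - 1 : ℤ) = y ^ k * y := by
        rw [inv_zpow', ← zpow_add_one₀ hy0]; congr 1; ring
      have e3 : y⁻¹ ^ (-k) = y ^ k := by rw [inv_zpow', neg_neg]
      have e4 : y ^ (2 * k) ≠ 0 := zpow_ne_zero _ hy0
      have e5 : y ^ k ≠ 0 := zpow_ne_zero _ hy0
      have e6 : y ^ (-2 * k) = (y ^ (2 * k))⁻¹ := by rw [← zpow_neg]; congr 1; ring
      rw [e1, e2, e3] at h4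
      rw [e6, zpow_one, ← inv_mul_cancel_left₀ (mul_ne_zero e4 e5) (comp3 (g y)), ← h4]
      push_cast
      field_simp
      ring)
  refine ⟨q, hq, fun z hz => ?_⟩
  rw [hq' _ (inv_ne_zero hz), inv_inv, ← mul_assoc (z ^ _), inv_zpow', ← zpow_add₀ hz]
  simp

/-- The coboundaries in components. -/
theorem decomposition_of_mem_B1 {v : Vect (kkk k) 2 U01} (hv : v ∈ B1 (kkk k)) :
    ∃ α β p q : Fin 3 → ℂ → ℂ, (∀ l, Differentiable ℂ (α l)) ∧ (∀ l, Differentiable ℂ (β l)) ∧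
    (∀ l, Differentiable ℂ (p l)) ∧ (∀ l, Differentiable ℂ (q l)) ∧
    (∀ l, ∀ z ≠ 0, vA v l z = α l z + z ^ (2 - 2 * k) * p l z⁻¹) ∧
    (∀ l, ∀ z ≠ 0, vB v l z = β l z + (z ^ (-2 * k) * q l z⁻¹ +
      k * epsSign l * (z ^ (1 - 2 * k) * p l z⁻¹))) := by
  obtain ⟨D, E, rfl⟩ := mem_B1_iff.mp hv
  choose α hα hα' using vA_res_chart0 D
  choose β hβ hβ' using vB_res_chart0 D
  choose p hp hp' using vA_res_chart1 E
  choose q hq hq' using vB_res_chart1 E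
  refine ⟨α, β, p, q, hα, hβ, hp, hq, fun l z hz => ?_, fun l z hz => ?_⟩
  · rw [vA_add _ _ _ hz, hα' _ z hz, hp' _ z hz]
  · have e : z ^ (1 - 2 * k) = z⁻¹ * z ^ (2 - 2 * k) := by
      rw [← zpow_neg_one, ← zpow_add₀ hz]; congr 1; ring
    rw [vB_add _ _ _ hz, hβ' _ z hz, hq' _ z hz, hp' _ z hz, e]
    ring

end

section

/-! ## The first cohomology in Laurent coefficients -/

variable {k : ℤ}

lemma HolPunct.add' {f g : ℂ → ℂ} (hf : HolPunct f) (hg : HolPunct g) :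
    HolPunct fun z => f z + g z := hf.add hg

lemma HolPunct.const_mul' {f : ℂ → ℂ} (hf : HolPunct f) (c : ℂ) : HolPunct fun z => c * f z :=
  hf.const_mul c

/-- The Laurent coefficients of the even components. -/
def cA (v : Vect (kkk k) 2 U01) (l : Fin 3) (n : ℤ) : ℂ := laurentCoef n (vA v l)

/-- The Laurent coefficients of the odd components. -/
def cB (v : Vect (kkk k) 2 U01) (j : Fin 3) (n : ℤ) : ℂ := laurentCoef n (vB v j)

lemma cA_sub_smul (v w : Vect (kkk k) 2 U01) (c : ℂ) (l : Fin 3) (n : ℤ) :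
    cA (v + -c • w) l n = cA v l n - c * cA w l n := by
  unfold cA
  rw [laurentCoef_congr fun z hz => by rw [vA_add _ _ _ hz, vA_smul _ _ _ hz],
    laurentCoef_add _ (vA_hol v l) ((vA_hol w l).const_mul _), laurentCoef_const_mul]
  ring

lemma cB_sub_smul (v w : Vect (kkk k) 2 U01) (c : ℂ) (j : Fin 3) (n : ℤ) :
    cB (v + -c • w) j n = cB v j n - c * cB w j n := by
  unfold cB
  rw [laurentCoef_congr fun z hz => by rw [vB_add _ _ _ hz, vB_smul _ _ _ hz],
    laurentCoef_add _ (vB_hol v j) ((vB_hol w j).const_mul _), laurentCoef_const_mul]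
  ring

/-- The vanishing of a cohomology class in terms of Laurent coefficients. -/
theorem mem_B1_iff_coef (hk : 2 ≤ k) (v : Vect (kkk k) 2 U01) : v ∈ B1 (kkk k) ↔
    (∀ l n, 2 - 2 * k < n → n < 0 → cA v l n = 0) ∧
    (∀ j n, 1 - 2 * k < n → n < 0 → cB v j n = 0) ∧
    ∀ j, cB v j (1 - 2 * k) = k * epsSign j * cA v j (2 - 2 * k) := by
  have hi : ∀ {r : ℂ → ℂ}, Differentiable ℂ r → ∀ n : ℤ, HolPunct fun z => z ^ n * r z⁻¹ :=
    fun hr n => (holPunct_of_entire hr).comp_inv.zpow_mul n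
  constructor
  · intro hv
    obtain ⟨α, β, p, q, hα, hβ, hp, hq, hA, hB⟩ := decomposition_of_mem_B1 hv
    have eA : ∀ l n, n < 0 → cA v l n = laurentCoef (n - (2 - 2 * k)) fun z => p l z⁻¹ := by
      intro l n hn
      rw [cA, laurentCoef_congr (hA l), laurentCoef_add _ (holPunct_of_entire (hα l)) (hi (hp l) _),
        laurentCoef_entire (hα l) hn, laurentCoef_zpow_mul, zero_add]
    have eB : ∀ j n, n < 0 → cB v j n = (laurentCoef (n - (-2 * k)) fun z => q j z⁻¹) +
        k * epsSign j * laurentCoef (n - (1 - 2 * k)) fun z => p j z⁻¹ := by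
      intro j n hn
      rw [cB, laurentCoef_congr (hB j), laurentCoef_add _ (holPunct_of_entire (hβ j))
        ((hi (hq j) _).add' ((hi (hp j) _).const_mul' _)), laurentCoef_entire (hβ j) hn, zero_add,
        laurentCoef_add _ (hi (hq j) _) ((hi (hp j) _).const_mul _), laurentCoef_const_mul,
        laurentCoef_zpow_mul, laurentCoef_zpow_mul]
    refine ⟨fun l n h1 h2 => ?_, fun j n h1 h2 => ?_, fun j => ?_⟩
    · rw [eA l n h2, laurentCoef_entire_inv (hp l) (by lia)]
    · rw [eB j n h2, laurentCoef_entire_inv (hp j) (by lia), laurentCoef_entire_inv (hq j) (by lia),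
        mul_zero, add_zero]
    · rw [eB j _ (by lia), eA j _ (by lia), laurentCoef_entire_inv (hq j) (by lia), sub_self,
        sub_self, zero_add]
  · rintro ⟨h1, h2, h3⟩
    have hAdec : ∀ l, ∃ p q : ℂ → ℂ, Differentiable ℂ p ∧ Differentiable ℂ q ∧
        ∀ z ≠ 0, vA v l z = p z + z ^ (2 - 2 * k) * q z⁻¹ := by
      intro l
      -- The vanishing degrees are 3-2k, …, -1; k ≥ 2 makes 2k-3 a natural number.
      obtain ⟨p, q, hp, hq, h⟩ := laurent_decomposition_of_coef (vA_hol v l) (2 * k - 3).toNat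
        fun n hn hn' => h1 l n (by lia) hn'
      rw [show (-1 - ((2 * k - 3).toNat : ℤ)) = 2 - 2 * k by lia] at h
      exact ⟨p, q, hp, hq, h⟩
    choose α p hα hp hA using hAdec
    have hBdec : ∀ j, ∃ β q : ℂ → ℂ, Differentiable ℂ β ∧ Differentiable ℂ q ∧
        ∀ z ≠ 0, vB v j z + -(k * epsSign j) * (z ^ (1 - 2 * k) * p j z⁻¹) =
          β z + z ^ (-2 * k) * q z⁻¹ := by
      intro j
      -- The mixed term is already fixed by the even components, so it is removed first; the
      -- difference must have no coefficients in degrees 1-2k, …, -1.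
      have hp' := (hi (hp j) (1 - 2 * k)).const_mul (-(k * epsSign j))
      obtain ⟨β, q, hβ, hq, h⟩ := laurent_decomposition_of_coef
        ((vB_hol v j).add hp') (2 * k - 1).toNat (fun n hn hn' => by
          refine (laurentCoef_add n (vB_hol v j) hp').trans ?_
          rw [laurentCoef_const_mul, laurentCoef_zpow_mul]
          change cB v j n + _ = 0
          -- In the lowest degree the mixed term contributes the constant term of p_j(1/z), which is
          -- the coefficient of a_j in degree 2-2k; the boundary relation cancels it. In higher
          -- degrees p_j(1/z) contributes nothing.
          rcases (show 1 - 2 * k = n ∨ 1 - 2 * k < n by lia) with rfl | hn''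
          · have : cA v j (2 - 2 * k) = laurentCoef 0 fun z => p j z⁻¹ := by
              rw [cA, laurentCoef_congr (hA j), laurentCoef_add _ (holPunct_of_entire (hα j))
                (hi (hp j) _), laurentCoef_entire (hα j) (by lia), laurentCoef_zpow_mul, zero_add,
                sub_self]
            rw [h3, this, sub_self]
            ring
          · rw [h2 j n hn'' hn', laurentCoef_entire_inv (hp j) (by lia)]
            ring)
      rw [show (-1 - ((2 * k - 1).toNat : ℤ)) = -2 * k by lia] at h
      exact ⟨β, q, hβ, hq, h⟩
    choose β q hβ hq hB using hBdec
    refine mem_B1_of_decomposition v hα hβ hp hq hA fun l z hz => ?_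
    linear_combination hB l z hz

/-- The exponent -1 is needed for k = 1, where the power y^(1-2k) has a simple pole that a zero of r
compensates. -/
lemma exists_entire_zpow_mul {r : ℂ → ℂ} (hr : Differentiable ℂ r) {n : ℤ}
    (h : 0 ≤ n ∨ n = -1 ∧ r 0 = 0) :
    ∃ q : ℂ → ℂ, Differentiable ℂ q ∧ ∀ y ≠ 0, q y = y ^ n * r y := by
  rcases h with h | ⟨rfl, h⟩
  · lift n to ℕ using h
    exact ⟨fun y => y ^ n * r y, by fun_prop, fun y _ => by rw [zpow_natCast]⟩
  · obtain ⟨s, hs, hs'⟩ := entire_eq_add_mul hr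
    refine ⟨s, hs, fun y hy => ?_⟩
    rw [hs' y, h, zpow_neg_one]
    field_simp
    ring

/-- For `k ≤ 1` the first cohomology vanishes. -/
theorem mem_B1_of_le_one (hk : k ≤ 1) (v : Vect (kkk k) 2 U01) : v ∈ B1 (kkk k) := by
  choose α p hα hp hA using fun l => laurent_decomposition (vA_hol v l)
  choose β r hβ hr hB using fun j => laurent_decomposition (vB_hol v j)
  -- The constant ε r(0) is moved from the part on `U0` to the part on `U1`. Through the mixed term
  -- it subtracts k ε² r(0) from r, so for k = 1 the remaining function vanishes at 0 and can be
  -- divided by y.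
  have hs : ∀ l, Differentiable ℂ fun y => y * p l y + epsSign l * r l 0 := fun l => by
    have := hp l
    fun_prop
  choose P hP hP' using fun l => exists_entire_zpow_mul (hs l) (n := 2 - 2 * k)
    (Or.inl (by lia))
  have ht : ∀ l, Differentiable ℂ fun y =>
      r l y - k * epsSign l * (y * p l y + epsSign l * r l 0) := fun l => by
    have := hp l
    have := hr l
    fun_prop
  choose Q hQ hQ' using fun l => exists_entire_zpow_mul (ht l) (n := 1 - 2 * k) (by
    rcases eq_or_lt_of_le hk with rfl | hk'
    · right
      refine ⟨by norm_num, ?_⟩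
      have := epsSign_sq l
      push_cast
      linear_combination -r l 0 * this
    · left; lia)
  refine mem_B1_of_decomposition v (α := fun l z => α l z - epsSign l * r l 0)
    (fun l => (hα l).sub_const _) hβ hP hQ (fun l z hz => ?_) fun l z hz => ?_
  · have e : z ^ (2 - 2 * k) * z⁻¹ ^ (2 - 2 * k) = 1 := by
      rw [← mul_zpow, mul_inv_cancel₀ hz, one_zpow]
    rw [hA l z hz, hP' l _ (inv_ne_zero hz), ← mul_assoc, e]
    ring
  · have e1 : z ^ (-2 * k) * z⁻¹ ^ (1 - 2 * k) = z⁻¹ := by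
      rw [inv_zpow', ← zpow_add₀ hz, ← zpow_neg_one]; congr 1; ring
    have e2 : z ^ (1 - 2 * k) * z⁻¹ ^ (2 - 2 * k) = z⁻¹ := by
      rw [inv_zpow', ← zpow_add₀ hz, ← zpow_neg_one]; congr 1; ring
    rw [hB l z hz, hP' l _ (inv_ne_zero hz), hQ' l _ (inv_ne_zero hz), ← mul_assoc (z ^ (-2 * k)),
      ← mul_assoc (z ^ (1 - 2 * k)), e1, e2]
    ring

/-! ## The action of `e''` and `f''` -/

lemma coordA_bracket {p : ℕ} {V : Opens CP1} {κ : Fin m → ℤ} {a : ℂ → Gr m} {b : Fin m → ℂ → Gr m}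
    (h : IsCoordField κ 0 ⊤ a b) (hp : Even p) (hV : ptInf ∉ V) (v : Vect κ p V) {z : ℂ}
    (hz : pt z ∈ V) :
    coordA hV (bracket (vectRes κ 0 le_top (ofCoords h)) v) le_rfl z =
      coordField a b (coordA hV v le_rfl) z -
        coordField (coordA hV v le_rfl) (coordB hV v le_rfl) a z := by
  rw [coordA, zext_of_mem _ hz]
  have e : coordField (coordA hV v le_rfl) (coordB hV v le_rfl)
      (zext ((ofCoords h).1 ⟨V, le_top⟩ (xSec κ hV)).1) z =
      coordField (coordA hV v le_rfl) (coordB hV v le_rfl) a z := by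
    refine coordField_congr _ _ ?_
    filter_upwards [eventually_fin0 hz] with w hw
    exact coordA_ofCoords h hV le_top hw
  rw [← e]
  exact congrArg (coordField a b (coordA hV v le_rfl) z - ·) (vect_apply hV hp v le_rfl _ ⟨z, hz⟩)

lemma coordB_bracket {p : ℕ} {V : Opens CP1} {κ : Fin m → ℤ} {a : ℂ → Gr m} {b : Fin m → ℂ → Gr m}
    (h : IsCoordField κ 0 ⊤ a b) (hp : Even p) (hV : ptInf ∉ V) (v : Vect κ p V) (j : Fin m) {z : ℂ}
    (hz : pt z ∈ V) :
    coordB hV (bracket (vectRes κ 0 le_top (ofCoords h)) v) le_rfl j z =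
      coordField a b (coordB hV v le_rfl j) z -
        coordField (coordA hV v le_rfl) (coordB hV v le_rfl) (b j) z := by
  rw [coordB, zext_of_mem _ hz]
  have e : coordField (coordA hV v le_rfl) (coordB hV v le_rfl)
      (zext ((ofCoords h).1 ⟨V, le_top⟩ (constSec κ hV (xi j))).1) z =
      coordField (coordA hV v le_rfl) (coordB hV v le_rfl) (b j) z := by
    refine coordField_congr _ _ ?_
    filter_upwards [eventually_fin0 hz] with w hw
    exact coordB_ofCoords h hV le_top j hw
  rw [← e]
  exact congrArg (coordField a b (coordB hV v le_rfl j) z - ·)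
    (vect_apply hV hp v le_rfl _ ⟨z, hz⟩)

/-- The action of a global vector field on the cocycles. -/
abbrev adv (w : Vect (kkk k) 0 ⊤) (v : Vect (kkk k) 2 U01) : Vect (kkk k) 2 U01 :=
  bracket (vectRes (kkk k) 0 le_top w) v

section
variable (v : Vect (kkk k) 2 U01)

lemma comp2_dx_coordA (l : Fin 3) {z : ℂ} (hz : z ≠ 0) :
    comp2 l (dx (coordA ptInf_notMem v le_rfl) z) = deriv (vA v l) z :=
  dual_dx (sec_holAt _ (pt_mem_U01 hz)) (comp2 l)

lemma comp3_dx_coordB (j : Fin 3) {z : ℂ} (hz : z ≠ 0) :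
    comp3 (dx (coordB ptInf_notMem v le_rfl j) z) = deriv (vB v j) z :=
  dual_dx (sec_holAt _ (pt_mem_U01 hz)) comp3

lemma comp3_coordB (j : Fin 3) (z : ℂ) :
    comp3 (coordB ptInf_notMem v le_rfl j z) = vB v j z := rfl

lemma comp2_oddDer_coordA (c : Fin 3 → Gr 3) (l : Fin 3) {z : ℂ} (hz : z ≠ 0) :
    comp2 l (oddDer c (coordA ptInf_notMem v le_rfl z)) =
      ∑ i, vA v i z * comp2 l (oddDer c (om i)) := by
  rw [coordA_eq v hz, oddDer_sum_smul, map_sum]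
  simp only [map_smul, smul_eq_mul]

lemma comp3_oddDer_coordB (c : Fin 3 → Gr 3) (j : Fin 3) {z : ℂ} (hz : z ≠ 0) :
    comp3 (oddDer c (coordB ptInf_notMem v le_rfl j z)) = vB v j z * comp3 (oddDer c xi123) := by
  rw [coordB_eq v j hz, oddDer_smul, map_smul, smul_eq_mul]

lemma comp3_coordA_mul_xi (j : Fin 3) {z : ℂ} (hz : z ≠ 0) :
    comp3 (coordA ptInf_notMem v le_rfl z * xi j) = epsSign j * vA v j z := by
  rw [coordA_eq v hz, Finset.sum_mul]
  simp only [smul_mul_assoc, om_mul_xi]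
  rw [Finset.sum_eq_single j (fun l _ hl => by rw [if_neg hl, smul_zero]) (by simp), if_pos rfl,
    map_smul, map_smul, comp3_xi123, smul_eq_mul, smul_eq_mul]
  ring

lemma vA_e (l : Fin 3) {z : ℂ} (hz : z ≠ 0) : vA (adv (eField k) v) l z =
    deriv (vA v l) z + ![vA v 1 z, vA v 2 z, 0] l := by
  have h0 := oddDer_algebraMap (fun j => coordB ptInf_notMem v le_rfl j z) 1
  rw [map_one] at h0
  rw [vA, adv, eField, coordA_bracket _ even_two _ _ (pt_mem_U01 hz), coordField_eq, coordField_eq,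
    dx_const, h0, mul_zero, add_zero, sub_zero, map_add, one_mul, comp2_dx_coordA v l hz,
    comp2_oddDer_coordA v _ l hz]
  simp only [Fin.sum_univ_three, oddDer_eOdd_om]
  fin_cases l <;> simp [comp2_om]

lemma vB_e (j : Fin 3) {z : ℂ} (hz : z ≠ 0) : vB (adv (eField k) v) j z =
    deriv (vB v j) z - ![vB v 1 z, vB v 2 z, 0] j := by
  rw [vB, adv, eField, coordB_bracket _ even_two _ _ _ (pt_mem_U01 hz), coordField_eq,
    coordField_eq, dx_const, mul_zero, zero_add, map_sub, map_add, one_mul, comp3_dx_coordB v j hz,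
    comp3_oddDer_coordB v _ j hz, oddDer_eOdd_xi123, map_zero, mul_zero, add_zero]
  congr 1
  fin_cases j
  · simp [eOdd_zero, oddDer_xi, comp3_coordB]
  · simp [eOdd_one, oddDer_xi, comp3_coordB]
  · simp [eOdd_two, oddDer]

lemma oddDer_fCoef (z : ℂ) (u : Gr 3) :
    oddDer (fun j => (-(k * z) : ℂ) • xi j + fOdd j) u =
      (-z) • oddDer (eulerCoef (kkk k)) u + oddDer fOdd u := by
  rw [← oddDer_coef_smul, ← oddDer_coef_add]
  congr 1
  funext j
  rw [eulerCoef, smul_smul]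
  congr 2
  ring

/-- In the factor 2 - 2k, the summand 2 comes from v applied to -x² and the summand -2k from the
Euler part of f'' acting on a product of two odd generators. -/
lemma vA_f (l : Fin 3) {z : ℂ} (hz : z ≠ 0) : vA (adv (fField k) v) l z =
    -(z ^ 2 * deriv (vA v l) z) + (2 - 2 * k) * (z * vA v l z) +
      ![0, 2 * vA v 0 z, 2 * vA v 1 z] l := by
  have h0 := oddDer_algebraMap (fun j => coordB ptInf_notMem v le_rfl j z) 1
  rw [map_one] at h0
  have hd : deriv (fun x : ℂ => -x ^ 2) z = -(2 * z) := by simp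
  rw [vA, adv, fField, coordA_bracket _ even_two _ _ (pt_mem_U01 hz), coordField_eq,
    coordField_scal _ _ (by fun_prop), h0, smul_zero, add_zero, hd, mul_one, map_sub, map_add,
    smul_mul_assoc, one_mul, map_smul, comp2_dx_coordA v l hz, oddDer_fCoef, map_add, map_smul,
    comp2_oddDer_coordA v _ l hz, comp2_oddDer_coordA v _ l hz, map_smul]
  simp only [Fin.sum_univ_three, oddDer_fOdd_om, oddDer_euler_om, smul_eq_mul]
  change _ - _ * vA v l z = _
  fin_cases l <;> simp [comp2_om] <;> ring

/-- The factor -2k is -3k, from the Euler part acting on the product of all generators, plus k from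
v applied to the coefficient -kxξ_j. Applying v to the factor x in that coefficient also gives the
term with the even component. -/
lemma vB_f (j : Fin 3) {z : ℂ} (hz : z ≠ 0) : vB (adv (fField k) v) j z =
    -(z ^ 2 * deriv (vB v j) z) - 2 * k * (z * vB v j z) + k * epsSign j * vA v j z -
      ![0, 2 * vB v 0 z, 2 * vB v 1 z] j := by
  have hd : deriv (fun x : ℂ => -(k * x)) z = -k := by simp
  have hh : HolAt (fun x : ℂ => (-(k * x)) • xi j) z :=
    HolAt.smul (by fun_prop) (HolAt.const _ _)
  have hf : comp3 (oddDer (fun j => coordB ptInf_notMem v le_rfl j z) (fOdd j)) =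
      ![0, 2 * vB v 0 z, 2 * vB v 1 z] j := by
    fin_cases j
    · simp [fOdd_zero, oddDer]
    · simp [fOdd_one, oddDer_smul, oddDer_xi, comp3_coordB]
    · simp [fOdd_two, oddDer_smul, oddDer_xi, comp3_coordB]
  rw [vB, adv, fField, coordB_bracket _ even_two _ _ _ (pt_mem_U01 hz), coordField_eq,
    coordField_add _ _ hh (HolAt.const _ _),
    coordField_scal _ _ (by fun_prop), coordField_eq, dx_const, mul_zero, zero_add, hd, map_sub,
    map_add, map_add, map_add, hf,
    smul_mul_assoc, one_mul, map_smul, comp3_dx_coordB v j hz, oddDer_fCoef, map_add, map_smul,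
    comp3_oddDer_coordB v _ j hz, comp3_oddDer_coordB v _ j hz, oddDer_euler_xi123,
    oddDer_fOdd_xi123, map_smul, map_smul, comp3_coordA_mul_xi v j hz, oddDer_xi, map_smul,
    comp3_coordB, comp3_xi123]
  simp only [smul_eq_mul, map_zero]
  ring

lemma laurentCoef_vec3 (n : ℤ) (f g h : ℂ → ℂ) (l : Fin 3) :
    laurentCoef n (fun z => ![f z, g z, h z] l) =
      ![laurentCoef n f, laurentCoef n g, laurentCoef n h] l := by
  fin_cases l <;> rfl

lemma laurentCoef_fun_zero (n : ℤ) : laurentCoef n (fun _ => 0) = 0 := by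
  have := laurentCoef_const_mul n 0 (fun _ => 0)
  simpa using this

lemma HolPunct.vec3 {f g h : ℂ → ℂ} (hf : HolPunct f) (hg : HolPunct g) (hh : HolPunct h)
    (l : Fin 3) : HolPunct fun z => ![f z, g z, h z] l := by
  fin_cases l
  exacts [hf, hg, hh]

lemma holPunct_zero : HolPunct fun _ => 0 := differentiableOn_const _

lemma cA_e (l : Fin 3) (n : ℤ) : cA (adv (eField k) v) l n =
    (n + 1) * cA v l (n + 1) + ![cA v 1 n, cA v 2 n, 0] l := by
  rw [cA, laurentCoef_congr fun z hz => vA_e v l hz, laurentCoef_add _ (vA_hol v l).deriv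
    ((vA_hol v 1).vec3 (vA_hol v 2) holPunct_zero l), laurentCoef_deriv _ (vA_hol v l),
    laurentCoef_vec3, laurentCoef_fun_zero]
  rfl

lemma cB_e (j : Fin 3) (n : ℤ) : cB (adv (eField k) v) j n =
    (n + 1) * cB v j (n + 1) - ![cB v 1 n, cB v 2 n, 0] j := by
  have e : ∀ z ≠ 0, vB (adv (eField k) v) j z =
      deriv (vB v j) z + (-1) * ![vB v 1 z, vB v 2 z, 0] j := fun z hz => by
    rw [vB_e v j hz]; ring
  have h3 := (vB_hol v 1).vec3 (vB_hol v 2) holPunct_zero j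
  rw [cB, laurentCoef_congr e, laurentCoef_add _ (vB_hol v j).deriv (h3.const_mul' _),
    laurentCoef_deriv _ (vB_hol v j), laurentCoef_const_mul, laurentCoef_vec3, laurentCoef_fun_zero]
  simp only [cB]
  ring

lemma cA_f (l : Fin 3) (n : ℤ) : cA (adv (fField k) v) l n =
    (3 - n - 2 * k) * cA v l (n - 1) + ![0, 2 * cA v 0 n, 2 * cA v 1 n] l := by
  have e : ∀ z ≠ 0, vA (adv (fField k) v) l z =
      ((-1) * (z ^ (2 : ℤ) * deriv (vA v l) z) + (2 - 2 * k) * (z ^ (1 : ℤ) * vA v l z)) +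
      ![0, 2 * vA v 0 z, 2 * vA v 1 z] l := fun z hz => by
    rw [vA_f v l hz, zpow_one, zpow_ofNat]; ring
  have h1 := ((vA_hol v l).deriv.zpow_mul 2).const_mul' (-1)
  have h2 := ((vA_hol v l).zpow_mul 1).const_mul' (2 - 2 * k)
  have h3 := holPunct_zero.vec3 ((vA_hol v 0).const_mul' 2) ((vA_hol v 1).const_mul' 2) l
  rw [cA, laurentCoef_congr e, laurentCoef_add _ (h1.add' h2) h3, laurentCoef_add _ h1 h2,
    laurentCoef_const_mul, laurentCoef_const_mul, laurentCoef_zpow_mul, laurentCoef_zpow_mul,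
    laurentCoef_deriv _ (vA_hol v l), laurentCoef_vec3, laurentCoef_fun_zero, laurentCoef_const_mul,
    laurentCoef_const_mul]
  simp only [cA]
  rw [show n - 2 + 1 = n - 1 by ring]
  push_cast
  ring

lemma cB_f (j : Fin 3) (n : ℤ) : cB (adv (fField k) v) j n =
    (1 - n - 2 * k) * cB v j (n - 1) + k * epsSign j * cA v j n -
      ![0, 2 * cB v 0 n, 2 * cB v 1 n] j := by
  have e : ∀ z ≠ 0, vB (adv (fField k) v) j z =
      (((-1) * (z ^ (2 : ℤ) * deriv (vB v j) z) + (-2 * k) * (z ^ (1 : ℤ) * vB v j z)) +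
      k * epsSign j * vA v j z) +
      (-1) * ![0, 2 * vB v 0 z, 2 * vB v 1 z] j := fun z hz => by
    rw [vB_f v j hz, zpow_one, zpow_ofNat]; ring
  have h1 := ((vB_hol v j).deriv.zpow_mul 2).const_mul' (-1)
  have h2 := ((vB_hol v j).zpow_mul 1).const_mul' (-2 * k)
  have h3 := holPunct_zero.vec3 ((vB_hol v 0).const_mul' 2) ((vB_hol v 1).const_mul' 2) j
  have h4 := (vA_hol v j).const_mul' (k * epsSign j)
  rw [cB, laurentCoef_congr e, laurentCoef_add _ ((h1.add' h2).add' h4) (h3.const_mul' (-1)),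
    laurentCoef_add _ (h1.add' h2) h4, laurentCoef_add _ h1 h2,
    laurentCoef_const_mul, laurentCoef_const_mul, laurentCoef_const_mul, laurentCoef_const_mul,
    laurentCoef_zpow_mul, laurentCoef_zpow_mul,
    laurentCoef_deriv _ (vB_hol v j), laurentCoef_vec3, laurentCoef_fun_zero, laurentCoef_const_mul,
    laurentCoef_const_mul]
  simp only [cB, cA]
  rw [show n - 2 + 1 = n - 1 by ring]
  push_cast
  ring

end

end

section

/-! ## The invariants of `s''` in the first cohomology -/

variable {k : ℤ}

lemma bracket_mem_B1 {κ : Fin m → ℤ} (w : Vect κ 0 ⊤) {v : Vect κ 2 U01} (hv : v ∈ B1 κ) :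
    bracket (vectRes κ 0 le_top w) v ∈ B1 κ := by
  obtain ⟨D, E, rfl⟩ := mem_B1_iff.mp hv
  rw [map_add]
  exact mem_B1_iff.mpr ⟨bracket (vectRes κ 0 le_top w) D, bracket (vectRes κ 0 le_top w) E, rfl⟩

lemma mk_mem_invariants_iff {κ : Fin m → ℤ} {a : Submodule ℂ (Vect κ 0 ⊤)} {v : Vect κ 2 U01} :
    (Submodule.Quotient.mk v : H1 κ) ∈ H1.invariants a ↔
      ∀ w ∈ a, bracket (vectRes κ 0 le_top w) v ∈ B1 κ :=
  forall₂_congr fun _ _ => Submodule.Quotient.mk_eq_zero _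

/-- The Jacobi identity; it turns invariance under e'' and f'' into invariance under h''. -/
lemma adv_bracket (w w' : Vect (kkk k) 0 ⊤) (v : Vect (kkk k) 2 U01) :
    adv (bracket w w') v = adv w (adv w' v) - adv w' (adv w v) := by
  apply Subtype.ext
  refine OpFam.ext fun W f => ?_
  let T : {W : Opens CP1 // W ≤ ⊤} := ⟨W.1, le_top⟩
  change (w.1 T (w'.1 T (v.1 W f)) - w'.1 T (w.1 T (v.1 W f))) -
    v.1 W (w.1 T (w'.1 T f) - w'.1 T (w.1 T f)) =
    (w.1 T (w'.1 T (v.1 W f) - v.1 W (w'.1 T f)) - (w'.1 T (v.1 W (w.1 T f)) - v.1 W (w'.1 T (w.1 T f)))) -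
    (w'.1 T (w.1 T (v.1 W f) - v.1 W (w.1 T f)) - (w.1 T (v.1 W (w'.1 T f)) - v.1 W (w.1 T (w'.1 T f))))
  simp only [map_sub]
  abel

/-- The invariance under `s''` amounts to the invariance under its generators. -/
lemma mem_invariants_sPP_iff {v : Vect (kkk k) 2 U01} :
    (Submodule.Quotient.mk v : H1 (kkk k)) ∈ H1.invariants (sPP k) ↔
      adv (eField k) v ∈ B1 (kkk k) ∧ adv (fField k) v ∈ B1 (kkk k) := by
  rw [mk_mem_invariants_iff]
  constructor
  · intro h
    exact ⟨h _ (Submodule.subset_span (by simp)), h _ (Submodule.subset_span (by simp))⟩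
  · rintro ⟨he, hf⟩ w hw
    change adv w v ∈ _
    induction hw using Submodule.span_induction with
    | mem w hw =>
      rcases hw with rfl | rfl | rfl
      · exact he
      · exact hf
      · rw [adv_bracket]
        exact Submodule.sub_mem _ (bracket_mem_B1 _ hf) (bracket_mem_B1 _ he)
    | zero =>
      have : adv (0 : Vect (kkk k) 0 ⊤) v = 0 := by
        apply Subtype.ext
        refine OpFam.ext fun W f => ?_
        change 0 - v.1 W 0 = 0
        rw [map_zero, sub_zero]
      rw [this]
      exact Submodule.zero_mem _
    | add x y _ _ hx hy =>
      have : adv (x + y) v = adv x v + adv y v := by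
        apply Subtype.ext
        refine OpFam.ext fun W f => ?_
        change (x.1 ⟨W.1, le_top⟩ (v.1 W f) + y.1 ⟨W.1, le_top⟩ (v.1 W f)) - v.1 W (x.1 ⟨W.1, le_top⟩ f + y.1 ⟨W.1, le_top⟩ f) =
          (x.1 ⟨W.1, le_top⟩ (v.1 W f) - v.1 W (x.1 ⟨W.1, le_top⟩ f)) + (y.1 ⟨W.1, le_top⟩ (v.1 W f) - v.1 W (y.1 ⟨W.1, le_top⟩ f))
        rw [map_add]
        abel
      rw [this]
      exact Submodule.add_mem _ hx hy
    | smul c x _ hx =>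
      have : adv (c • x) v = c • adv x v := by
        apply Subtype.ext
        refine OpFam.ext fun W f => ?_
        change c • x.1 ⟨W.1, le_top⟩ (v.1 W f) - v.1 W (c • x.1 ⟨W.1, le_top⟩ f) = c • (x.1 ⟨W.1, le_top⟩ (v.1 W f) - v.1 W (x.1 ⟨W.1, le_top⟩ f))
        rw [map_smul, smul_sub]
      rw [this]
      exact Submodule.smul_mem _ _ hx

/-! ### Weights of h'' and the linear equations for invariant classes. -/

/-- The vector field `h'' = [e'', f'']` acts diagonally on the Laurent coefficients. -/
lemma cA_h (v : Vect (kkk k) 2 U01) (l : Fin 3) (n : ℤ) :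
    cA (adv (bracket (eField k) (fField k)) v) l n =
      (2 - 2 * n - 2 * k + ![2, 0, -2] l) * cA v l n := by
  have hs : adv (bracket (eField k) (fField k)) v =
      adv (eField k) (adv (fField k) v) + -(1 : ℂ) • adv (fField k) (adv (eField k) v) := by
    rw [adv_bracket, neg_one_smul, sub_eq_add_neg]
  rw [hs, cA_sub_smul]
  fin_cases l <;> simp [cA_e, cA_f] <;> ring

lemma cB_h (v : Vect (kkk k) 2 U01) (j : Fin 3) (n : ℤ) :
    cB (adv (bracket (eField k) (fField k)) v) j n =
      (-2 * n - 2 * k + ![2, 0, -2] j) * cB v j n := by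
  have hs : adv (bracket (eField k) (fField k)) v =
      adv (eField k) (adv (fField k) v) + -(1 : ℂ) • adv (fField k) (adv (eField k) v) := by
    rw [adv_bracket, neg_one_smul, sub_eq_add_neg]
  rw [hs, cB_sub_smul]
  fin_cases j <;> simp [cB_e, cB_f, cA_e, epsSign] <;> ring

/-- The equations satisfied by the Laurent coefficients of an invariant class. -/
structure InvariantCoef (k : ℤ) (a b : Fin 3 → ℤ → ℂ) : Prop where
  a_e : ∀ l n, 2 - 2 * k < n → n < 0 → (n + 1) * a l (n + 1) + ![a 1 n, a 2 n, 0] l = 0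
  b_e : ∀ j n, 1 - 2 * k < n → n < 0 → (n + 1) * b j (n + 1) - ![b 1 n, b 2 n, 0] j = 0
  ab_e : ∀ j, (2 - 2 * k) * b j (2 - 2 * k) - ![b 1 (1 - 2 * k), b 2 (1 - 2 * k), 0] j =
    k * epsSign j * ((3 - 2 * k) * a j (3 - 2 * k) + ![a 1 (2 - 2 * k), a 2 (2 - 2 * k), 0] j)
  a_h : ∀ l n, 2 - 2 * k < n → n < 0 → 2 - 2 * n - 2 * k + ![2, 0, -2] l ≠ 0 → a l n = 0
  b_h : ∀ j n, 1 - 2 * k < n → n < 0 → -2 * n - 2 * k + ![2, 0, -2] j ≠ 0 → b j n = 0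
  ab_h : ∀ j, 2 * k - 2 + ![2, 0, -2] j ≠ 0 →
    b j (1 - 2 * k) = k * epsSign j * a j (2 - 2 * k)

lemma cast_vec3 (l : Fin 3) : ((![2, 0, -2] l : ℤ) : ℂ) = ![2, 0, -2] l := by
  fin_cases l <;> simp

/-- The coboundary criterion is applied to the images of v under e'' and under h''. The generator
f'' enters only through h'', which suffices for bounding the invariants. -/
theorem invariantCoef (hk : 2 ≤ k) {v : Vect (kkk k) 2 U01}
    (he : adv (eField k) v ∈ B1 (kkk k)) (hf : adv (fField k) v ∈ B1 (kkk k)) :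
    InvariantCoef k (cA v) (cB v) := by
  have hh : adv (bracket (eField k) (fField k)) v ∈ B1 (kkk k) := by
    rw [adv_bracket]
    exact Submodule.sub_mem _ (bracket_mem_B1 _ hf) (bracket_mem_B1 _ he)
  obtain ⟨e1, e2, e3⟩ := (mem_B1_iff_coef hk _).mp he
  obtain ⟨h1, h2, h3⟩ := (mem_B1_iff_coef hk _).mp hh
  refine ⟨fun l n a b => ?_, fun j n a b => ?_, fun j => ?_, fun l n a b c => ?_,
    fun j n a b c => ?_, fun j c => ?_⟩
  · rw [← cA_e]; exact e1 l n a b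
  · rw [← cB_e]; exact e2 j n a b
  · have := e3 j
    rw [cA_e, cB_e, show 1 - 2 * k + 1 = 2 - 2 * k by ring,
      show 2 - 2 * k + 1 = 3 - 2 * k by ring] at this
    push_cast at this
    linear_combination this
  · have := h1 l n a b
    rw [cA_h, ← cast_vec3] at this
    refine (mul_eq_zero.mp this).resolve_left ?_
    exact_mod_cast c
  · have := h2 j n a b
    rw [cB_h, ← cast_vec3] at this
    refine (mul_eq_zero.mp this).resolve_left ?_
    exact_mod_cast c
  · have := h3 j
    rw [cB_h, cA_h, ← cast_vec3] at this
    have c' : ((2 * k - 2 + ![2, 0, -2] j : ℤ) : ℂ) ≠ 0 := by exact_mod_cast c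
    push_cast at this c'
    refine mul_left_cancel₀ c' ?_
    linear_combination this

/-- For `k ≥ 4` there are no nonzero invariant classes. -/
theorem mem_B1_of_four_le (hk : 4 ≤ k) {v : Vect (kkk k) 2 U01}
    (he : adv (eField k) v ∈ B1 (kkk k)) (hf : adv (fField k) v ∈ B1 (kkk k)) : v ∈ B1 (kkk k) := by
  have h := invariantCoef (by lia) he hf
  have hk0 : ∀ n : ℤ, n ≠ 0 → ((n : ℤ) : ℂ) ≠ 0 := fun n hn => by exact_mod_cast hn
  have a2 : cA v 2 (-k) = 0 := by
    -- The end of the a-chain: degree -k-1 exceeds 2-2k exactly because k ≥ 4. Going up the chain,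
    -- each equation then has a nonzero integer factor in front of the next coefficient.
    have := h.a_e 2 (-k - 1) (by lia) (by lia)
    simp only [sub_add_cancel, Matrix.cons_val] at this
    refine (mul_eq_zero.mp (this.symm.trans (add_zero _)).symm).resolve_left ?_
    have := hk0 (-k) (by lia)
    push_cast at this ⊢
    simpa using this
  have a1 : cA v 1 (1 - k) = 0 := by
    have := h.a_e 1 (-k) (by lia) (by lia)
    simp only [Matrix.cons_val, a2, add_zero, show -k + 1 = 1 - k by ring] at this
    refine (mul_eq_zero.mp this).resolve_left ?_
    have := hk0 (-k + 1) (by lia)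
    push_cast at this ⊢
    exact this
  have a0 : cA v 0 (2 - k) = 0 := by
    have := h.a_e 0 (1 - k) (by lia) (by lia)
    simp only [Matrix.cons_val, a1, add_zero, show 1 - k + 1 = 2 - k by ring] at this
    refine (mul_eq_zero.mp this).resolve_left ?_
    have := hk0 (1 - k + 1) (by lia)
    push_cast at this ⊢
    exact this
  have b2 : cB v 2 (-k - 1) = 0 := by
    -- The end of the b-chain: degree -k-2 exceeds 1-2k, again because k ≥ 4.
    have := h.b_e 2 (-k - 2) (by lia) (by lia)
    simp only [Matrix.cons_val, sub_zero, show -k - 2 + 1 = -k - 1 by ring] at this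
    refine (mul_eq_zero.mp this).resolve_left ?_
    have := hk0 (-k - 2 + 1) (by lia)
    push_cast at this ⊢
    exact this
  have b1 : cB v 1 (-k) = 0 := by
    have := h.b_e 1 (-k - 1) (by lia) (by lia)
    simp only [Matrix.cons_val, b2, sub_zero, sub_add_cancel] at this
    refine (mul_eq_zero.mp this).resolve_left ?_
    have := hk0 (-k - 1 + 1) (by lia)
    push_cast at this ⊢
    exact this
  have b0 : cB v 0 (1 - k) = 0 := by
    have := h.b_e 0 (-k) (by lia) (by lia)
    simp only [Matrix.cons_val, b1, sub_zero, show -k + 1 = 1 - k by ring] at this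
    refine (mul_eq_zero.mp this).resolve_left ?_
    have := hk0 (-k + 1) (by lia)
    push_cast at this ⊢
    exact this
  refine (mem_B1_iff_coef (by lia) v).mpr ⟨fun l n h1 h2 => ?_, fun j n h1 h2 => ?_, fun j => ?_⟩
  · by_cases hn : 2 - 2 * n - 2 * k + ![2, 0, -2] l = 0
    · fin_cases l
      · obtain rfl : n = 2 - k := by simp at hn; lia
        exact a0
      · obtain rfl : n = 1 - k := by simp at hn; lia
        exact a1
      · obtain rfl : n = -k := by simp at hn; lia
        exact a2
    · exact h.a_h l n h1 h2 hn
  · by_cases hn : -2 * n - 2 * k + ![2, 0, -2] j = 0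
    · fin_cases j
      · obtain rfl : n = 1 - k := by simp at hn; lia
        exact b0
      · obtain rfl : n = -k := by simp at hn; lia
        exact b1
      · obtain rfl : n = -k - 1 := by simp at hn; lia
        exact b2
    · exact h.b_h j n h1 h2 hn
  -- The weights at the boundary are 2k, 2k-2 and 2k-4, all nonzero here; the last one vanishes for
  -- k = 2, which is where the class of part 1 comes from.
  · refine h.ab_h j ?_
    fin_cases j <;> simp <;> lia

/-! ### The two cocycles -/

lemma fin3_cases (j : Fin 3) : j = 0 ∨ j = 1 ∨ j = 2 := by
  fin_cases j <;> simp

@[simp] lemma vec3_two {α : Type} (a b c : α) : ![a, b, c] 2 = c := rfl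

lemma vA_cocycle1 (l : Fin 3) {z : ℂ} (hz : z ≠ 0) : vA cocycle1 l z = 0 := by
  rw [vA, cocycle1, coordA_ofCoords _ _ _ (pt_mem_U01 hz), map_zero]

lemma vB_cocycle1 (j : Fin 3) {z : ℂ} (hz : z ≠ 0) : vB cocycle1 j z =
    ![1 / 2 * z ^ (-1 : ℤ), -1 / 2 * z ^ (-2 : ℤ), 1 * z ^ (-3 : ℤ)] j := by
  rw [vB, cocycle1, coordB_ofCoords _ _ _ _ (pt_mem_U01 hz)]
  rcases fin3_cases j with rfl | rfl | rfl <;> simp [comp3_xi123]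

lemma vA_cocycle2 (l : Fin 3) {z : ℂ} (hz : z ≠ 0) : vA cocycle2 l z =
    ![1 / 2 * z ^ (-1 : ℤ), 1 / 2 * z ^ (-2 : ℤ), 1 * z ^ (-3 : ℤ)] l := by
  rw [vA, cocycle2, coordA_ofCoords _ _ _ (pt_mem_U01 hz), map_add, map_add, map_smul, map_smul,
    map_smul]
  change _ * comp2 l (om 2) + _ * comp2 l (om 1) + _ * comp2 l (om 0) = _
  rcases fin3_cases l with rfl | rfl | rfl <;> simp [comp2_om]

lemma vB_cocycle2 (j : Fin 3) {z : ℂ} (hz : z ≠ 0) : vB cocycle2 j z =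
    ![3 / 8 * z ^ (-2 : ℤ), -3 / 4 * z ^ (-3 : ℤ), 9 / 4 * z ^ (-4 : ℤ)] j := by
  rw [vB, cocycle2, coordB_ofCoords _ _ _ _ (pt_mem_U01 hz)]
  rcases fin3_cases j with rfl | rfl | rfl <;> simp [comp3_xi123]

lemma cA_cocycle1 (l : Fin 3) (n : ℤ) : cA cocycle1 l n = 0 := by
  rw [cA, laurentCoef_congr fun z hz => vA_cocycle1 l hz, laurentCoef_fun_zero]

lemma cB_cocycle1 (j : Fin 3) (n : ℤ) : cB cocycle1 j n =
    ![if n = -1 then 1 / 2 else 0, if n = -2 then -1 / 2 else 0, if n = -3 then 1 else 0] j := by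
  rw [cB, laurentCoef_congr fun z hz => vB_cocycle1 j hz, laurentCoef_vec3, laurentCoef_zpow,
    laurentCoef_zpow, laurentCoef_zpow]

lemma cA_cocycle2 (l : Fin 3) (n : ℤ) : cA cocycle2 l n =
    ![if n = -1 then 1 / 2 else 0, if n = -2 then 1 / 2 else 0, if n = -3 then 1 else 0] l := by
  rw [cA, laurentCoef_congr fun z hz => vA_cocycle2 l hz, laurentCoef_vec3, laurentCoef_zpow,
    laurentCoef_zpow, laurentCoef_zpow]

lemma cB_cocycle2 (j : Fin 3) (n : ℤ) : cB cocycle2 j n =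
    ![if n = -2 then 3 / 8 else 0, if n = -3 then -3 / 4 else 0, if n = -4 then 9 / 4 else 0] j := by
  rw [cB, laurentCoef_congr fun z hz => vB_cocycle2 j hz, laurentCoef_vec3, laurentCoef_zpow,
    laurentCoef_zpow, laurentCoef_zpow]

/-- For k = 2 the criterion involves only degree -1 for the even components, degrees -1 and -2 for
the odd ones, and the boundary relations, so this is a finite check. -/
theorem cocycle1_invariant :
    (Submodule.Quotient.mk cocycle1 : H1 (kkk 2)) ∈ H1.invariants (sPP 2) := by
  refine mem_invariants_sPP_iff.mpr ⟨(mem_B1_iff_coef le_rfl _).mpr ⟨fun l n h1 h2 => ?_,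
    fun j n h1 h2 => ?_, fun j => ?_⟩, (mem_B1_iff_coef le_rfl _).mpr ⟨fun l n h1 h2 => ?_,
    fun j n h1 h2 => ?_, fun j => ?_⟩⟩
  · rcases fin3_cases l with rfl | rfl | rfl <;> simp [cA_e, cA_cocycle1]
  · norm_num at h1
    obtain rfl | rfl : n = -1 ∨ n = -2 := by lia
    all_goals rcases fin3_cases j with rfl | rfl | rfl <;> norm_num [cB_e, cB_cocycle1]
  · rcases fin3_cases j with rfl | rfl | rfl <;> norm_num [cB_e, cA_e, cB_cocycle1, cA_cocycle1]
  · rcases fin3_cases l with rfl | rfl | rfl <;> simp [cA_f, cA_cocycle1]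
  · norm_num at h1
    obtain rfl | rfl : n = -1 ∨ n = -2 := by lia
    all_goals rcases fin3_cases j with rfl | rfl | rfl <;> norm_num [cB_f, cB_cocycle1, cA_cocycle1]
  · rcases fin3_cases j with rfl | rfl | rfl <;> norm_num [cB_f, cA_f, cB_cocycle1, cA_cocycle1]

theorem cocycle2_invariant :
    (Submodule.Quotient.mk cocycle2 : H1 (kkk 3)) ∈ H1.invariants (sPP 3) := by
  refine mem_invariants_sPP_iff.mpr ⟨(mem_B1_iff_coef (by norm_num) _).mpr ⟨fun l n h1 h2 => ?_,
    fun j n h1 h2 => ?_, fun j => ?_⟩, (mem_B1_iff_coef (by norm_num) _).mpr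
    ⟨fun l n h1 h2 => ?_, fun j n h1 h2 => ?_, fun j => ?_⟩⟩
  · norm_num at h1
    obtain rfl | rfl | rfl : n = -1 ∨ n = -2 ∨ n = -3 := by lia
    all_goals rcases fin3_cases l with rfl | rfl | rfl <;> norm_num [cA_e, cA_cocycle2]
  · norm_num at h1
    obtain rfl | rfl | rfl | rfl : n = -1 ∨ n = -2 ∨ n = -3 ∨ n = -4 := by lia
    all_goals rcases fin3_cases j with rfl | rfl | rfl <;> norm_num [cB_e, cB_cocycle2]
  · rcases fin3_cases j with rfl | rfl | rfl <;> norm_num [cB_e, cA_e, cB_cocycle2, cA_cocycle2, epsSign]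
  · norm_num at h1
    obtain rfl | rfl | rfl : n = -1 ∨ n = -2 ∨ n = -3 := by lia
    all_goals rcases fin3_cases l with rfl | rfl | rfl <;> norm_num [cA_f, cA_cocycle2]
  · norm_num at h1
    obtain rfl | rfl | rfl | rfl : n = -1 ∨ n = -2 ∨ n = -3 ∨ n = -4 := by lia
    all_goals rcases fin3_cases j with rfl | rfl | rfl <;> norm_num [cB_f, cB_cocycle2, cA_cocycle2, epsSign]
  · rcases fin3_cases j with rfl | rfl | rfl <;> norm_num [cB_f, cA_f, cB_cocycle2, cA_cocycle2, epsSign]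

/-- The boundary relation for j = 2 fails: b_2 has coefficient 1 in degree -3, while a_2 vanishes.
-/
theorem cocycle1_notMem_B1 : cocycle1 ∉ B1 (kkk 2) := fun h => by
  have := ((mem_B1_iff_coef le_rfl _).mp h).2.2 2
  norm_num [cB_cocycle1, cA_cocycle1] at this

/-- The coefficient of a_2 in degree -3 lies strictly between 2-2k = -4 and 0, and it is 1. -/
theorem cocycle2_notMem_B1 : cocycle2 ∉ B1 (kkk 3) := fun h => by
  have := ((mem_B1_iff_coef (by norm_num) _).mp h).1 2 (-3) (by norm_num) (by norm_num)
  norm_num [cA_cocycle2] at this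

theorem exists_sub_smul_cocycle1_mem_B1 {v : Vect (kkk 2) 2 U01}
    (he : adv (eField 2) v ∈ B1 (kkk 2)) (hf : adv (fField 2) v ∈ B1 (kkk 2)) :
    ∃ c : ℂ, v + -c • cocycle1 ∈ B1 (kkk 2) := by
  have h := invariantCoef le_rfl he hf
  have ha : ∀ l, cA v l (-1) = 0 := by
    intro l
    rcases fin3_cases l with rfl | rfl | rfl
    · exact h.a_h 0 (-1) (by norm_num) (by norm_num) (by norm_num)
    -- This coefficient has weight zero, but in degree -1 the derivative term has factor n + 1 = 0,
    -- so the equation of e'' is the vanishing of a_1 itself.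
    · have := h.a_e 0 (-1) (by norm_num) (by norm_num)
      norm_num at this
      exact this
    · exact h.a_h 2 (-1) (by norm_num) (by norm_num) (by norm_num)
  have e1 := h.ab_e 1
  have e2 := h.b_e 0 (-2) (by norm_num) (by norm_num)
  have b11 := h.b_h 1 (-1) (by norm_num) (by norm_num) (by norm_num)
  have b21 := h.b_h 2 (-1) (by norm_num) (by norm_num) (by norm_num)
  have b02 := h.b_h 0 (-2) (by norm_num) (by norm_num) (by norm_num)
  have b22 := h.b_h 2 (-2) (by norm_num) (by norm_num) (by norm_num)
  have b0 := h.ab_h 0 (by norm_num)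
  have b1 := h.ab_h 1 (by norm_num)
  norm_num [epsSign, ha] at e1 e2 b0 b1
  -- The constant is the defect of the boundary relation for j = 2, the only one on which h''
  -- imposes nothing. The equations `e1` and `e2` express the remaining coefficients as -1/2 and 1/2
  -- of it.
  refine ⟨cB v 2 (-3) - 2 * cA v 2 (-2), (mem_B1_iff_coef le_rfl _).mpr ⟨fun l n h1 h2 => ?_,
    fun j n h1 h2 => ?_, fun j => ?_⟩⟩
  · obtain rfl : n = -1 := by lia
    rw [cA_sub_smul, cA_cocycle1, ha, mul_zero, sub_zero]
  · norm_num at h1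
    obtain rfl | rfl : n = -1 ∨ n = -2 := by lia
    all_goals
      rw [cB_sub_smul, cB_cocycle1]
      rcases fin3_cases j with rfl | rfl | rfl <;> norm_num [b11, b21, b02, b22]
    · linear_combination -e2 + 1 / 2 * e1
    · linear_combination -1 / 2 * e1
  · rw [cB_sub_smul, cB_cocycle1, cA_sub_smul, cA_cocycle1]
    rcases fin3_cases j with rfl | rfl | rfl <;> norm_num [epsSign, b0, b1]

theorem exists_sub_smul_cocycle2_mem_B1 {v : Vect (kkk 3) 2 U01}
    (he : adv (eField 3) v ∈ B1 (kkk 3)) (hf : adv (fField 3) v ∈ B1 (kkk 3)) :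
    ∃ c : ℂ, v + -c • cocycle2 ∈ B1 (kkk 3) := by
  have h := invariantCoef (by norm_num) he hf
  have ea1 := h.a_e 1 (-3) (by norm_num) (by norm_num)
  have ea0 := h.a_e 0 (-2) (by norm_num) (by norm_num)
  -- At k = 3 the end of the b-chain sits on the boundary: its equation relates b_2 in degree -4 to
  -- a_2 in degree -3 with ratio 9/4, so the b-chain is not independent of the a-chain.
  have eb2 := h.ab_e 2
  have eb1 := h.b_e 1 (-4) (by norm_num) (by norm_num)
  have eb0 := h.b_e 0 (-3) (by norm_num) (by norm_num)
  norm_num [epsSign] at ea1 ea0 eb2 eb1 eb0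
  -- The cocycle has coefficient 1 in this position, and the equations above make every other weight
  -- zero coefficient the corresponding multiple of it.
  refine ⟨cA v 2 (-3), (mem_B1_iff_coef (by norm_num) _).mpr ⟨fun l n h1 h2 => ?_,
    fun j n h1 h2 => ?_, fun j => ?_⟩⟩
  · rw [cA_sub_smul, cA_cocycle2]
    norm_num at h1
    by_cases hn : 2 - 2 * n - 2 * 3 + ![2, 0, -2] l = 0
    · obtain rfl | rfl | rfl : n = -1 ∨ n = -2 ∨ n = -3 := by lia
      all_goals rcases fin3_cases l with rfl | rfl | rfl <;> norm_num at hn <;> norm_num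
      · linear_combination -ea0 - 1 / 2 * ea1
      · linear_combination -1 / 2 * ea1
    · rw [h.a_h l n (by lia) h2 hn]
      obtain rfl | rfl | rfl : n = -1 ∨ n = -2 ∨ n = -3 := by lia
      all_goals rcases fin3_cases l with rfl | rfl | rfl <;> norm_num at hn <;> norm_num
  · rw [cB_sub_smul, cB_cocycle2]
    norm_num at h1
    by_cases hn : -2 * n - 2 * 3 + ![2, 0, -2] j = 0
    · obtain rfl | rfl | rfl | rfl : n = -1 ∨ n = -2 ∨ n = -3 ∨ n = -4 := by lia
      all_goals rcases fin3_cases j with rfl | rfl | rfl <;> norm_num at hn <;> norm_num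
      · linear_combination -1 / 2 * eb0 + 1 / 6 * eb1 + 1 / 24 * eb2
      · linear_combination -1 / 3 * eb1 - 1 / 12 * eb2
      · linear_combination 1 / 4 * eb2
    · rw [h.b_h j n (by lia) h2 hn]
      obtain rfl | rfl | rfl | rfl : n = -1 ∨ n = -2 ∨ n = -3 ∨ n = -4 := by lia
      all_goals rcases fin3_cases j with rfl | rfl | rfl <;> norm_num at hn <;> norm_num
  · have := h.ab_h j (by rcases fin3_cases j with rfl | rfl | rfl <;> norm_num)
    rw [cB_sub_smul, cB_cocycle2, cA_sub_smul, cA_cocycle2, this]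
    rcases fin3_cases j with rfl | rfl | rfl <;> norm_num [epsSign]

end

section

/-! ## Homogeneous components of sections -/

/-- The projection to the component of degree `n`. -/
def grProj (n : ℕ) : Gr m →ₗ[ℂ] Gr m :=
  (grDeg m n).subtype ∘ₗ DirectSum.component ℂ ℕ (fun n => grDeg m n) n ∘ₗ
    (DirectSum.decomposeLinearEquiv fun n => grDeg m n).toLinearMap

lemma grProj_mem (n : ℕ) (u : Gr m) : grProj n u ∈ grDeg m n := Subtype.mem _

lemma grProj_of_mem {n : ℕ} {u : Gr m} (hu : u ∈ grDeg m n) : grProj n u = u :=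
  DirectSum.decompose_of_mem_same _ hu

lemma grProj_of_mem_ne {n n' : ℕ} {u : Gr m} (hu : u ∈ grDeg m n) (h : n ≠ n') :
    grProj n' u = 0 :=
  DirectSum.decompose_of_mem_ne _ hu h

lemma gr_hom_ext {M : Type} [AddCommMonoid M] [Module ℂ M] {L L' : Gr m →ₗ[ℂ] M}
    (h : ∀ n, ∀ u ∈ grDeg m n, L u = L' u) : L = L' := by
  refine LinearMap.ext fun u => ?_
  induction u using DirectSum.Decomposition.inductionOn (fun n => grDeg m n) with
  | zero => rw [map_zero, map_zero]
  | homogeneous u => exact h _ _ u.2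
  | add a b ha hb => rw [map_add, map_add, ha, hb]

lemma sum_grProj (u : Gr 3) : ∑ n ∈ Finset.range 4, grProj n u = u := by
  have : (∑ n ∈ Finset.range 4, grProj n : Gr 3 →ₗ[ℂ] Gr 3) = LinearMap.id := by
    refine gr_hom_ext fun n u hu => ?_
    rw [LinearMap.sum_apply, LinearMap.id_apply]
    by_cases hn : n < 4
    · rw [Finset.sum_eq_single n (fun n' _ h => grProj_of_mem_ne hu h.symm)
        (fun h => absurd (Finset.mem_range.mpr hn) h), grProj_of_mem hu]
    · rw [grDeg_eq_bot (not_lt.mp hn), Submodule.mem_bot] at hu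
      rw [hu]
      simp
  rw [← LinearMap.sum_apply, this, LinearMap.id_apply]

lemma map_mem_grDeg (L : (Fin m → ℂ) →ₗ[ℂ] (Fin m → ℂ)) {n : ℕ} {u : Gr m} (hu : u ∈ grDeg m n) :
    ExteriorAlgebra.map L u ∈ grDeg m n := by
  induction hu using Submodule.pow_induction_on_left' with
  | algebraMap r => rw [AlgHom.commutes]; exact algebraMap_mem_grDeg r
  | add x y i hx hy ihx ihy => rw [map_add]; exact Submodule.add_mem _ ihx ihy
  | mem_mul v hv i x hx ih =>
    obtain ⟨v, rfl⟩ := hv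
    rw [map_mul, ExteriorAlgebra.map_apply_ι, Nat.succ_eq_one_add]
    exact grDeg_mul (iota_mem_grDeg _) ih

lemma trans_mem {k : Fin m → ℤ} {x : ℂ} {n : ℕ} {u : Gr m} (hu : u ∈ grDeg m n) :
    trans k x u ∈ grDeg m n := map_mem_grDeg _ hu

lemma grProj_trans (n : ℕ) (k : Fin m → ℤ) (x : ℂ) (u : Gr m) :
    grProj n (trans k x u) = trans k x (grProj n u) := by
  have : grProj n ∘ₗ (trans k x).toLinearMap = (trans k x).toLinearMap ∘ₗ grProj n := by
    refine gr_hom_ext fun n' u hu => ?_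
    simp only [LinearMap.comp_apply, AlgHom.toLinearMap_apply]
    by_cases h : n' = n
    · subst h
      rw [grProj_of_mem hu, grProj_of_mem (trans_mem hu)]
    · rw [grProj_of_mem_ne hu h, grProj_of_mem_ne (trans_mem hu) h, map_zero]
  exact LinearMap.congr_fun this u

lemma sg_of_mem {n : ℕ} {u : Gr m} (hu : u ∈ grDeg m n) : sg u = (-1 : ℂ) ^ n • u := by
  induction hu using Submodule.pow_induction_on_left' with
  | algebraMap r => rw [AlgHom.commutes, pow_zero, one_smul]
  | add x y i hx hy ihx ihy => rw [map_add, ihx, ihy, smul_add]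
  | mem_mul v hv i x hx ih =>
    obtain ⟨v, rfl⟩ := hv
    have e : sg (ExteriorAlgebra.ι ℂ v * x) = -ExteriorAlgebra.ι ℂ v * sg x := by
      rw [map_mul, sg_iota]
    rw [e, ih, pow_succ', mul_smul_comm, neg_mul, neg_one_mul, neg_smul, smul_neg]

lemma grDeg_le_grPar (n : ℕ) : grDeg m n ≤ grPar m n :=
  le_iSup (fun j : {j : ℕ // (j : ZMod 2) = n} =>
    LinearMap.range (CliffordAlgebra.ι (0 : QuadraticForm ℂ (Fin m → ℂ))) ^ (j : ℕ)) ⟨n, rfl⟩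

lemma zmod_two_cases (i : ZMod 2) : i = 0 ∨ i = 1 := by
  revert i; decide

lemma grProj_sg (n : ℕ) (u : Gr m) : grProj n (sg u) = (-1 : ℂ) ^ n • grProj n u := by
  have : grProj n ∘ₗ sg.toLinearMap = (-1 : ℂ) ^ n • (grProj n : Gr m →ₗ[ℂ] Gr m) := by
    refine gr_hom_ext fun n' u hu => ?_
    rw [LinearMap.comp_apply, AlgHom.toLinearMap_apply, sg_of_mem hu, map_smul, LinearMap.smul_apply]
    by_cases h : n' = n
    · rw [h]
    · rw [grProj_of_mem_ne hu h, smul_zero, smul_zero]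
  exact LinearMap.congr_fun this u

/-- The parity automorphism acts on degree n by (-1)^n and on u by the opposite sign, so the
component equals its own negative. -/
lemma grProj_of_mem_par {i : ZMod 2} {u : Gr m} (hu : u ∈ grPar m i) {n : ℕ} (h : (n : ZMod 2) ≠ i) :
    grProj n u = 0 := by
  have h2 := grProj_sg n u
  have h3 : ∀ x : Gr m, x = -x → x = 0 := fun x hx => by
    have : (2 : ℂ) • x = 0 := by rw [two_smul]; nth_rw 2 [hx]; exact add_neg_cancel x
    exact (smul_eq_zero.mp this).resolve_left two_ne_zero
  rcases zmod_two_cases i with rfl | rfl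
  · have hs : sg u = u := CliffordAlgebra.involute_eq_of_mem_even hu
    have hn : Odd n := by
      rw [← ZMod.natCast_ne_zero_iff_odd]; exact h
    rw [hs, hn.neg_one_pow, neg_one_smul] at h2
    exact h3 _ h2
  · have hs : sg u = -u := CliffordAlgebra.involute_eq_of_mem_odd hu
    have hn : Even n := by
      by_contra hn
      exact h (ZMod.natCast_eq_one_iff_odd.mpr (Nat.not_even_iff_odd.mp hn))
    rw [hs, hn.neg_one_pow, one_smul, map_neg] at h2
    exact h3 _ h2.symm

lemma mem_fil_iff {p : ℕ} {u : Gr 3} :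
    u ∈ (⨆ q : {q : ℕ // p ≤ q}, grDeg 3 q.1) ↔ ∀ n < p, grProj n u = 0 := by
  constructor
  · intro hu n hn
    have : (⨆ q : {q : ℕ // p ≤ q}, grDeg 3 q.1) ≤ LinearMap.ker (grProj n) :=
      iSup_le fun q u hu => grProj_of_mem_ne hu (by have := q.2; lia)
    exact this hu
  · intro h
    rw [← sum_grProj u]
    refine Submodule.sum_mem _ fun n _ => ?_
    by_cases hn : n < p
    · rw [h n hn]; exact Submodule.zero_mem _
    · exact le_iSup (fun q : {q : ℕ // p ≤ q} => grDeg 3 q.1) ⟨n, not_lt.mp hn⟩ (grProj_mem n u)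

section
variable {k : Fin 3 → ℤ} {W : Opens CP1}

/-- The component of degree `n` of a section. -/
def secProj (n : ℕ) (f : Sec k W) : Sec k W :=
  ⟨_, isSection_linear f.2 (grProj n) fun x u => grProj_trans n k x u⟩

lemma secProj_mem (n : ℕ) (f : Sec k W) : secProj n f ∈ secDeg k W n := fun z => grProj_mem n (f.1 z)

lemma sum_secProj (f : Sec k W) : ∑ n ∈ Finset.range 4, secProj n f = f := by
  apply Subtype.ext; funext z
  rw [AddSubmonoidClass.coe_finsetSum, Finset.sum_apply]
  exact sum_grProj (f.1 z)

/-- A property of sections which is additive holds if it holds for homogeneous sections. -/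
lemma sec_induction {P : Sec k W → Prop} (hadd : ∀ f g, P f → P g → P (f + g)) (h0 : P 0)
    (h : ∀ n, ∀ f ∈ secDeg k W n, P f) (f : Sec k W) : P f := by
  rw [← sum_secProj f]
  exact Finset.sum_induction _ P hadd h0 fun n _ => h n _ (secProj_mem n f)

lemma secDeg_eq_zero {n : ℕ} (hn : 4 ≤ n) {f : Sec k W} (hf : f ∈ secDeg k W n) : f = 0 := by
  apply Subtype.ext; funext z
  have := hf z
  rw [grDeg_eq_bot hn, Submodule.mem_bot] at this
  exact this

lemma secDeg_le_secPar (n : ℕ) : secDeg k W n ≤ secPar k W n := fun _ hf z => grDeg_le_grPar n (hf z)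

lemma secProj_of_mem_par {i : ZMod 2} {f : Sec k W} (hf : f ∈ secPar k W i) {n : ℕ}
    (h : (n : ZMod 2) ≠ i) : secProj n f = 0 := by
  apply Subtype.ext; funext z
  exact grProj_of_mem_par (hf z) h

lemma mem_secFil_iff {p : ℕ} {f : Sec k W} : f ∈ secFil k W p ↔ ∀ n < p, secProj n f = 0 := by
  constructor
  · intro h n hn
    apply Subtype.ext; funext z
    exact mem_fil_iff.mp (h z) n hn
  · intro h z
    exact mem_fil_iff.mpr fun n hn => congrFun (congrArg Subtype.val (h n hn)) z

lemma secDeg_le_secFil {n p : ℕ} (h : p ≤ n) : secDeg k W n ≤ secFil k W p := fun _ hf z =>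
  le_iSup (fun q : {q : ℕ // p ≤ q} => grDeg 3 q.1) ⟨n, h⟩ (hf z)

/-- An additive property holds on `secPar` if it holds for homogeneous sections. -/
lemma par_induction {i : ZMod 2} {P : Sec k W → Prop} (hadd : ∀ f g, P f → P g → P (f + g))
    (h0 : P 0) (h : ∀ n : ℕ, (n : ZMod 2) = i → ∀ f ∈ secDeg k W n, P f) {f : Sec k W}
    (hf : f ∈ secPar k W i) : P f := by
  rw [← sum_secProj f]
  refine Finset.sum_induction _ P hadd h0 fun n _ => ?_
  by_cases hn : (n : ZMod 2) = i
  · exact h n hn _ (secProj_mem n f)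
  · rw [secProj_of_mem_par hf hn]; exact h0

lemma fil_induction {p : ℕ} {P : Sec k W → Prop} (hadd : ∀ f g, P f → P g → P (f + g))
    (h0 : P 0) (h : ∀ n : ℕ, p ≤ n → ∀ f ∈ secDeg k W n, P f) {f : Sec k W}
    (hf : f ∈ secFil k W p) : P f := by
  rw [← sum_secProj f]
  refine Finset.sum_induction _ P hadd h0 fun n _ => ?_
  by_cases hn : p ≤ n
  · exact h n hn _ (secProj_mem n f)
  · rw [mem_secFil_iff.mp hf n (not_le.mp hn)]; exact h0

lemma secDeg_mul {a b : ℕ} {f g : Sec k W} (hf : f ∈ secDeg k W a) (hg : g ∈ secDeg k W b) :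
    f * g ∈ secDeg k W (a + b) := fun z => grDeg_mul (hf z) (hg z)

variable {V V' : Opens CP1}

/-- Two fields of degree 2 raise the degree by 4. Hence id + v has inverse id - v, and such
automorphisms compose by adding the fields. -/
lemma vect_vect (D : Vect k 2 V) (E : Vect k 2 V') (h : W ≤ V) (h' : W ≤ V') (f : Sec k W) :
    D.1 ⟨W, h⟩ (E.1 ⟨W, h'⟩ f) = 0 := by
  induction f using sec_induction with
  | hadd f g hf hg => rw [map_add, map_add, hf, hg, add_zero]
  | h0 => rw [map_zero, map_zero]
  | h n f hf => exact secDeg_eq_zero (n := n + 2 + 2) (by lia) (D.2.2.2 _ _ _ (E.2.2.2 ⟨W, h'⟩ _ _ hf))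

/-- The product has degree at least 4; this is the quadratic term that would obstruct the
multiplicativity of id + v. -/
lemma vect_mul_vect (D : Vect k 2 V) (E : Vect k 2 V') (h : W ≤ V) (h' : W ≤ V') (f g : Sec k W) :
    D.1 ⟨W, h⟩ f * E.1 ⟨W, h'⟩ g = 0 := by
  induction f using sec_induction with
  | hadd f g hf hg => rw [map_add, add_mul, hf, hg, add_zero]
  | h0 => rw [map_zero, zero_mul]
  | h n f hf =>
    induction g using sec_induction with
    | hadd f g hf hg => rw [map_add, mul_add, hf, hg, add_zero]
    | h0 => rw [map_zero, mul_zero]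
    | h n' g hg =>
      exact secDeg_eq_zero (n := n + 2 + (n' + 2)) (by lia) (secDeg_mul (D.2.2.2 _ _ _ hf) (E.2.2.2 ⟨W, h'⟩ _ _ hg))

lemma vect_par (D : Vect k 2 V) (h : W ≤ V) {i : ZMod 2} {f : Sec k W} (hf : f ∈ secPar k W i) :
    D.1 ⟨W, h⟩ f ∈ secPar k W i := by
  refine par_induction (P := fun f => D.1 ⟨W, h⟩ f ∈ secPar k W i) (fun f g hf hg => ?_) ?_ (fun n hn f hf => ?_) hf
  · rw [map_add]; exact Submodule.add_mem _ hf hg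
  · rw [map_zero]; exact Submodule.zero_mem _
  · have := secDeg_le_secPar _ (D.2.2.2 ⟨W, h⟩ n f hf)
    rwa [show ((n + 2 : ℕ) : ZMod 2) = i by rw [← hn]; push_cast; rw [show (2 : ZMod 2) = 0 from rfl,
      add_zero]] at this

lemma vect_fil (D : Vect k 2 V) (h : W ≤ V) {p : ℕ} {f : Sec k W} (hf : f ∈ secFil k W p) :
    D.1 ⟨W, h⟩ f ∈ secFil k W (p + 1) := by
  refine fil_induction (P := fun f => D.1 ⟨W, h⟩ f ∈ secFil k W (p + 1)) (fun f g hf hg => ?_) ?_ (fun n hn f hf => ?_) hf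
  · rw [map_add]; exact Submodule.add_mem _ hf hg
  · rw [map_zero]; exact Submodule.zero_mem _
  · exact secDeg_le_secFil (by lia) (D.2.2.2 ⟨W, h⟩ n f hf)

end

end

section

/-! ## Isomorphisms of sheaves of superalgebras -/

namespace SuperSheaf
variable {F G H : SuperSheaf}

lemma res_res {U V W : Opens CP1} (h : V ≤ U) (h' : W ≤ V) (s : F.Obj U) :
    F.res h' (F.res h s) = F.res (h'.trans h) s := by
  change ((F.sheaf.obj.map (homOfLE h).op) ≫ (F.sheaf.obj.map (homOfLE h').op)).hom s = _
  rw [← F.sheaf.obj.map_comp]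
  rfl

lemma existsUnique_glue {ι : Type} {V : ι → Opens CP1} {W : Opens CP1} (hV : ∀ i, V i ≤ W)
    (hW : W ≤ iSup V) (s : ∀ i, F.Obj (V i))
    (hs : ∀ i j, F.res (inf_le_left : V i ⊓ V j ≤ V i) (s i) =
      F.res (inf_le_right : V i ⊓ V j ≤ V j) (s j)) :
    ∃! t : F.Obj W, ∀ i, F.res (hV i) t = s i :=
  F.sheaf.existsUnique_gluing' V W (fun i => homOfLE (hV i)) hW s hs

lemma eq_of_res_eq {ι : Type} {V : ι → Opens CP1} {W : Opens CP1} (hV : ∀ i, V i ≤ W)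
    (hW : W ≤ iSup V) {s t : F.Obj W} (h : ∀ i, F.res (hV i) s = F.res (hV i) t) : s = t :=
  F.sheaf.eq_of_locally_eq' V W (fun i => homOfLE (hV i)) hW s t h

lemma le_iSup_inf (W : Opens CP1) : W ≤ ⨆ i : Bool, W ⊓ cond i U0 U1 := by
  intro p hp
  rw [Opens.mem_iSup]
  by_cases h : p = ptInf
  · exact ⟨false, hp, by rw [h]; exact ptInf_mem_U1⟩
  · exact ⟨true, hp, h⟩

lemma eq_of_res_eq₂ {W : Opens CP1} {s t : F.Obj W}
    (h0 : F.res (inf_le_left : W ⊓ U0 ≤ W) s = F.res (inf_le_left : W ⊓ U0 ≤ W) t)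
    (h1 : F.res (inf_le_left : W ⊓ U1 ≤ W) s = F.res (inf_le_left : W ⊓ U1 ≤ W) t) : s = t :=
  eq_of_res_eq (V := fun i : Bool => W ⊓ cond i U0 U1) (fun _ => inf_le_left) (le_iSup_inf W)
    (by rintro (_ | _); exacts [h1, h0])

lemma exists_glue₂ {W : Opens CP1} (s0 : F.Obj (W ⊓ U0)) (s1 : F.Obj (W ⊓ U1))
    (h : ∀ (W' : Opens CP1) (h0 : W' ≤ W ⊓ U0) (h1 : W' ≤ W ⊓ U1), F.res h0 s0 = F.res h1 s1) :
    ∃ t : F.Obj W, F.res inf_le_left t = s0 ∧ F.res inf_le_left t = s1 := by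
  obtain ⟨t, ht, -⟩ := existsUnique_glue (F := F) (V := fun i : Bool => W ⊓ cond i U0 U1)
    (fun _ => inf_le_left) (le_iSup_inf W) (fun i => match i with | true => s0 | false => s1) (by
      rintro (_ | _) (_ | _)
      · rfl
      · exact (h _ inf_le_right inf_le_left).symm
      · exact h _ inf_le_left inf_le_right
      · rfl)
  exact ⟨t, ht true, ht false⟩

lemma par_isCompl (F : SuperSheaf) (U : Opens CP1) (i : ZMod 2) :
    IsCompl (F.par U i) (F.par U (i + 1)) :=
  (F.isInternal U).isCompl (by revert i; decide) (by
    ext j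
    simp only [Set.mem_univ, Set.mem_insert_iff, Set.mem_singleton_iff, true_iff]
    revert i j; decide)

/-- The component of the wrong parity has an image of both parities, hence zero. This shows that the
inverse of a parity preserving isomorphism preserves parity. -/
lemma mem_par_of_injective {U V : Opens CP1} {i : ZMod 2} (L : F.Obj U →ₗ[ℂ] G.Obj V)
    (hL : Function.Injective L) (hp : ∀ i, ∀ s ∈ F.par U i, L s ∈ G.par V i) {s : F.Obj U}
    (hs : L s ∈ G.par V i) : s ∈ F.par U i := by
  obtain ⟨a, ha, b, hb, rfl⟩ := Submodule.mem_sup.mp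
    ((F.par_isCompl U i).sup_eq_top ▸ Submodule.mem_top (x := s))
  have h1 : L b ∈ G.par V i := by
    have := Submodule.sub_mem _ hs (hp i a ha)
    rwa [map_add, add_sub_cancel_left] at this
  have h2 := Submodule.disjoint_def.mp (G.par_isCompl V i).disjoint _ h1 (hp _ b hb)
  rw [hL (h2.trans (map_zero L).symm), add_zero]
  exact ha

/-- Parity is a local property: the component of the wrong parity restricts to zero on both charts.
-/
lemma mem_par_of_res {W : Opens CP1} {i : ZMod 2} {s : F.Obj W}
    (h0 : F.res (inf_le_left : W ⊓ U0 ≤ W) s ∈ F.par _ i)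
    (h1 : F.res (inf_le_left : W ⊓ U1 ≤ W) s ∈ F.par _ i) : s ∈ F.par W i := by
  obtain ⟨a, ha, b, hb, rfl⟩ := Submodule.mem_sup.mp
    ((F.par_isCompl W i).sup_eq_top ▸ Submodule.mem_top (x := s))
  have key : ∀ (V : Opens CP1) (h : V ≤ W), F.res h (a + b) ∈ F.par V i → F.res h b = 0 := by
    intro V h hs
    have h1 : F.res h b ∈ F.par V i := by
      have := Submodule.sub_mem _ hs (F.map_par h i a ha)
      rwa [map_add, add_sub_cancel_left] at this
    exact Submodule.disjoint_def.mp (F.par_isCompl V i).disjoint _ h1 (F.map_par h _ b hb)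
  have hb0 : b = 0 := eq_of_res_eq₂ (by rw [key _ _ h0, map_zero]) (by rw [key _ _ h1, map_zero])
  rw [hb0, add_zero]
  exact ha

namespace IsoOn

/-- The inverse isomorphism. -/
def symm {U : Opens CP1} (φ : F.IsoOn U G) : G.IsoOn U F where
  equiv W h := (φ.equiv W h).symm
  natural W W' hW h s := by
    apply (φ.equiv W' (h.trans hW)).injective
    rw [AlgEquiv.apply_symm_apply, ← φ.natural W W' hW h, AlgEquiv.apply_symm_apply]
  map_par W hW i s hs := by
    refine mem_par_of_injective (φ.equiv W hW).toLinearMap (φ.equiv W hW).injective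
      (φ.map_par W hW) ?_
    rw [AlgEquiv.toLinearMap_apply, AlgEquiv.apply_symm_apply]
    exact hs

/-- The composition of isomorphisms. -/
def trans {U V T : Opens CP1} (φ : F.IsoOn U G) (ψ : G.IsoOn V H) (hU : T ≤ U) (hV : T ≤ V) :
    F.IsoOn T H where
  equiv W h := (φ.equiv W (h.trans hU)).trans (ψ.equiv W (h.trans hV))
  natural W W' hW h s := by
    rw [AlgEquiv.trans_apply, AlgEquiv.trans_apply, ψ.natural, φ.natural]
  map_par W hW i s hs := ψ.map_par _ _ _ _ (φ.map_par _ _ _ _ hs)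

/-- Isomorphisms over `U0` and `U1` that agree over `U01` glue. -/
theorem exists_glue (φ : F.IsoOn U0 G) (ψ : F.IsoOn U1 G)
    (h : ∀ (W : Opens CP1) (h0 : W ≤ U0) (h1 : W ≤ U1) (s : F.Obj W),
      φ.equiv W h0 s = ψ.equiv W h1 s) : Nonempty (F.IsoOn ⊤ G) := by
  -- The image of s over W is glued from its images over the two parts of W in the charts.
  have ex : ∀ (W : Opens CP1) (s : F.Obj W), ∃ t : G.Obj W,
      G.res inf_le_left t = φ.equiv (W ⊓ U0) inf_le_right (F.res inf_le_left s) ∧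
      G.res inf_le_left t = ψ.equiv (W ⊓ U1) inf_le_right (F.res inf_le_left s) := by
    intro W s
    refine exists_glue₂ _ _ fun W' h0 h1 => ?_
    rw [φ.natural, ψ.natural, res_res, res_res]
    exact h _ _ _ _
  choose t ht0 ht1 using ex
  -- Uniqueness of the gluing yields all algebraic identities and the naturality, since each can be
  -- checked on the two parts.
  have uniq : ∀ (W : Opens CP1) (s : F.Obj W) (u : G.Obj W),
      G.res inf_le_left u = φ.equiv (W ⊓ U0) inf_le_right (F.res inf_le_left s) →
      G.res inf_le_left u = ψ.equiv (W ⊓ U1) inf_le_right (F.res inf_le_left s) → t W s = u :=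
    fun W s u h0 h1 => eq_of_res_eq₂ ((ht0 W s).trans h0.symm) ((ht1 W s).trans h1.symm)
  let τ : ∀ W : Opens CP1, F.Obj W →ₐ[ℂ] G.Obj W := fun W =>
    { toFun := t W
      map_one' := uniq _ _ _ (by simp only [map_one]) (by simp only [map_one])
      map_mul' := fun a b => uniq _ _ _ (by simp only [map_mul, ht0]) (by simp only [map_mul, ht1])
      map_zero' := uniq _ _ _ (by simp only [map_zero]) (by simp only [map_zero])
      map_add' := fun a b => uniq _ _ _ (by simp only [map_add, ht0]) (by simp only [map_add, ht1])
      commutes' := fun r => uniq _ _ _ (by simp only [AlgHom.commutes, AlgEquiv.commutes])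
        (by simp only [AlgHom.commutes, AlgEquiv.commutes]) }
  have hτ : ∀ W s, τ W s = t W s := fun _ _ => rfl
  have hinj : ∀ W, Function.Injective (τ W) := by
    intro W a b hab
    rw [hτ, hτ] at hab
    refine eq_of_res_eq₂ ?_ ?_
    · apply (φ.equiv (W ⊓ U0) inf_le_right).injective
      rw [← ht0, ← ht0, hab]
    · apply (ψ.equiv (W ⊓ U1) inf_le_right).injective
      rw [← ht1, ← ht1, hab]
  have hsurj : ∀ W, Function.Surjective (τ W) := by
    intro W u
    obtain ⟨s, hs0, hs1⟩ := exists_glue₂ (F := F)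
      (φ.symm.equiv (W ⊓ U0) inf_le_right (G.res inf_le_left u))
      (ψ.symm.equiv (W ⊓ U1) inf_le_right (G.res inf_le_left u)) (by
        intro W' h0 h1
        rw [φ.symm.natural, ψ.symm.natural, res_res, res_res]
        apply (φ.equiv W' (h0.trans inf_le_right)).injective
        rw [h W' _ (h1.trans inf_le_right) ((ψ.symm.equiv W' _) _)]
        exact (AlgEquiv.apply_symm_apply _ _).trans (AlgEquiv.apply_symm_apply _ _).symm)
    refine ⟨s, uniq _ _ _ ?_ ?_⟩
    · rw [hs0]; exact (AlgEquiv.apply_symm_apply _ _).symm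
    · rw [hs1]; exact (AlgEquiv.apply_symm_apply _ _).symm
  have ht0' : ∀ (W V : Opens CP1) (s : F.Obj W) (h : V ≤ W) (h0 : V ≤ U0),
      G.res h (t W s) = φ.equiv V h0 (F.res h s) := fun W V s h h0 => by
    rw [← res_res (inf_le_left : W ⊓ U0 ≤ W) (le_inf h h0), ht0, φ.natural, res_res]
  have ht1' : ∀ (W V : Opens CP1) (s : F.Obj W) (h : V ≤ W) (h1 : V ≤ U1),
      G.res h (t W s) = ψ.equiv V h1 (F.res h s) := fun W V s h h1 => by
    rw [← res_res (inf_le_left : W ⊓ U1 ≤ W) (le_inf h h1), ht1, ψ.natural, res_res]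
  refine ⟨⟨fun W _ => AlgEquiv.ofBijective (τ W) ⟨hinj W, hsurj W⟩, fun W W' _ h' s => ?_,
    fun W _ i s hs => ?_⟩⟩
  · refine Eq.symm (uniq W' (F.res h' s) (G.res h' (t W s)) ?_ ?_)
    · rw [res_res, res_res, ht0']
    · rw [res_res, res_res, ht1']
  · refine mem_par_of_res (s := t W s) ?_ ?_
    · rw [ht0]; exact φ.map_par _ _ _ _ (F.map_par _ _ _ hs)
    · rw [ht1]; exact ψ.map_par _ _ _ _ (F.map_par _ _ _ hs)

end IsoOn

end SuperSheaf

end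

section

/-! ## Isomorphisms between split supermanifolds -/

/-- The automorphism of the Grassmann algebra that multiplies the odd generators by `t`. -/
def grScale (t : ℂ) : Gr m →ₐ[ℂ] Gr m := ExteriorAlgebra.map (t • LinearMap.id)

lemma grScale_of_mem (t : ℂ) {n : ℕ} {u : Gr m} (hu : u ∈ grDeg m n) :
    grScale t u = t ^ n • u := by
  induction hu using Submodule.pow_induction_on_left' with
  | algebraMap r => rw [AlgHom.commutes, pow_zero, one_smul]
  | add x y i hx hy ihx ihy => rw [map_add, ihx, ihy, smul_add]
  | mem_mul v hv i x hx ih =>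
    obtain ⟨v, rfl⟩ := hv
    have e : grScale t (ExteriorAlgebra.ι ℂ v : Gr m) = t • ExteriorAlgebra.ι ℂ v := by
      rw [grScale, ExteriorAlgebra.map_apply_ι, ← map_smul]
      rfl
    rw [map_mul, ih, e, smul_mul_smul_comm, pow_succ']

lemma grScale_trans (t : ℂ) (k : Fin m → ℤ) (x : ℂ) (u : Gr m) :
    grScale t (trans k x u) = trans k x (grScale t u) := by
  have : (grScale t).toLinearMap ∘ₗ (trans k x).toLinearMap =
      (trans k x).toLinearMap ∘ₗ (grScale t).toLinearMap := by
    refine gr_hom_ext fun n u hu => ?_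
    simp only [LinearMap.comp_apply, AlgHom.toLinearMap_apply]
    rw [grScale_of_mem t hu, grScale_of_mem t (trans_mem hu), map_smul]
  exact LinearMap.congr_fun this u

lemma trans_trans_add (a b : Fin m → ℤ) {x : ℂ} (hx : x ≠ 0) (u : Gr m) :
    trans a x (trans b x u) = trans (a + b) x u := by
  induction u using ExteriorAlgebra.induction with
  | algebraMap r => simp only [AlgHom.commutes]
  | ι v =>
    rw [trans_iota, trans_iota, trans_iota]
    congr 1
    funext i
    rw [← mul_assoc, ← zpow_add₀ hx, Pi.add_apply, neg_add]
  | mul a b ha hb => simp only [map_mul, ha, hb]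
  | add a b ha hb => simp only [map_add, ha, hb]

lemma trans_zero (x : ℂ) (u : Gr m) : trans 0 x u = u := by
  have : trans (0 : Fin m → ℤ) x = AlgHom.id ℂ (Gr m) := by
    rw [trans, ← ExteriorAlgebra.map_id]
    congr 1
    ext i
    simp
  rw [this]
  rfl

lemma HolAt.trans (k : Fin m → ℤ) {z : ℂ} (hz : z ≠ 0) {g : ℂ → Gr m} (hg : HolAt g z) :
    HolAt (fun w => trans k w (g w)) z := by
  have e : ∀ w, CP1Super.trans k w (g w) =
      ∑ s, coef s (g w) • CP1Super.trans k w (grBasis m s) := fun w => by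
    conv_lhs => rw [← sum_coef (g w)]
    simp only [map_sum, map_smul]
  simp only [e]
  exact HolAt.sum fun s _ => HolAt.smul (hg s) (trans_hol_dx k hz (grBasis m s)).1

/-- Over an open set in the first chart, the sections of all split supermanifolds agree. -/
def secCast (k k' : Fin m → ℤ) {W : Opens CP1} (hW : ptInf ∉ W) : Sec k W →ₐ[ℂ] Sec k' W where
  toFun f := ⟨f.1, f.2.1, fun h => absurd h hW⟩
  map_one' := rfl
  map_mul' _ _ := rfl
  map_zero' := rfl
  map_add' _ _ := rfl
  commutes' _ := rfl

lemma secCast_secCast (k k' : Fin m → ℤ) {W : Opens CP1} (hW : ptInf ∉ W) (f : Sec k W) :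
    secCast k' k hW (secCast k k' hW f) = f := by
  apply Subtype.ext; funext z; rfl

/-- Over an open set in the second chart, the sections of all split supermanifolds agree, if they
are written in the coordinates of this chart. -/
def secTwist (k k' : Fin m → ℤ) {W : Opens CP1} (hW : pt 0 ∉ W) : Sec k W →ₐ[ℂ] Sec k' W where
  toFun f := ⟨fun z => trans (k' - k) z (f.1 z), by
    have e : ∀ z, zext (fun z : Fin0 W => trans (k' - k) z (f.1 z)) z =
        trans (k' - k) z (zext f.1 z) := by
      intro z
      by_cases h : pt z ∈ W <;> simp [zext, h]
    refine ⟨fun z hz => ?_, fun h => ?_⟩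
    · refine (HolAt.trans (k' - k) ?_ (f.2.1 z hz)).congr (Eventually.of_forall fun w => (e w).symm)
      rintro rfl
      exact hW hz
    · obtain ⟨g, hg, hg'⟩ := f.2.2 h
      refine ⟨g, hg, ?_⟩
      filter_upwards [hg', self_mem_nhdsWithin] with y hy hy0
      rw [e, hy, trans_trans_add _ _ (inv_ne_zero hy0), sub_add_cancel]⟩
  map_one' := by apply Subtype.ext; funext z; exact map_one _
  map_mul' _ _ := by apply Subtype.ext; funext z; exact map_mul _ _ _
  map_zero' := by apply Subtype.ext; funext z; exact map_zero _
  map_add' _ _ := by apply Subtype.ext; funext z; exact map_add _ _ _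
  commutes' _ := by apply Subtype.ext; funext z; exact AlgHom.commutes _ _

lemma secTwist_secTwist (k k' : Fin m → ℤ) {W : Opens CP1} (hW : pt 0 ∉ W) (f : Sec k W) :
    secTwist k' k hW (secTwist k k' hW f) = f := by
  apply Subtype.ext; funext z
  change trans (k - k') z (trans (k' - k) z (f.1 z)) = f.1 z
  rw [trans_trans_add, sub_add_sub_cancel', sub_self, trans_zero]
  intro h
  exact hW (h ▸ z.2)

/-- The automorphism of the sections that multiplies the odd coordinates by `t`. -/
def secScale (t : ℂ) {k : Fin m → ℤ} {W : Opens CP1} : Sec k W →ₐ[ℂ] Sec k W where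
  toFun f := ⟨fun z => grScale t (f.1 z),
    isSection_linear f.2 (grScale t).toLinearMap fun x u => grScale_trans t k x u⟩
  map_one' := by apply Subtype.ext; funext z; exact map_one _
  map_mul' _ _ := by apply Subtype.ext; funext z; exact map_mul _ _ _
  map_zero' := by apply Subtype.ext; funext z; exact map_zero _
  map_add' _ _ := by apply Subtype.ext; funext z; exact map_add _ _ _
  commutes' _ := by apply Subtype.ext; funext z; exact AlgHom.commutes _ _

lemma secScale_of_mem (t : ℂ) {k : Fin m → ℤ} {W : Opens CP1} {n : ℕ} {f : Sec k W}
    (hf : f ∈ secDeg k W n) : secScale t f = t ^ n • f := by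
  apply Subtype.ext; funext z
  exact grScale_of_mem t (hf z)

variable {k : Fin 3 → ℤ} {W V : Opens CP1}

lemma map_par_of_map_deg {k k' : Fin 3 → ℤ} (L : Sec k W →ₐ[ℂ] Sec k' W)
    (hL : ∀ n, ∀ f ∈ secDeg k W n, L f ∈ secDeg k' W n) {i : ZMod 2} {f : Sec k W}
    (hf : f ∈ secPar k W i) : L f ∈ secPar k' W i := by
  refine par_induction (P := fun f => L f ∈ secPar k' W i) (fun f g hf hg => ?_) ?_
    (fun n hn f hf => ?_) hf
  · rw [map_add]; exact Submodule.add_mem _ hf hg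
  · rw [map_zero]; exact Submodule.zero_mem _
  · exact hn ▸ secDeg_le_secPar n (hL n f hf)

lemma secScale_mem (t : ℂ) {n : ℕ} {f : Sec k W} (hf : f ∈ secDeg k W n) :
    secScale t f ∈ secDeg k W n := by
  rw [secScale_of_mem t hf]; exact Submodule.smul_mem _ _ hf

lemma secScale_secScale {s t : ℂ} (h : s * t = 1) (f : Sec k W) :
    secScale s (secScale t f) = f := by
  induction f using sec_induction with
  | hadd f g hf hg => rw [map_add, map_add, hf, hg]
  | h0 => rw [map_zero, map_zero]
  | h n f hf =>
    rw [secScale_of_mem t hf, map_smul, secScale_of_mem s hf, smul_smul, ← mul_pow, mul_comm t,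
      h, one_pow, one_smul]

/-- On degree n the left side carries the factor t^(n+2) and the inner dilation on the right carries
t^n. -/
lemma secScale_vect (t : ℂ) (D : Vect k 2 V) (h : W ≤ V) (f : Sec k W) :
    secScale (W := W) t (D.1 ⟨W, h⟩ f) = t ^ 2 • D.1 ⟨W, h⟩ (secScale (W := W) t f) := by
  induction f using sec_induction with
  | hadd f g hf hg => simp only [map_add, hf, hg, smul_add]
  | h0 => simp only [map_zero, smul_zero]
  | h n f hf =>
    rw [secScale_of_mem t hf, secScale_of_mem t (D.2.2.2 ⟨W, h⟩ n f hf), map_smul, smul_smul,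
      add_comm, pow_add]

/-- The automorphism `id + v` of the sections. -/
def vectExp (v : Vect k 2 V) (h : W ≤ V) : Sec k W ≃ₐ[ℂ] Sec k W where
  toFun f := f + v.1 ⟨W, h⟩ f
  invFun f := f - v.1 ⟨W, h⟩ f
  left_inv f := by
    change f + v.1 ⟨W, h⟩ f - v.1 ⟨W, h⟩ (f + v.1 ⟨W, h⟩ f) = f
    rw [map_add, vect_vect, add_zero, add_sub_cancel_right]
  right_inv f := by
    change f - v.1 ⟨W, h⟩ f + v.1 ⟨W, h⟩ (f - v.1 ⟨W, h⟩ f) = f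
    rw [map_sub, vect_vect, sub_zero, sub_add_cancel]
  map_mul' f g := by
    rw [v.2.2.1, add_mul, mul_add, mul_add, vect_mul_vect]
    abel
  map_add' f g := by
    rw [map_add]
    abel
  commutes' r := by
    rw [Algebra.algebraMap_eq_smul_one, map_smul, vect_one, smul_zero, add_zero]

lemma vectExp_apply (v : Vect k 2 V) (h : W ≤ V) (f : Sec k W) :
    vectExp v h f = f + v.1 ⟨W, h⟩ f := rfl

/-- An isomorphism between split supermanifolds, given by isomorphisms of the algebras of
sections. -/
def splitIso {k k' : Fin m → ℤ} {U : Opens CP1} (e : ∀ W, W ≤ U → (Sec k W ≃ₐ[ℂ] Sec k' W))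
    (hn : ∀ (W W' : Opens CP1) (hW : W ≤ U) (h : W' ≤ W) (f : Sec k W),
      secRes k' h (e W hW f) = e W' (h.trans hW) (secRes k h f))
    (hp : ∀ (W : Opens CP1) (hW : W ≤ U) (i : ZMod 2), ∀ f ∈ secPar k W i, e W hW f ∈ secPar k' W i) :
    (split k).IsoOn U (split k') :=
  ⟨e, hn, hp⟩

/-- The isomorphism of the algebras of sections given by an isomorphism with a split
supermanifold. -/
def SuperSheaf.IsoOn.sec {k : Fin m → ℤ} {U : Opens CP1} {F : SuperSheaf}
    (φ : F.IsoOn U (split k)) {W : Opens CP1} (h : W ≤ U) : F.Obj W ≃ₐ[ℂ] Sec k W :=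
  φ.equiv W h

/-- The isomorphism of the algebras of sections given by an isomorphism between split
supermanifolds. -/
def SuperSheaf.IsoOn.onSec {k k' : Fin m → ℤ} {U : Opens CP1}
    (φ : (split k).IsoOn U (split k')) {W : Opens CP1} (h : W ≤ U) : Sec k W ≃ₐ[ℂ] Sec k' W :=
  φ.equiv W h

/-- The automorphism `id + v` of a split supermanifold. -/
def autV (v : Vect k 2 V) : (split k).IsoOn V (split k) :=
  splitIso (fun _ h => vectExp v h)
    (fun W W' hW h f => by
      rw [vectExp_apply, vectExp_apply, map_add]
      exact congrArg _ (v.2.1 ⟨W, hW⟩ ⟨W', h.trans hW⟩ h f))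
    (fun W hW i f hf => Submodule.add_mem (secPar k W i) hf (vect_par v hW hf))

/-- The automorphism of the sections that multiplies the odd coordinates by `t ≠ 0`. -/
def secScaleEquiv (k : Fin 3 → ℤ) {t : ℂ} (ht : t ≠ 0) (W : Opens CP1) : Sec k W ≃ₐ[ℂ] Sec k W :=
  AlgEquiv.ofAlgHom (secScale t) (secScale t⁻¹)
    (AlgHom.ext fun f => secScale_secScale (mul_inv_cancel₀ ht) f)
    (AlgHom.ext fun f => secScale_secScale (inv_mul_cancel₀ ht) f)

/-- The automorphism of a split supermanifold that multiplies the odd coordinates by `t`. -/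
def autScale (k : Fin 3 → ℤ) {t : ℂ} (ht : t ≠ 0) : (split k).IsoOn ⊤ (split k) :=
  splitIso (fun W _ => secScaleEquiv k ht W) (fun _ _ _ _ _ => rfl)
    (fun _ _ _ _ hs => map_par_of_map_deg (secScale t) (fun _ _ => secScale_mem t) hs)

/-- The isomorphism of sections over an open set in the first chart. -/
def secCastEquiv (k k' : Fin m → ℤ) {W : Opens CP1} (hW : ptInf ∉ W) : Sec k W ≃ₐ[ℂ] Sec k' W :=
  AlgEquiv.ofAlgHom (secCast k k' hW) (secCast k' k hW)
    (AlgHom.ext fun f => secCast_secCast k' k hW f)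
    (AlgHom.ext fun f => secCast_secCast k k' hW f)

/-- The isomorphism of sections over an open set in the second chart. -/
def secTwistEquiv (k k' : Fin m → ℤ) {W : Opens CP1} (hW : pt 0 ∉ W) : Sec k W ≃ₐ[ℂ] Sec k' W :=
  AlgEquiv.ofAlgHom (secTwist k k' hW) (secTwist k' k hW)
    (AlgHom.ext fun f => secTwist_secTwist k' k hW f)
    (AlgHom.ext fun f => secTwist_secTwist k k' hW f)

/-- The trivialization of a split supermanifold over the first chart. -/
def triv0 (k k' : Fin m → ℤ) : (split k).IsoOn U0 (split k') :=
  splitIso (fun _ h => secCastEquiv k k' (ptInf_notMem_of_le h ptInf_notMem_U0))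
    (fun _ _ _ _ _ => by apply Subtype.ext; funext z; rfl) (fun _ _ _ _ hs z => hs z)

lemma pt_zero_notMem (h : W ≤ U1) : pt 0 ∉ W := fun hz => h hz rfl

lemma secTwist_mem {k k' : Fin m → ℤ} {W : Opens CP1} (hW : pt 0 ∉ W) {n : ℕ} {f : Sec k W}
    (hf : f ∈ secDeg k W n) : secTwist k k' hW f ∈ secDeg k' W n := fun z => trans_mem (hf z)

/-- The trivialization of a split supermanifold over the second chart. -/
def triv1 (k k' : Fin 3 → ℤ) : (split k).IsoOn U1 (split k') :=
  splitIso (fun _ h => secTwistEquiv k k' (pt_zero_notMem h)) (fun _ _ _ _ _ => rfl)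
    (fun _ h _ _ hs => map_par_of_map_deg (secTwist k k' (pt_zero_notMem h))
      (fun _ _ hf => secTwist_mem _ hf) hs)

lemma transition_trans {k : Fin 3 → ℤ} {F : SuperSheaf} {U V : Opens CP1}
    (ψ : F.IsoOn ⊤ (split k)) (a : (split k).IsoOn U (split 0)) (b : (split k).IsoOn V (split 0))
    (hU : W ≤ U) (hV : W ≤ V) (f : Sec (0 : Fin 3 → ℤ) W) :
    transition (ψ.trans a le_top le_rfl) (ψ.trans b le_top le_rfl) W hU hV f =
      b.onSec hV ((a.onSec hU).symm f) := by
  change b.onSec hV (ψ.sec le_top ((ψ.sec le_top).symm ((a.onSec hU).symm f))) = _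
  rw [AlgEquiv.apply_symm_apply]

lemma triv1_mem {k k' : Fin 3 → ℤ} (h : W ≤ U1) {n : ℕ} {f : Sec k W}
    (hf : f ∈ secDeg k W n) : (triv1 k k').onSec h f ∈ secDeg k' W n :=
  secTwist_mem (pt_zero_notMem h) hf

lemma triv1_symm_mem {k k' : Fin 3 → ℤ} (h : W ≤ U1) {n : ℕ} {f : Sec k' W}
    (hf : f ∈ secDeg k' W n) : ((triv1 k k').onSec h).symm f ∈ secDeg k W n :=
  secTwist_mem (pt_zero_notMem h) hf

lemma triv0_mem {k k' : Fin 3 → ℤ} (h : W ≤ U0) {n : ℕ} {f : Sec k W}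
    (hf : f ∈ secDeg k W n) : (triv0 k k').onSec h f ∈ secDeg k' W n := fun z => hf z

lemma triv0_symm_mem {k k' : Fin 3 → ℤ} (h : W ≤ U0) {n : ℕ} {f : Sec k' W}
    (hf : f ∈ secDeg k' W n) : ((triv0 k k').onSec h).symm f ∈ secDeg k W n := fun z => hf z

/-- The standard trivializations over the two charts preserve degrees, and the given isomorphism
cancels in the transition maps. -/
theorem isSplit_of_isomorphic {F : SuperSheaf} (h : Isomorphic F (split k)) : IsSplit 3 F := by
  obtain ⟨ψ⟩ := h
  refine ⟨Bool, fun i => cond i U0 U1, fun i => match i with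
    | true => ψ.trans (triv0 k 0) le_top le_rfl
    | false => ψ.trans (triv1 k 0) le_top le_rfl, fun p => ?_, ?_⟩
  · have := SuperSheaf.le_iSup_inf ⊤ (show p ∈ (⊤ : Opens CP1) from trivial)
    obtain ⟨i, hi⟩ := Opens.mem_iSup.mp this
    exact ⟨i, hi.2⟩
  · rintro (_ | _) (_ | _) W hi hj p f hf
    · rw [transition_trans]
      exact triv1_mem hj (triv1_symm_mem hi hf)
    · rw [transition_trans]
      exact triv0_mem hj (triv1_symm_mem hi hf)
    · rw [transition_trans]
      exact triv1_mem hj (triv0_symm_mem hi hf)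
    · rw [transition_trans]
      exact triv0_mem hj (triv0_symm_mem hi hf)

/-! ### From cohomology classes to isomorphism types. -/

lemma CorrespondsTo.apply {v : Vect k 2 U01} {F : SuperSheaf} {φ₀ : F.IsoOn U0 (split k)}
    {φ₁ : F.IsoOn U1 (split k)}
    (h : ∀ (W : Opens CP1) (hW : W ≤ U01) (f : Sec k W),
      transition φ₁ φ₀ W (hW.trans inf_le_right) (hW.trans inf_le_left) f = f + v.1 ⟨W, hW⟩ f)
    (hW : W ≤ U01) (h0 : W ≤ U0) (h1 : W ≤ U1) (s : F.Obj W) :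
    φ₀.sec h0 s = φ₁.sec h1 s + v.1 ⟨W, hW⟩ (φ₁.sec h1 s) := by
  rw [← h]
  change _ = φ₀.sec h0 ((φ₁.sec h1).symm (φ₁.sec h1 s))
  rw [AlgEquiv.symm_apply_apply]

/-- Supermanifolds corresponding to classes that differ by a non-zero factor are isomorphic. -/
theorem isomorphic_of_correspondsTo {v w : Vect k 2 U01} {F G : SuperSheaf}
    (hF : CorrespondsTo w F) (hG : CorrespondsTo v G) {c : ℂ} (hc : c ≠ 0)
    (h : w + -c • v ∈ B1 k) : Isomorphic F G := by
  obtain ⟨φ₀, φ₁, hφ⟩ := hF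
  obtain ⟨ψ₀, ψ₁, hψ⟩ := hG
  obtain ⟨D, E, hDE⟩ := mem_B1_iff.mp h
  -- A dilation S by t satisfies S v = t² v S, so t² = 1/c gives S(cv) = vS.
  obtain ⟨t, ht⟩ := IsAlgClosed.exists_pow_nat_eq c⁻¹ (n := 2) two_pos
  have ht0 : t ≠ 0 := by
    rintro rfl
    rw [zero_pow two_ne_zero] at ht
    exact inv_ne_zero hc ht.symm
  -- The isomorphism is S(id - D) in the chart over `U0` and S(id + E) in the chart over `U1`.
  -- Agreement over `U01` means S(id - D)(id + w) = (id + v)S(id + E); second order terms vanish,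
  -- and the rest is w = D + E + cv.
  refine SuperSheaf.IsoOn.exists_glue
    (((φ₀.trans (autV (-D)) le_rfl le_rfl).trans (autScale k ht0) le_rfl le_top).trans ψ₀.symm
      le_rfl le_rfl)
    (((φ₁.trans (autV E) le_rfl le_rfl).trans (autScale k ht0) le_rfl le_top).trans ψ₁.symm
      le_rfl le_rfl) fun W h0 h1 s => ?_
  have hW : W ≤ U01 := le_inf h0 h1
  change (ψ₀.sec h0).symm (secScale t (vectExp (-D) h0 (φ₀.sec h0 s))) =
    (ψ₁.sec h1).symm (secScale t (vectExp E h1 (φ₁.sec h1 s)))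
  rw [AlgEquiv.symm_apply_eq, CorrespondsTo.apply hψ hW h0 h1, AlgEquiv.apply_symm_apply,
    CorrespondsTo.apply hφ hW h0 h1]
  generalize φ₁.sec h1 s = u
  have hw : w.1 ⟨W, hW⟩ u = D.1 ⟨W, h0⟩ u + E.1 ⟨W, h1⟩ u + c • v.1 ⟨W, hW⟩ u := by
    have : (w + -c • v).1 ⟨W, hW⟩ u = D.1 ⟨W, h0⟩ u + E.1 ⟨W, h1⟩ u := by rw [← hDE]; rfl
    rw [← this]
    change _ = w.1 ⟨W, hW⟩ u + -c • v.1 ⟨W, hW⟩ u + c • v.1 ⟨W, hW⟩ u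
    rw [neg_smul, neg_add_cancel_right]
  change secScale t ((u + w.1 ⟨W, hW⟩ u) + -(D.1 ⟨W, h0⟩ (u + w.1 ⟨W, hW⟩ u))) =
    secScale t (u + E.1 ⟨W, h1⟩ u) + v.1 ⟨W, hW⟩ (secScale (W := W) t (u + E.1 ⟨W, h1⟩ u))
  have e1 : v.1 ⟨W, hW⟩ (secScale (W := W) t (E.1 ⟨W, h1⟩ u)) = 0 := by
    rw [secScale_vect, map_smul, vect_vect, smul_zero]
  have e2 : c • secScale (W := W) t (v.1 ⟨W, hW⟩ u) = v.1 ⟨W, hW⟩ (secScale (W := W) t u) := by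
    rw [secScale_vect, smul_smul, ht, mul_inv_cancel₀ hc, one_smul]
  rw [map_add (D.1 ⟨W, h0⟩), vect_vect, hw]
  simp only [map_add, map_neg, map_zero, map_smul, e1, e2]
  abel

lemma split_correspondsTo_zero (k : Fin 3 → ℤ) : CorrespondsTo (0 : Vect k 2 U01) (split k) :=
  ⟨autV 0, autV 0, fun W hW f => by
    change (f - 0 : Sec k W) + 0 = f + 0
    rw [sub_zero]⟩

theorem isSplit_of_mem_B1 {v : Vect k 2 U01} {F : SuperSheaf} (hF : CorrespondsTo v F)
    (hv : v ∈ B1 k) : IsSplit 3 F :=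
  isSplit_of_isomorphic (isomorphic_of_correspondsTo hF (split_correspondsTo_zero k) one_ne_zero
    (by rwa [smul_zero, add_zero]))

end

section

/-! ## The supermanifold corresponding to a cocycle -/

section
variable {k : Fin 3 → ℤ} {V W W' : Opens CP1}

lemma secRes_vectExp (v : Vect k 2 V) (hW : W ≤ V) (h : W' ≤ W) (f : Sec k W) :
    secRes k h (vectExp v hW f) = vectExp v (h.trans hW) (secRes k h f) := by
  rw [vectExp_apply, vectExp_apply, map_add]
  exact congrArg _ (v.2.1 ⟨W, hW⟩ ⟨W', h.trans hW⟩ h f)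

lemma sec_ext {f g : Sec k W} (h : ∀ (z : ℂ) (hz : pt z ∈ W), f.1 ⟨z, hz⟩ = g.1 ⟨z, hz⟩) : f = g :=
  Subtype.ext (funext fun z => h z.1 z.2)

variable (v : Vect k 2 U01)

lemma inf_U01_le_U0 (W : Opens CP1) : W ⊓ U01 ≤ W ⊓ U0 := inf_le_inf_left W U01_le_U0

lemma inf_U01_le_U1 (W : Opens CP1) : W ⊓ U01 ≤ W ⊓ U1 := inf_le_inf_left W U01_le_U1

/-- The superfunctions on `W` of the supermanifold obtained by gluing by means of `id + v`. -/
def glueSec (W : Opens CP1) : Subalgebra ℂ (Sec k (W ⊓ U0) × Sec k (W ⊓ U1)) :=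
  AlgHom.equalizer ((secRes k (inf_U01_le_U0 W)).comp (AlgHom.fst ℂ _ _))
    ((vectExp v (inf_le_right : W ⊓ U01 ≤ U01)).toAlgHom.comp
      ((secRes k (inf_U01_le_U1 W)).comp (AlgHom.snd ℂ _ _)))

variable {v}

lemma mem_glueSec {p : Sec k (W ⊓ U0) × Sec k (W ⊓ U1)} : p ∈ glueSec v W ↔
    secRes k (inf_U01_le_U0 W) p.1 =
      vectExp v (inf_le_right : W ⊓ U01 ≤ U01) (secRes k (inf_U01_le_U1 W) p.2) := Iff.rfl

/-- The superalgebra of superfunctions on `W` of the supermanifold obtained by gluing. -/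
def GlueSec (v : Vect k 2 U01) (W : Opens CP1) : Type := glueSec v W

instance : Ring (GlueSec v W) := inferInstanceAs (Ring (glueSec v W))

instance : Algebra ℂ (GlueSec v W) := inferInstanceAs (Algebra ℂ (glueSec v W))

lemma glueSec_spec (p : GlueSec v W) (h : W' ≤ U01) (h0 : W' ≤ W ⊓ U0) (h1 : W' ≤ W ⊓ U1) :
    secRes k h0 p.1.1 = vectExp v h (secRes k h1 p.1.2) := by
  have h2 : W' ≤ W ⊓ U01 := le_inf (h0.trans inf_le_left) h
  have := congrArg (secRes k h2) (mem_glueSec.mp p.2)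
  rw [secRes_vectExp] at this
  exact this

/-- Restriction of superfunctions. -/
def glueRes (v : Vect k 2 U01) (h : W' ≤ W) : GlueSec v W →ₐ[ℂ] GlueSec v W' where
  toFun p := ⟨(secRes k (inf_le_inf_right U0 h) p.1.1, secRes k (inf_le_inf_right U1 h) p.1.2),
    mem_glueSec.mpr (glueSec_spec p inf_le_right
      ((inf_U01_le_U0 W').trans (inf_le_inf_right U0 h))
      ((inf_U01_le_U1 W').trans (inf_le_inf_right U1 h)))⟩
  map_one' := rfl
  map_mul' _ _ := rfl
  map_zero' := rfl
  map_add' _ _ := rfl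
  commutes' _ := rfl

/-- The presheaf of superalgebras `W ↦ GlueSec v W`. -/
def gluePresheaf (v : Vect k 2 U01) : TopCat.Presheaf (AlgCat.{0} ℂ) CP1 where
  obj W := AlgCat.of ℂ (GlueSec v W.unop)
  map i := AlgCat.ofHom (glueRes v i.unop.le)
  map_id _ := rfl
  map_comp _ _ := rfl

lemma exists_glue_sec {ι : Type} (U : ι → Opens CP1) (V : Opens CP1)
    (s : ∀ i, Sec k (U i ⊓ V))
    (hs : ∀ i j z (hi : pt z ∈ U i ⊓ V) (hj : pt z ∈ U j ⊓ V), (s i).1 ⟨z, hi⟩ = (s j).1 ⟨z, hj⟩) :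
    ∃ t : Sec k (iSup U ⊓ V), ∀ i, secRes k (inf_le_inf_right V (le_iSup U i)) t = s i := by
  obtain ⟨t, ht, -⟩ := SuperSheaf.existsUnique_glue (F := split k) (V := fun i => U i ⊓ V)
    (W := iSup U ⊓ V) (fun i => inf_le_inf_right V (le_iSup U i)) (iSup_inf_eq U V).le s
    (fun i j => sec_ext fun z hz => hs i j z hz.1 hz.2)
  exact ⟨t, ht⟩

lemma gluePresheaf_isSheaf (v : Vect k 2 U01) : (gluePresheaf v).IsSheaf := by
  rw [TopCat.Presheaf.isSheaf_iff_isSheafUniqueGluing]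
  intro ι U sf hsf
  let S : ∀ i, GlueSec v (U i) := sf
  have hS : ∀ i j, glueRes v (inf_le_left : U i ⊓ U j ≤ U i) (S i) =
      glueRes v (inf_le_right : U i ⊓ U j ≤ U j) (S j) := hsf
  obtain ⟨t0, ht0⟩ := exists_glue_sec U U0 (fun i => (S i).1.1) fun i j z hi hj => by
    have := congrArg (fun p => p.1.1.1) (hS i j)
    exact congrFun this ⟨z, ⟨hi.1, hj.1⟩, hi.2⟩
  obtain ⟨t1, ht1⟩ := exists_glue_sec U U1 (fun i => (S i).1.2) fun i j z hi hj => by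
    have := congrArg (fun p => p.1.2.1) (hS i j)
    exact congrFun this ⟨z, ⟨hi.1, hj.1⟩, hi.2⟩
  have ht : (t0, t1) ∈ glueSec v (iSup U) := by
    rw [mem_glueSec]
    refine sec_ext fun z hz => ?_
    obtain ⟨i, hi⟩ := Opens.mem_iSup.mp hz.1
    have h1 := glueSec_spec (S i) (W' := U i ⊓ U01) inf_le_right (inf_U01_le_U0 _)
      (inf_U01_le_U1 _)
    rw [← ht0 i, ← ht1 i] at h1
    have h2 := secRes_vectExp v (inf_le_right : iSup U ⊓ U01 ≤ U01)
      (inf_le_inf_right U01 (le_iSup U i)) (secRes k (inf_U01_le_U1 _) t1)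
    exact congrFun (congrArg Subtype.val (h1.trans h2.symm)) ⟨z, hi, hz.2⟩
  refine ⟨(⟨(t0, t1), ht⟩ : GlueSec v (iSup U)), fun i => ?_, fun s hs => ?_⟩
  · have : glueRes v (le_iSup U i) ⟨(t0, t1), ht⟩ = S i := Subtype.ext (Prod.ext (ht0 i) (ht1 i))
    exact this
  · let s' : GlueSec v (iSup U) := s
    have hs' : ∀ i, glueRes v (le_iSup U i) s' = S i := hs
    have h0 : s'.1.1 = t0 := sec_ext fun z hz => by
      obtain ⟨i, hi⟩ := Opens.mem_iSup.mp hz.1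
      have h1 : secRes k (inf_le_inf_right U0 (le_iSup U i)) s'.1.1 = (S i).1.1 :=
        congrArg (fun p => p.1.1) (hs' i)
      exact congrFun (congrArg Subtype.val (h1.trans (ht0 i).symm)) ⟨z, hi, hz.2⟩
    have h1 : s'.1.2 = t1 := sec_ext fun z hz => by
      obtain ⟨i, hi⟩ := Opens.mem_iSup.mp hz.1
      have h1 : secRes k (inf_le_inf_right U1 (le_iSup U i)) s'.1.2 = (S i).1.2 :=
        congrArg (fun p => p.1.2) (hs' i)
      exact congrFun (congrArg Subtype.val (h1.trans (ht1 i).symm)) ⟨z, hi, hz.2⟩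
    have : s' = ⟨(t0, t1), ht⟩ := Subtype.ext (Prod.ext h0 h1)
    exact this

/-- The even and the odd superfunctions. -/
def gluePar (v : Vect k 2 U01) (W : Opens CP1) (i : ZMod 2) : Submodule ℂ (GlueSec v W) where
  carrier := {p | p.1.1 ∈ secPar k _ i ∧ p.1.2 ∈ secPar k _ i}
  add_mem' hf hg := ⟨Submodule.add_mem _ hf.1 hg.1, Submodule.add_mem _ hf.2 hg.2⟩
  zero_mem' := ⟨Submodule.zero_mem _, Submodule.zero_mem _⟩
  smul_mem' c _ hf := ⟨Submodule.smul_mem _ c hf.1, Submodule.smul_mem _ c hf.2⟩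

lemma grScale_neg_one (u : Gr m) : grScale (-1) u = sg u := by
  have : (grScale (-1)).toLinearMap = (sg : Gr m →ₐ[ℂ] Gr m).toLinearMap :=
    gr_hom_ext fun n u hu => (grScale_of_mem _ hu).trans (sg_of_mem hu).symm
  exact LinearMap.congr_fun this u

lemma half_add_secScale (f : Sec k W) : (2⁻¹ : ℂ) • (f + secScale (-1) f) ∈ secPar k W 0 := fun z => by
  have := half_add_sg (f.1 z)
  rw [← grScale_neg_one] at this
  exact this

lemma half_sub_secScale (f : Sec k W) : (2⁻¹ : ℂ) • (f - secScale (-1) f) ∈ secPar k W 1 := fun z => by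
  have := half_sub_sg (f.1 z)
  rw [← grScale_neg_one] at this
  exact this

/-- The parity automorphism is the dilation by -1, which commutes with v because (-1)² = 1. Hence
the even and odd parts of a compatible pair are compatible. -/
lemma glueScale_mem {p : Sec k (W ⊓ U0) × Sec k (W ⊓ U1)} (hp : p ∈ glueSec v W) :
    (secScale (-1) p.1, secScale (-1) p.2) ∈ glueSec v W := by
  rw [mem_glueSec] at hp ⊢
  have := congrArg (secScale (W := W ⊓ U01) (-1)) hp
  rw [vectExp_apply, map_add, secScale_vect, neg_one_sq, one_smul] at this
  exact this

lemma gluePar_isInternal (v : Vect k 2 U01) (W : Opens CP1) :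
    DirectSum.IsInternal (gluePar v W) := by
  have huniv : (Set.univ : Set (ZMod 2)) = {0, 1} := by
    ext i
    simp only [Set.mem_univ, Set.mem_insert_iff, Set.mem_singleton_iff, true_iff]
    exact zmod_two_cases i
  have hc : ∀ {W'} (f : Sec k W'), f ∈ secPar k W' 0 → f ∈ secPar k W' 1 → f = 0 := fun {W'} f =>
    Submodule.disjoint_def.mp ((split k).par_isCompl W' 0).disjoint f
  refine (DirectSum.isInternal_submodule_iff_isCompl (gluePar v W) zero_ne_one huniv).mpr ⟨?_, ?_⟩
  · rw [Submodule.disjoint_def]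
    intro p h0 h1
    exact Subtype.ext (Prod.ext (hc _ h0.1 h1.1) (hc _ h0.2 h1.2))
  · rw [codisjoint_iff, Submodule.eq_top_iff']
    intro p
    let q : GlueSec v W := ⟨_, glueScale_mem p.2⟩
    refine Submodule.mem_sup.mpr ⟨(2⁻¹ : ℂ) • (p + q), ⟨half_add_secScale _, half_add_secScale _⟩,
      (2⁻¹ : ℂ) • (p - q), ⟨half_sub_secScale _, half_sub_secScale _⟩, ?_⟩
    rw [← smul_add, add_add_sub_cancel, ← two_smul ℂ p, smul_smul]
    norm_num

/-- The supermanifold obtained by gluing the restrictions of `(k₁, k₂, k₃)` to the two charts by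
means of the automorphism `id + v`. -/
def glued (v : Vect k 2 U01) : SuperSheaf where
  sheaf := ⟨gluePresheaf v, gluePresheaf_isSheaf v⟩
  par W i := gluePar v W i
  isInternal W := gluePar_isInternal v W
  gradedMonoid W :=
    { one_mem := ⟨((split k).gradedMonoid (W ⊓ U0)).one_mem, ((split k).gradedMonoid (W ⊓ U1)).one_mem⟩
      mul_mem := fun _ _ _ _ hf hg => ⟨((split k).gradedMonoid (W ⊓ U0)).mul_mem hf.1 hg.1,
        ((split k).gradedMonoid (W ⊓ U1)).mul_mem hf.2 hg.2⟩ }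
  map_par h _ _ hs := ⟨fun z => hs.1 ⟨z.1, h z.2.1, z.2.2⟩, fun z => hs.2 ⟨z.1, h z.2.1, z.2.2⟩⟩

/-- The chart of the glued supermanifold over `U0`, on superfunctions. -/
def glueEquiv0 (v : Vect k 2 U01) (h : W ≤ U0) : GlueSec v W ≃ₐ[ℂ] Sec k W where
  toFun p := secRes k (le_inf le_rfl h) p.1.1
  invFun f := ⟨(secRes k inf_le_left f,
      (vectExp v (inf_le_inf_right U1 h : W ⊓ U1 ≤ U01)).symm (secRes k inf_le_left f)), by
    have h1 : W ⊓ U01 ≤ W ⊓ U1 := inf_U01_le_U1 W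
    rw [mem_glueSec, ← secRes_vectExp v (inf_le_inf_right U1 h : W ⊓ U1 ≤ U01) h1,
      AlgEquiv.apply_symm_apply]
    rfl⟩
  left_inv p := by
    refine Subtype.ext (Prod.ext rfl ?_)
    have h2 : W ⊓ U1 ≤ U01 := inf_le_inf_right U1 h
    have h3 : W ⊓ U1 ≤ W ⊓ U0 := le_inf inf_le_left (h2.trans U01_le_U0)
    have := glueSec_spec p h2 h3 le_rfl
    exact (AlgEquiv.symm_apply_eq _).mpr this
  right_inv f := rfl
  map_mul' _ _ := rfl
  map_add' _ _ := rfl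
  commutes' _ := rfl

/-- The chart of the glued supermanifold over `U1`, on superfunctions. -/
def glueEquiv1 (v : Vect k 2 U01) (h : W ≤ U1) : GlueSec v W ≃ₐ[ℂ] Sec k W where
  toFun p := secRes k (le_inf le_rfl h) p.1.2
  invFun f := ⟨(vectExp v (le_inf inf_le_right (inf_le_left.trans h) : W ⊓ U0 ≤ U01)
      (secRes k inf_le_left f), secRes k inf_le_left f), by
    have h1 : W ⊓ U01 ≤ W ⊓ U0 := inf_U01_le_U0 W
    rw [mem_glueSec,
      secRes_vectExp v (le_inf inf_le_right (inf_le_left.trans h) : W ⊓ U0 ≤ U01) h1]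
    rfl⟩
  left_inv p := by
    refine Subtype.ext (Prod.ext ?_ rfl)
    have h2 : W ⊓ U0 ≤ U01 := le_inf inf_le_right (inf_le_left.trans h)
    have h3 : W ⊓ U0 ≤ W ⊓ U1 := le_inf inf_le_left (h2.trans U01_le_U1)
    exact (glueSec_spec p h2 le_rfl h3).symm
  right_inv f := rfl
  map_mul' _ _ := rfl
  map_add' _ _ := rfl
  commutes' _ := rfl

/-- The chart of the glued supermanifold over `U0`. -/
def glueChart0 (v : Vect k 2 U01) : (glued v).IsoOn U0 (split k) where
  equiv _ h := glueEquiv0 v h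
  natural _ _ _ _ _ := by apply Subtype.ext; funext z; rfl
  map_par _ _ _ _ hs z := hs.1 ⟨z.1, z.2, pt_mem_U0 z⟩

/-- The chart of the glued supermanifold over `U1`. -/
def glueChart1 (v : Vect k 2 U01) : (glued v).IsoOn U1 (split k) where
  equiv _ h := glueEquiv1 v h
  natural _ _ _ _ _ := by apply Subtype.ext; funext z; rfl
  map_par _ h _ _ hs z := hs.2 ⟨z.1, z.2, h z.2⟩

theorem glued_correspondsTo (v : Vect k 2 U01) : CorrespondsTo v (glued v) := by
  refine ⟨glueChart0 v, glueChart1 v, fun W hW f => ?_⟩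
  have h0 : W ≤ U0 := hW.trans U01_le_U0
  have h1 : W ≤ U1 := hW.trans U01_le_U1
  change glueEquiv0 v h0 ((glueEquiv1 v h1).symm f) = vectExp v hW f
  exact secRes_vectExp v (le_inf inf_le_right (inf_le_left.trans h1) : W ⊓ U0 ≤ U01)
    (le_inf le_rfl h0) (secRes k inf_le_left f)

theorem CorrespondsTo.isSupermanifold {F : SuperSheaf} (h : CorrespondsTo v F) :
    IsSupermanifold 3 F := by
  obtain ⟨φ₀, φ₁, -⟩ := h
  intro p
  by_cases hp : p ∈ U0
  · exact ⟨U0, hp, ⟨φ₀.trans (triv0 k 0) le_rfl le_rfl⟩⟩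
  · have : p = ptInf := not_not.mp hp
    exact ⟨U1, this ▸ ptInf_mem_U1, ⟨φ₁.trans (triv1 k 0) le_rfl le_rfl⟩⟩

/-- The transition maps of the two charts are id + v and its inverse id - v, and v raises the
filtration. -/
theorem CorrespondsTo.hasRetract {F : SuperSheaf} (h : CorrespondsTo v F) : HasRetract k F := by
  obtain ⟨φ₀, φ₁, h⟩ := h
  refine ⟨Bool, fun i => cond i U0 U1, fun i => match i with
    | true => φ₀
    | false => φ₁, fun p => ?_, ?_⟩
  · have := SuperSheaf.le_iSup_inf ⊤ (show p ∈ (⊤ : Opens CP1) from trivial)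
    obtain ⟨i, hi⟩ := Opens.mem_iSup.mp this
    exact ⟨i, hi.2⟩
  · rintro (_ | _) (_ | _) W hi hj p f hf
    · change φ₁.sec hi ((φ₁.sec hi).symm f) - f ∈ _
      rw [AlgEquiv.apply_symm_apply, sub_self]
      exact Submodule.zero_mem _
    · have hW : W ≤ U01 := le_inf hj hi
      rw [h W hW f, add_sub_cancel_left]
      exact vect_fil v hW hf
    · have hW : W ≤ U01 := le_inf hi hj
      have e : φ₁.sec hj ((φ₀.sec hi).symm f) = (vectExp v hW).symm f := by
        rw [AlgEquiv.eq_symm_apply, vectExp_apply, ← CorrespondsTo.apply h hW hi hj,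
          AlgEquiv.apply_symm_apply]
      change φ₁.sec hj ((φ₀.sec hi).symm f) - f ∈ _
      rw [e]
      change f - v.1 ⟨W, hW⟩ f - f ∈ _
      rw [sub_sub_cancel_left]
      exact Submodule.neg_mem _ (vect_fil v hW hf)
    · change φ₀.sec hi ((φ₀.sec hi).symm f) - f ∈ _
      rw [AlgEquiv.apply_symm_apply, sub_self]
      exact Submodule.zero_mem _

end

end

section

/-! ## The Euler operator -/

/-- The second clause covers n = 0, where the truncated n - 1 is again 0; the induction step from
degree 0 to degree 1 needs it. -/
lemma dxi_mem_aux {n : ℕ} {u : Gr m} (hu : u ∈ grDeg m n) (j : Fin m) :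
    dxi j u ∈ grDeg m (n - 1) ∧ (n = 0 → dxi j u = 0) := by
  induction hu using Submodule.pow_induction_on_left' with
  | algebraMap r =>
    rw [dxi_algebraMap]
    exact ⟨Submodule.zero_mem _, fun _ => rfl⟩
  | add x y i hx hy ihx ihy =>
    rw [map_add]
    exact ⟨Submodule.add_mem _ ihx.1 ihy.1, fun h => by rw [ihx.2 h, ihy.2 h, add_zero]⟩
  | mem_mul v hv i x hx ih =>
    obtain ⟨v, rfl⟩ := hv
    have e : dxi j (ExteriorAlgebra.ι ℂ v * x) = v j • x - ExteriorAlgebra.ι ℂ v * dxi j x :=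
      dxi_iota_mul j v x
    rw [e]
    refine ⟨Submodule.sub_mem _ (Submodule.smul_mem _ _ hx) ?_, fun h => absurd h i.succ_ne_zero⟩
    rcases i with _ | i
    · rw [ih.2 rfl, mul_zero]; exact Submodule.zero_mem _
    · have := grDeg_mul (iota_mem_grDeg v) ih.1
      rwa [show 1 + (i + 1 - 1) = (i + 1).succ - 1 by lia] at this

lemma dxi_mem {n : ℕ} {u : Gr m} (hu : u ∈ grDeg m (n + 1)) (j : Fin m) :
    dxi j u ∈ grDeg m n := (dxi_mem_aux hu j).1

/-- The Euler operator `∑ⱼ ξⱼ ∂/∂ξⱼ`. -/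
def grEuler : Gr m →ₗ[ℂ] Gr m := ∑ j, LinearMap.mulLeft ℂ (xi j) ∘ₗ dxi j

lemma grEuler_apply (u : Gr m) : grEuler u = oddDer xi u := by
  rw [grEuler, LinearMap.sum_apply]
  rfl

lemma grEuler_of_mem {n : ℕ} {u : Gr m} (hu : u ∈ grDeg m n) : grEuler u = (n : ℂ) • u := by
  rw [grEuler_apply]
  induction hu using Submodule.pow_induction_on_left' with
  | algebraMap r => rw [oddDer_algebraMap, Nat.cast_zero, zero_smul]
  | add x y i hx hy ihx ihy => rw [oddDer_add, ihx, ihy, smul_add]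
  | mem_mul v hv i x hx ih =>
    obtain ⟨v, rfl⟩ := hv
    have e : oddDer xi (ExteriorAlgebra.ι ℂ v : Gr m) = ExteriorAlgebra.ι ℂ v := by
      rw [oddDer_iota, iota_eq_sum]
    have e2 : oddDer xi (ExteriorAlgebra.ι ℂ v * x : Gr m) =
        ExteriorAlgebra.ι ℂ v * x + ExteriorAlgebra.ι ℂ v * ((i : ℂ) • x) := by
      rw [oddDer_mul xi_mem_grDeg, ih, e]
    refine e2.trans ?_
    rw [mul_smul_comm, Nat.cast_succ, add_smul, one_smul, add_comm]

lemma grEuler_trans (k : Fin m → ℤ) (x : ℂ) (u : Gr m) :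
    grEuler (trans k x u) = trans k x (grEuler u) := by
  rw [grEuler_apply, grEuler_apply, oddDer_trans xi_mem_grDeg (trans_xi k x)]

/-- The Euler operator on sections. -/
def secEuler {k : Fin m → ℤ} {W : Opens CP1} : Sec k W →ₗ[ℂ] Sec k W where
  toFun f := ⟨fun z => grEuler (f.1 z),
    isSection_linear f.2 grEuler fun x u => grEuler_trans k x u⟩
  map_add' _ _ := by apply Subtype.ext; funext z; exact map_add _ _ _
  map_smul' c f := by apply Subtype.ext; funext z; exact grEuler.map_smul c (f.1 z)

lemma secEuler_of_mem {k : Fin m → ℤ} {W : Opens CP1} {n : ℕ} {f : Sec k W}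
    (hf : f ∈ secDeg k W n) : secEuler f = (n : ℂ) • f := by
  apply Subtype.ext; funext z
  exact grEuler_of_mem (hf z)

lemma secEuler_mul {k : Fin m → ℤ} {W : Opens CP1} (f g : Sec k W) :
    secEuler (f * g) = secEuler f * g + f * secEuler g := by
  apply Subtype.ext; funext z
  change grEuler (f.1 z * g.1 z) = grEuler (f.1 z) * g.1 z + f.1 z * grEuler (g.1 z)
  simp only [grEuler_apply]
  exact oddDer_mul xi_mem_grDeg _ _

lemma secEuler_res {k : Fin m → ℤ} {W W' : Opens CP1} (h : W' ≤ W) (f : Sec k W) :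
    secRes k h (secEuler f) = secEuler (secRes k h f) := by
  apply Subtype.ext; funext z; rfl

section
variable {k k' : Fin 3 → ℤ} {W V : Opens CP1}

lemma secEuler_comm (L : Sec k W →ₐ[ℂ] Sec k' W)
    (hL : ∀ n, ∀ f ∈ secDeg k W n, L f ∈ secDeg k' W n) (f : Sec k W) :
    L (secEuler f) = secEuler (L f) := by
  induction f using sec_induction with
  | hadd f g hf hg => simp only [map_add, hf, hg]
  | h0 => simp only [map_zero]
  | h n f hf => rw [secEuler_of_mem hf, secEuler_of_mem (hL n f hf), map_smul]

lemma secFil_mul {a b : ℕ} {f g : Sec k W} (hf : f ∈ secFil k W a) (hg : g ∈ secFil k W b) :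
    f * g ∈ secFil k W (a + b) := by
  refine fil_induction (P := fun f => f * g ∈ secFil k W (a + b)) (fun f f' hf hf' => ?_) ?_
    (fun n hn f hf => ?_) hf
  · rw [add_mul]; exact Submodule.add_mem _ hf hf'
  · rw [zero_mul]; exact Submodule.zero_mem _
  · refine fil_induction (P := fun g => f * g ∈ secFil k W (a + b)) (fun f f' hf hf' => ?_) ?_
      (fun n' hn' g hg => ?_) hg
    · rw [mul_add]; exact Submodule.add_mem _ hf hf'
    · rw [mul_zero]; exact Submodule.zero_mem _
    · exact secDeg_le_secFil (by lia) (secDeg_mul hf hg)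

/-- A homomorphism of superalgebras of sections respects the filtration. -/
lemma map_mem_secFil_of_deg (hW : ptInf ∉ W) (L : Sec k W →ₐ[ℂ] Sec k' W)
    (hL : ∀ i, ∀ f ∈ secPar k W i, L f ∈ secPar k' W i) {n : ℕ} {f : Sec k W}
    (hf : f ∈ secDeg k W n) : L f ∈ secFil k' W n := by
  induction n generalizing f with
  | zero => exact mem_secFil_iff.mpr fun n hn => absurd hn (Nat.not_lt_zero n)
  | succ n ih =>
    let d : Fin 3 → Sec k W := fun j => holSec k hW (fun z => dxi j (zext f.1 z))
      fun z hz => (sec_holAt f hz).linear (dxi j)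
    have hd : ∀ j, d j ∈ secDeg k W n := fun j z => by
      change dxi j (zext f.1 z) ∈ _
      rw [zext_of_mem _ z.2]
      exact dxi_mem (hf z) j
    -- Euler's formula writes a section of degree n + 1 in terms of the ξ_j and sections of degree
    -- n.
    have e : ((n + 1 : ℕ) : ℂ) • f = ∑ j, constSec k hW (xi j) * d j := by
      rw [← secEuler_of_mem hf]
      apply Subtype.ext; funext z
      rw [AddSubmonoidClass.coe_finsetSum, Finset.sum_apply]
      change grEuler (f.1 z) = ∑ j, xi j * dxi j (zext f.1 z)
      rw [zext_of_mem _ z.2, grEuler_apply]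
      rfl
    -- The image of ξ_j is odd, so it has no component of degree 0.
    have h1 : ∀ j, L (constSec k hW (xi j)) ∈ secFil k' W 1 := fun j => by
      have : L (constSec k hW (xi j)) ∈ secPar k' W 1 := hL 1 _ fun z => by
        have := grDeg_le_grPar 1 (xi_mem_grDeg j)
        rwa [Nat.cast_one] at this
      refine mem_secFil_iff.mpr fun n hn => secProj_of_mem_par this ?_
      rw [Nat.lt_one_iff.mp hn]
      decide
    have h2 : ((n + 1 : ℕ) : ℂ) • L f ∈ secFil k' W (n + 1) := by
      rw [← map_smul, e, map_sum]
      refine Submodule.sum_mem _ fun j _ => ?_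
      rw [map_mul, add_comm]
      exact secFil_mul (h1 j) (ih (hd j))
    exact (Submodule.smul_mem_iff _ (Nat.cast_ne_zero.mpr n.succ_ne_zero)).mp h2

lemma secFil_anti {a b : ℕ} (h : a ≤ b) : secFil k W b ≤ secFil k W a := fun _ hf =>
  mem_secFil_iff.mpr fun n hn => mem_secFil_iff.mp hf n (hn.trans_le h)

lemma map_mem_secFil (hW : ptInf ∉ W) (L : Sec k W →ₐ[ℂ] Sec k' W)
    (hL : ∀ i, ∀ f ∈ secPar k W i, L f ∈ secPar k' W i) {n : ℕ} {f : Sec k W}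
    (hf : f ∈ secFil k W n) : L f ∈ secFil k' W n := by
  refine fil_induction (P := fun f => L f ∈ secFil k' W n) (fun f g hf hg => ?_) ?_
    (fun n' hn f hf => secFil_anti hn (map_mem_secFil_of_deg hW L hL hf)) hf
  · rw [map_add]; exact Submodule.add_mem _ hf hg
  · rw [map_zero]; exact Submodule.zero_mem _

lemma secEuler_par {i : ZMod 2} {f : Sec k W} (hf : f ∈ secPar k W i) :
    secEuler f ∈ secPar k W i := by
  refine par_induction (P := fun f => secEuler f ∈ secPar k W i) (fun f g hf hg => ?_) ?_
    (fun n hn f hf => ?_) hf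
  · rw [map_add]; exact Submodule.add_mem _ hf hg
  · rw [map_zero]; exact Submodule.zero_mem _
  · rw [secEuler_of_mem hf]
    exact Submodule.smul_mem _ _ (hn ▸ secDeg_le_secPar n hf)

/-- Degree n + 3 is excluded by parity, and all degrees above it exceed 3. -/
lemma mem_secDeg_of_par_fil {n : ℕ} {f : Sec k W} (hp : f ∈ secPar k W n)
    (hf : f ∈ secFil k W (n + 2)) : f ∈ secDeg k W (n + 2) := by
  rw [← sum_secProj f]
  refine Submodule.sum_mem _ fun n' hn' => ?_
  have h4 := Finset.mem_range.mp hn'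
  by_cases h1 : n' < n + 2
  · rw [mem_secFil_iff.mp hf n' h1]; exact Submodule.zero_mem _
  by_cases h2 : n' = n + 2
  · rw [h2]; exact secProj_mem _ f
  · have h3 : n' = n + 3 := by lia
    rw [secProj_of_mem_par hp]
    · exact Submodule.zero_mem _
    · rw [h3]
      push_cast
      rw [show (3 : ZMod 2) = 1 from rfl, Ne, add_eq_left]
      exact one_ne_zero

/-- The leading component of degree n is an eigenvector with eigenvalue n, and the component of
degree n + 1 is absent by parity. -/
lemma secEuler_sub_mem_secFil {n : ℕ} {f : Sec k W} (hp : f ∈ secPar k W n)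
    (hf : f ∈ secFil k W n) : secEuler f - (n : ℂ) • f ∈ secFil k W (n + 2) := by
  have e : f = ∑ n' ∈ Finset.range 4, secProj n' f := (sum_secProj f).symm
  have e2 : secEuler f - (n : ℂ) • f =
      ∑ n' ∈ Finset.range 4, ((n' : ℂ) - n) • secProj n' f := by
    conv_lhs => rw [e]
    rw [map_sum, Finset.smul_sum, ← Finset.sum_sub_distrib]
    refine Finset.sum_congr rfl fun n' _ => ?_
    rw [secEuler_of_mem (secProj_mem n' f), sub_smul]
  rw [e2]
  refine Submodule.sum_mem _ fun n' _ => ?_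
  rcases lt_trichotomy n' n with h | h | h
  · rw [mem_secFil_iff.mp hf n' h, smul_zero]; exact Submodule.zero_mem _
  · rw [h, sub_self, zero_smul]; exact Submodule.zero_mem _
  · by_cases h1 : n' = n + 1
    · rw [secProj_of_mem_par hp, smul_zero]
      · exact Submodule.zero_mem _
      · rw [h1]
        push_cast
        rw [Ne, add_eq_left]
        exact one_ne_zero
    · exact Submodule.smul_mem _ _ (secDeg_le_secFil (by lia) (secProj_mem n' f))

/-- An isomorphism of superalgebras of sections transforms the Euler operator into the Euler
operator up to terms that raise the degree by `2`. -/
lemma conj_euler_sub_mem (hW : ptInf ∉ W) (L : Sec k W ≃ₐ[ℂ] Sec k' W)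
    (hL : ∀ i, ∀ f ∈ secPar k W i, L f ∈ secPar k' W i)
    (hL' : ∀ i, ∀ f ∈ secPar k' W i, L.symm f ∈ secPar k W i) {n : ℕ} {f : Sec k W}
    (hf : f ∈ secDeg k W n) : L.symm (secEuler (L f)) - secEuler f ∈ secDeg k W (n + 2) := by
  have hp := hL n f (secDeg_le_secPar n hf)
  have e : L.symm (secEuler (L f)) - secEuler f = L.symm (secEuler (L f) - (n : ℂ) • L f) := by
    rw [map_sub, map_smul, AlgEquiv.symm_apply_apply, secEuler_of_mem hf]
  rw [e]
  refine mem_secDeg_of_par_fil (hL' n _ ?_) (map_mem_secFil hW L.symm.toAlgHom hL' ?_)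
  · exact Submodule.sub_mem _ (secEuler_par hp) (Submodule.smul_mem _ _ hp)
  · exact secEuler_sub_mem_secFil hp (map_mem_secFil_of_deg hW L.toAlgHom hL hf)

/-! ## Split supermanifolds correspond to the zero class -/

variable {F : SuperSheaf}

/-- The Euler operator in a chart. -/
def eulerOn {U : Opens CP1} (φ : F.IsoOn U (split k)) (h : W ≤ U) : F.Obj W →ₗ[ℂ] F.Obj W :=
  (φ.sec h).symm.toLinearMap ∘ₗ secEuler ∘ₗ (φ.sec h).toLinearMap

lemma eulerOn_apply {U : Opens CP1} (φ : F.IsoOn U (split k)) (h : W ≤ U) (s : F.Obj W) :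
    eulerOn φ h s = (φ.sec h).symm (secEuler (φ.sec h s)) := rfl

lemma sec_res {U W' : Opens CP1} (φ : F.IsoOn U (split k)) (h : W ≤ U) (h' : W' ≤ W)
    (s : F.Obj W) : secRes k h' (φ.sec h s) = φ.sec (h'.trans h) (F.res h' s) :=
  φ.natural W W' h h' s

lemma eulerOn_res {U W' : Opens CP1} (φ : F.IsoOn U (split k)) (h : W ≤ U) (h' : W' ≤ W)
    (s : F.Obj W) : F.res h' (eulerOn φ h s) = eulerOn φ (h'.trans h) (F.res h' s) := by
  apply (φ.sec (h'.trans h)).injective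
  rw [← sec_res φ h h', eulerOn_apply, eulerOn_apply, AlgEquiv.apply_symm_apply,
    AlgEquiv.apply_symm_apply, secEuler_res, sec_res φ h h']

lemma eulerOn_mul {U : Opens CP1} (φ : F.IsoOn U (split k)) (h : W ≤ U) (s t : F.Obj W) :
    eulerOn φ h (s * t) = eulerOn φ h s * t + s * eulerOn φ h t := by
  apply (φ.sec h).injective
  simp only [eulerOn_apply, AlgEquiv.apply_symm_apply, map_add, map_mul, secEuler_mul]

/-- A transition map that preserves degrees commutes with the Euler operator, so the local Euler
operators of an atlas of this kind coincide on overlaps. -/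
lemma eulerOn_eq {U U' : Opens CP1} (φ : F.IsoOn U (split k)) (ψ : F.IsoOn U' (split k))
    (h : W ≤ U) (h' : W ≤ U')
    (ht : ∀ n, ∀ f ∈ secDeg k W n, transition φ ψ W h h' f ∈ secDeg k W n) (s : F.Obj W) :
    eulerOn φ h s = eulerOn ψ h' s := by
  have := secEuler_comm (transition φ ψ W h h').toAlgHom ht (φ.sec h s)
  apply (ψ.sec h').injective
  rw [eulerOn_apply ψ, AlgEquiv.apply_symm_apply]
  refine this.trans ?_
  change secEuler (ψ.sec h' ((φ.sec h).symm (φ.sec h s))) = _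
  rw [AlgEquiv.symm_apply_apply]

/-- On a split supermanifold the Euler operators in the charts are the restrictions of a
vector field. -/
theorem exists_euler {ι : Type} {U : ι → Opens CP1} (φ : ∀ i, F.IsoOn (U i) (split k))
    (hU : ∀ p : CP1, ∃ i, p ∈ U i)
    (hφ : ∀ (i j : ι) (W : Opens CP1) (hi : W ≤ U i) (hj : W ≤ U j) (p : ℕ),
      ∀ f ∈ secDeg k W p, transition (φ i) (φ j) W hi hj f ∈ secDeg k W p) :
    ∃ T : ∀ W, F.Obj W →ₗ[ℂ] F.Obj W,
      (∀ (W W' : Opens CP1) (h : W' ≤ W) s, F.res h (T W s) = T W' (F.res h s)) ∧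
      (∀ W s t, T W (s * t) = T W s * t + s * T W t) ∧
      ∀ (i : ι) (W : Opens CP1) (h : W ≤ U i) s, T W s = eulerOn (φ i) h s := by
  have hV : ∀ W : Opens CP1, W ≤ ⨆ i, W ⊓ U i := fun W p hp => by
    obtain ⟨i, hi⟩ := hU p
    exact Opens.mem_iSup.mpr ⟨i, hp, hi⟩
  have ex : ∀ (W : Opens CP1) (s : F.Obj W), ∃ t : F.Obj W, ∀ i,
      F.res (inf_le_left : W ⊓ U i ≤ W) t = eulerOn (φ i) inf_le_right (F.res inf_le_left s) := by
    intro W s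
    obtain ⟨t, ht, -⟩ := SuperSheaf.existsUnique_glue (F := F) (V := fun i => W ⊓ U i)
      (fun _ => inf_le_left) (hV W)
      (fun i => eulerOn (φ i) (inf_le_right : W ⊓ U i ≤ U i) (F.res inf_le_left s)) (fun i j => by
        rw [eulerOn_res, eulerOn_res, SuperSheaf.res_res, SuperSheaf.res_res]
        exact eulerOn_eq _ _ _ _ (hφ i j _ _ _) _)
    exact ⟨t, ht⟩
  choose t ht using ex
  have uniq : ∀ (W : Opens CP1) (s u : F.Obj W), (∀ i, F.res (inf_le_left : W ⊓ U i ≤ W) u =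
      eulerOn (φ i) inf_le_right (F.res inf_le_left s)) → t W s = u := fun W s u h =>
    SuperSheaf.eq_of_res_eq (V := fun i => W ⊓ U i) (fun _ => inf_le_left) (hV W)
      fun i => (ht W s i).trans (h i).symm
  refine ⟨fun W =>
    { toFun := t W
      map_add' := fun a b => uniq _ _ _ fun i => by simp only [map_add, ht]
      map_smul' := fun c a => uniq _ _ _ fun i => by simp only [map_smul, ht, RingHom.id_apply] },
    fun W W' h s => ?_, fun W s u => ?_, fun i W h s => ?_⟩
  · refine (uniq W' (F.res h s) (F.res h (t W s)) fun i => ?_).symm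
    have h1 : W' ⊓ U i ≤ W ⊓ U i := inf_le_inf_right _ h
    rw [SuperSheaf.res_res, SuperSheaf.res_res,
      ← SuperSheaf.res_res (inf_le_left : W ⊓ U i ≤ W) h1, ht, eulerOn_res, SuperSheaf.res_res]
  · refine uniq W (s * u) (t W s * u + s * t W u) fun i => ?_
    rw [map_add, map_mul, map_mul, ht, ht, map_mul, eulerOn_mul]
  · exact uniq W s _ fun i' => by
      rw [eulerOn_res]
      exact eulerOn_eq _ _ _ _ (hφ i i' _ _ _) _

/-- In a chart of the supermanifold, a vector field that restricts to Euler operators is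
the Euler operator plus a vector field of degree `2`. -/
theorem exists_vect_of_euler {ι : Type} {U : ι → Opens CP1} (φ : ∀ i, F.IsoOn (U i) (split k'))
    (hU : ∀ p : CP1, ∃ i, p ∈ U i) {T : ∀ W, F.Obj W →ₗ[ℂ] F.Obj W}
    (hres : ∀ (W W' : Opens CP1) (h : W' ≤ W) s, F.res h (T W s) = T W' (F.res h s))
    (hmul : ∀ W s t, T W (s * t) = T W s * t + s * T W t)
    (hT : ∀ (i : ι) (W : Opens CP1) (h : W ≤ U i) s, T W s = eulerOn (φ i) h s)
    (ψ : F.IsoOn V (split k)) :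
    ∃ u : Vect k 2 V, ∀ (W : Opens CP1) (h : W ≤ V) (f : Sec k W),
      ψ.sec h (T W ((ψ.sec h).symm f)) = secEuler f + u.1 ⟨W, h⟩ f := by
  let D : OpFam k V := fun W =>
    (ψ.sec W.2).toLinearMap ∘ₗ T W.1 ∘ₗ (ψ.sec W.2).symm.toLinearMap - secEuler
  have hD : ∀ (W : Opens CP1) (h : W ≤ V) (f : Sec k W),
      D ⟨W, h⟩ f = ψ.sec h (T W ((ψ.sec h).symm f)) - secEuler f := fun _ _ _ => rfl
  have nat : ∀ (W W' : {W : Opens CP1 // W ≤ V}) (h : W'.1 ≤ W.1) (f : Sec k W.1),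
      secRes k h (D W f) = D W' (secRes k h f) := by
    rintro ⟨W, hW⟩ ⟨W', hW'⟩ h f
    have e : F.res h ((ψ.sec hW).symm f) = (ψ.sec hW').symm (secRes k h f) := by
      rw [AlgEquiv.eq_symm_apply, ← sec_res ψ hW h, AlgEquiv.apply_symm_apply]
    rw [hD, hD, map_sub, secEuler_res, sec_res ψ hW h, hres, e]
  refine ⟨⟨D, nat, ?_, ?_⟩, fun W h f => ?_⟩
  · rintro ⟨W, hW⟩ f g
    rw [hD, hD, hD, map_mul, hmul, map_add, map_mul, map_mul, AlgEquiv.apply_symm_apply,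
      AlgEquiv.apply_symm_apply, secEuler_mul, sub_mul, mul_sub]
    abel
  · rintro ⟨W, hW⟩ n f hf z
    obtain ⟨i, hi⟩ := hU (pt z)
    -- The degree is tested pointwise at points with finite coordinate, so it suffices to work near
    -- z: inside U i the operator T is an Euler operator, and inside `U0` the ξ_j are sections, as
    -- the filtration argument requires.
    let W' : Opens CP1 := W ⊓ U i ⊓ U0
    have h1 : W' ≤ W := inf_le_left.trans inf_le_left
    have h2 : W' ≤ U i := inf_le_left.trans inf_le_right
    have hi' : ptInf ∉ W' := fun h => ptInf_notMem_U0 h.2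
    have h3 := nat ⟨W, hW⟩ ⟨W', h1.trans hW⟩ h1 f
    have h4 : D ⟨W', h1.trans hW⟩ (secRes k h1 f) ∈ secDeg k W' (n + 2) := by
      rw [hD, hT i W' h2]
      exact conj_euler_sub_mem hi' ((ψ.sec (h1.trans hW)).symm.trans ((φ i).sec h2))
        (fun j f hf => (φ i).map_par _ _ _ _ (ψ.symm.map_par _ _ _ _ hf))
        (fun j f hf => ψ.map_par _ _ _ _ ((φ i).symm.map_par _ _ _ _ hf))
        (fun z => hf ⟨z.1, h1 z.2⟩)
    rw [← h3] at h4
    exact h4 ⟨z.1, ⟨z.2, hi⟩, pt_mem_U0 z⟩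
  · change _ = secEuler f + D ⟨W, h⟩ f
    rw [hD, add_sub_cancel]

/-- In the two charts the global Euler derivation reads E + u₀ and E + u₁. The charts differ by id +
v, so E + u₀ = (id + v)(E + u₁)(id - v) = E + u₁ - [E, v], where [E, v] = 2v since v raises the
degree by 2. -/
theorem mem_B1_of_isSplit {v : Vect k 2 U01} (hF : CorrespondsTo v F) (hs : IsSplit 3 F) :
    v ∈ B1 k := by
  obtain ⟨ψ₀, ψ₁, hψ⟩ := hF
  obtain ⟨ι, U, φ, hU, hφ⟩ := hs
  obtain ⟨T, hres, hmul, hT⟩ := exists_euler φ hU hφ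
  obtain ⟨u₀, hu₀⟩ := exists_vect_of_euler φ hU hres hmul hT ψ₀
  obtain ⟨u₁, hu₁⟩ := exists_vect_of_euler φ hU hres hmul hT ψ₁
  refine mem_B1_iff.mpr ⟨-(2⁻¹ : ℂ) • u₀, (2⁻¹ : ℂ) • u₁, Subtype.ext (OpFam.ext ?_)⟩
  rintro ⟨W, hW⟩ f
  have h0 : W ≤ U0 := hW.trans U01_le_U0
  have h1 : W ≤ U1 := hW.trans U01_le_U1
  change -(2⁻¹ : ℂ) • u₀.1 ⟨W, h0⟩ f + (2⁻¹ : ℂ) • u₁.1 ⟨W, h1⟩ f = v.1 ⟨W, hW⟩ f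
  induction f using sec_induction with
  | hadd f g hf hg =>
    rw [map_add, map_add, map_add, ← hf, ← hg]
    module
  | h0 => simp only [map_zero, smul_zero, add_zero]
  | h n f hf =>
    have hv : v.1 ⟨W, hW⟩ f ∈ secDeg k W (n + 2) := v.2.2.2 ⟨W, hW⟩ n f hf
    -- The inverse of id + v is id - v.
    have e : (ψ₀.sec h0).symm f = (ψ₁.sec h1).symm (f - v.1 ⟨W, hW⟩ f) := by
      rw [AlgEquiv.symm_apply_eq, CorrespondsTo.apply hψ hW h0 h1, AlgEquiv.apply_symm_apply,
        map_sub, vect_vect, sub_zero, sub_add_cancel]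
    have e0 := hu₀ W h0 f
    rw [e, CorrespondsTo.apply hψ hW h0 h1, hu₁, map_sub secEuler, secEuler_of_mem hf,
      secEuler_of_mem hv, map_sub, vect_vect, map_add, map_sub, map_sub, map_smul, map_smul,
      vect_vect, vect_vect, sub_zero, map_zero, smul_zero, sub_zero, sub_zero, add_zero] at e0
    -- On degree n the Euler operator contributes n v(f) - (n + 2) v(f) = -2 v(f).
    have e1 : u₀.1 ⟨W, h0⟩ f = u₁.1 ⟨W, h1⟩ f - (2 : ℂ) • v.1 ⟨W, hW⟩ f := by
      rw [eq_sub_of_add_eq' e0.symm]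
      push_cast
      module
    rw [e1]
    module

end

/-! ### The classification. -/

/-- If the invariant classes are the multiples of the non-zero class of `v₀`, there is exactly one
non-split supermanifold up to isomorphism. -/
theorem exists_unique_nonsplit {k : ℤ} {v₀ : Vect (kkk k) 2 U01}
    (hi : (Submodule.Quotient.mk v₀ : H1 (kkk k)) ∈ H1.invariants (sPP k)) (h0 : v₀ ∉ B1 (kkk k))
    (h : ∀ v : Vect (kkk k) 2 U01, adv (eField k) v ∈ B1 (kkk k) → adv (fField k) v ∈ B1 (kkk k) →
      ∃ c : ℂ, v + -c • v₀ ∈ B1 (kkk k)) :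
    ∃ M : SuperSheaf, IsNonsplitSPP k M ∧ CorrespondsTo v₀ M ∧
      ∀ N : SuperSheaf, IsNonsplitSPP k N → Isomorphic N M := by
  have hM := glued_correspondsTo v₀
  refine ⟨glued v₀, ⟨hM.isSupermanifold, hM.hasRetract, fun hs => h0 (mem_B1_of_isSplit hM hs),
    v₀, hi, hM⟩, hM, ?_⟩
  rintro N ⟨-, -, hs, v, hv, hN⟩
  obtain ⟨he, hf⟩ := mem_invariants_sPP_iff.mp hv
  obtain ⟨c, hc⟩ := h v he hf
  -- The factor c is nonzero, since otherwise the class of v would vanish and N would be split.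
  refine isomorphic_of_correspondsTo hN hM (fun hc0 => hs (isSplit_of_mem_B1 hN ?_)) hc
  rwa [hc0, neg_zero, zero_smul, add_zero] at hc

end

end CP1Super

end

theorem mainTheorem4 :
    (∃ M : CP1Super.SuperSheaf,
      CP1Super.IsNonsplitSPP 2 M ∧ CP1Super.CorrespondsTo CP1Super.cocycle1 M ∧
        ∀ N : CP1Super.SuperSheaf, CP1Super.IsNonsplitSPP 2 N → CP1Super.Isomorphic N M) ∧
    (∃ M : CP1Super.SuperSheaf,
      CP1Super.IsNonsplitSPP 3 M ∧ CP1Super.CorrespondsTo CP1Super.cocycle2 M ∧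
        ∀ N : CP1Super.SuperSheaf, CP1Super.IsNonsplitSPP 3 N → CP1Super.Isomorphic N M) ∧
    (∀ k : ℤ, k ≠ 2 → k ≠ 3 → ¬ ∃ M : CP1Super.SuperSheaf, CP1Super.IsNonsplitSPP k M) := by
  refine ⟨CP1Super.exists_unique_nonsplit CP1Super.cocycle1_invariant CP1Super.cocycle1_notMem_B1
    fun v he hf => CP1Super.exists_sub_smul_cocycle1_mem_B1 he hf,
    CP1Super.exists_unique_nonsplit CP1Super.cocycle2_invariant CP1Super.cocycle2_notMem_B1
    fun v he hf => CP1Super.exists_sub_smul_cocycle2_mem_B1 he hf, ?_⟩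
  rintro k h2 h3 ⟨M, -, -, hs, v, hv, hM⟩
  apply hs
  apply CP1Super.isSplit_of_mem_B1 hM
  -- For k ≤ 1 the cohomology itself vanishes; for k ≥ 4 only its invariants do.
  by_cases h : k ≤ 1
  · exact CP1Super.mem_B1_of_le_one h v
  · obtain ⟨he, hf⟩ := CP1Super.mem_invariants_sPP_iff.mp hv
    exact CP1Super.mem_B1_of_four_le (by lia) he hf
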